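/- **Setting.** Let $n,m\ge 0$ and $r\ge 1$ be integers. Let $A\in\mathbb R^{n\times n}$, $B\in\mathbb R^{n\times m}$, $C\in\mathbb R^{m\times n}$ be such that the system $\dot x=Ax+Bu$, $y=Cx$ belongs to the class $\Sigma_{m,r}$, that is: * (strict relative degree $r$) $CA^kB=0$ for $k=0,\dots,r-2$, and $\Gamma:=CA^{r-1}B$ is invertible; * (minimum phase) $\operatorname{rk}\begin{bmatrix}A-\lambda I_n&B\\C&0\end{bmatrix}=n+m$ for all $\lambda\in\mathbb C$ with $\operatorname{Re}\lambda\ge0$; * $\Gamma$ is positive definite, in the sense that $v^\top\Gamma v>0$ for all $v\neq0$ ($\Gamma$ need not be symmetric). Let $\alpha\in\mathbb R[s]$ be monic of degree $p$ such that the above rank equals $n+m$ at every $\lambda\in\mathbb C$ with $\alpha(\lambda)=0$, and let $$\mathcal R(\alpha)=\{w\in C^\infty(\mathbb R_{\ge0},\mathbb R^m) : \alpha(\tfrac{d}{dt})w=0\}.$$ Let $(\tilde A,\tilde B,\tilde C,I_m)$ be an internal model of $\mathcal R(\alpha)$: $\tilde A=\operatorname{diag}(\hat A,\dots,\hat A)\in\mathbb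 R^{mp\times mp}$, $\tilde B=\operatorname{diag}(\hat b,\dots,\hat b)\in\mathbb R^{mp\times m}$, $\tilde C=\operatorname{diag}(\hat c,\dots,\hat c)\in\mathbb R^{m\times mp}$, where $(\hat A,\hat b,\hat c,1)$ with $\hat A\in\mathbb R^{p\times p}$ is a minimal (controllable and observable) realization of $\beta/\alpha$, for some $\beta\in\mathbb R[s]$ all of whose roots have negative real part, which is coprime to $\alpha$, has degree $p$, and satisfies $\lim_{s\to\infty}\beta(s)/\alpha(s)=1$. Let $\Phi$ be the set of $\varphi\in C^1(\mathbb R_{\ge0},\mathbb R)$ with $\varphi,\dot\varphi$ bounded, $\varphi(t)>0$ for $t>0$ and $\liminf_{t\to\infty}\varphi(t)>0$. Let $x^0\in\mathbb R^n$, $z^0\in\mathbb R^{mp}$, $y_{\rm ref}\in\mathcal R(\alpha)$, $\varphi_1,\dots,\varphi_r\in\Phi$ and $k_1,\dots,k_{r-1}>0$. For $k_r>0$ consider the closed loop $$\dot x=Ax+Bu,\quad y=Cx,\quad \dot z=\tilde Az+\tilde Bw,\quad u=\tilde Cz+w,\quad x(0)=x^0,\ z(0)=z^0,$$ $$e_1=e=y-y_{\rm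 ref},\quad e_{i+1}=\dot e_i+k_ie_i\ (1\le i\le r-1),\quad k(t)=\frac{k_r}{1-\varphi_r(t)^2\|e_r(t)\|^2},\quad w(t)=-k(t)e_r(t).$$ Assume * (K1) $k_i>\big\|\dot\varphi_i/\varphi_i\big\|_\infty+\big\|\varphi_i/\varphi_{i+1}\big\|_\infty$ for $i=1,\dots,r-1$; * (K2) $\varphi_i(0)\|e_i(0)\|<1$ for $i=1,\dots,r$, where $e_i(0)$ is computed from the initial data by $y^{(j)}(0)=CA^jx^0$ for $0\le j\le r-1$. A solution on $[0,\omega)$, $\omega\in(0,\infty]$, is a locally absolutely continuous $(x,z):[0,\omega)\to\mathbb R^n\times\mathbb R^{mp}$ which attains the initial values, for which $k(t)$ is well defined for all $t\in[0,\omega)$, and which satisfies the differential equations for almost all $t\in[0,\omega)$. It is maximal if it has no proper right extension that is also a solution. **Theorem.** For every $k_r>0$ the closed loop has a unique maximal solution $(x,z):[0,\omega)\to\mathbb R^n\times\mathbb R^{mp}$, and 1. $\omega=\infty$; 2. for each $i=1,\dots,r$ there is $\varepsilon_i\in(0,1)$ with $\varphi_i(t)\|e_i(t)\|\le\varepsilon_i$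 for all $t\ge0$; 3. $k$ is bounded, and if $y_{\rm ref}$ is bounded, then $x$, $z$ and $u$ are bounded; 4. if $k_r$ is sufficiently large (that is, $k_r\ge k_r^*$ for some $k_r^*>0$ that depends on the data above but not on $k_r$), then $\lim_{t\to\infty}e^{(i)}(t)=0$ for all $i=0,\dots,r-1$. -/

import Mathlib

open Set Filter Topology MeasureTheory Matrix Polynomial
open scoped ENNReal

noncomputable section

namespace FunnelIM

/-- The Rosenbrock matrix `[A - λ I, B; C, 0]` of `(A, B, C)` at a complex number `λ`. -/
def rosenbrock {n m : ℕ} (A : Matrix (Fin n) (Fin n) ℝ) (B : Matrix (Fin n) (Fin m) ℝ)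
    (C : Matrix (Fin m) (Fin n) ℝ) (l : ℂ) : Matrix (Fin n ⊕ Fin m) (Fin n ⊕ Fin m) ℂ :=
  fromBlocks (A.map Complex.ofReal - l • (1 : Matrix (Fin n) (Fin n) ℂ))
    (B.map Complex.ofReal) (C.map Complex.ofReal) 0

/-- Strict relative degree `r`: `C A^k B = 0` for `k = 0, …, r - 2`, and `C A^(r-1) B` is
invertible. -/
def HasStrictRelDegree {n m : ℕ} (A : Matrix (Fin n) (Fin n) ℝ) (B : Matrix (Fin n) (Fin m) ℝ)
    (C : Matrix (Fin m) (Fin n) ℝ) (r : ℕ) : Prop :=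
  (∀ k : ℕ, k + 2 ≤ r → C * A ^ k * B = 0) ∧ IsUnit (C * A ^ (r - 1) * B)

/-- Minimum phase: the Rosenbrock matrix has full rank on the closed right half plane. -/
def IsMinimumPhase {n m : ℕ} (A : Matrix (Fin n) (Fin n) ℝ) (B : Matrix (Fin n) (Fin m) ℝ)
    (C : Matrix (Fin m) (Fin n) ℝ) : Prop :=
  ∀ l : ℂ, 0 ≤ l.re → (rosenbrock A B C l).rank = n + m

/-- The system class `Σ_{m,r}`. Positive definiteness of `Γ = C A^(r-1) B` means `vᵀ Γ v > 0` for
all `v ≠ 0`; symmetry of `Γ` is not required. -/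
structure InSystemClass {n m : ℕ} (A : Matrix (Fin n) (Fin n) ℝ) (B : Matrix (Fin n) (Fin m) ℝ)
    (C : Matrix (Fin m) (Fin n) ℝ) (r : ℕ) : Prop where
  relDegree : HasStrictRelDegree A B C r
  minPhase : IsMinimumPhase A B C
  posDef : ∀ v : Fin m → ℝ, v ≠ 0 → 0 < v ⬝ᵥ ((C * A ^ (r - 1) * B) *ᵥ v)

/-- No root of `α` is a zero of `(A, B, C)`: the Rosenbrock matrix has full rank at each complex
root of `α`. -/
def RootsAvoidZeros {n m : ℕ} (A : Matrix (Fin n) (Fin n) ℝ) (B : Matrix (Fin n) (Fin m) ℝ)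
    (C : Matrix (Fin m) (Fin n) ℝ) (α : ℝ[X]) : Prop :=
  ∀ l : ℂ, aeval l α = 0 → (rosenbrock A B C l).rank = n + m

/-- The reference class `R(α)`: smooth functions `w` on `[0, ∞)` with `α(d/dt) w = 0`. A function
on `[0, ∞)` is represented by a function on `ℝ` whose values off `[0, ∞)` play no role. -/
def RefClass (m : ℕ) (α : ℝ[X]) : Set (ℝ → EuclideanSpace ℝ (Fin m)) :=
  {w | ContDiffOn ℝ ((⊤ : ℕ∞) : WithTop ℕ∞) w (Ici 0) ∧
    ∀ t, 0 ≤ t → ∑ j ∈ Finset.range (α.natDegree + 1),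
      α.coeff j • iteratedDerivWithin j w (Ici 0) t = 0}

/-- A real polynomial is Hurwitz if all its complex roots have negative real part. -/
def IsHurwitz (β : ℝ[X]) : Prop := ∀ l : ℂ, aeval l β = 0 → l.re < 0

/-- `(Â, b̂, ĉ, 1)` is a minimal (controllable and observable) realization of `β / α`, that is,
`ĉ (s I - Â)⁻¹ b̂ + 1 = β(s) / α(s)` as rational functions. -/
structure IsMinimalRealization {p : ℕ} (α β : ℝ[X]) (Ah : Matrix (Fin p) (Fin p) ℝ)
    (bh ch : Fin p → ℝ) : Prop where
  transfer :
    (fun i => algebraMap ℝ (RatFunc ℝ) (ch i)) ⬝ᵥ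
        (((charmatrix Ah).map (algebraMap ℝ[X] (RatFunc ℝ)))⁻¹ *ᵥ
          fun i => algebraMap ℝ (RatFunc ℝ) (bh i)) + 1
      = algebraMap ℝ[X] (RatFunc ℝ) β / algebraMap ℝ[X] (RatFunc ℝ) α
  controllable : Submodule.span ℝ (range fun i : ℕ => (Ah ^ i) *ᵥ bh) = ⊤
  observable : ∀ v : Fin p → ℝ, (∀ i : ℕ, ch ⬝ᵥ ((Ah ^ i) *ᵥ v) = 0) → v = 0

/-- `(Ã, B̃, C̃, I_m)` is an internal model of the class `R(α)`: for some Hurwitz polynomial `β`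
coprime to `α`, of the same degree `p`, with `β(s) / α(s) → 1` as `s → ∞`, and some minimal
realization `(Â, b̂, ĉ, 1)` of `β / α` of order `p`, the matrices are block diagonal with `m` copies
of `Â`, `b̂`, `ĉ`. The state space `ℝ^{mp}` is indexed by pairs (position in the block, block). -/
def IsInternalModel {m p : ℕ} (α : ℝ[X]) (At : Matrix (Fin p × Fin m) (Fin p × Fin m) ℝ)
    (Bt : Matrix (Fin p × Fin m) (Fin m) ℝ) (Ct : Matrix (Fin m) (Fin p × Fin m) ℝ) : Prop :=
  ∃ (β : ℝ[X]) (Ah : Matrix (Fin p) (Fin p) ℝ) (bh ch : Fin p → ℝ),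
    IsHurwitz β ∧ IsCoprime α β ∧ α.degree = (p : WithBot ℕ) ∧ β.degree = (p : WithBot ℕ) ∧
    Tendsto (fun s : ℝ => β.eval s / α.eval s) atTop (𝓝 1) ∧
    IsMinimalRealization α β Ah bh ch ∧
    At = blockDiagonal (fun _ : Fin m => Ah) ∧
    Bt = Matrix.of (fun (i : Fin p × Fin m) (j : Fin m) => if i.2 = j then bh i.1 else 0) ∧
    Ct = Matrix.of (fun (j : Fin m) (i : Fin p × Fin m) => if j = i.2 then ch i.1 else 0)

/-- The class `Φ` of funnel functions on `[0, ∞)`. -/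
structure IsFunnel (φ : ℝ → ℝ) : Prop where
  contDiffOn : ContDiffOn ℝ 1 φ (Ici 0)
  bounded : ∃ M, ∀ t, 0 ≤ t → |φ t| ≤ M
  deriv_bounded : ∃ M, ∀ t, 0 ≤ t → |derivWithin φ (Ici 0) t| ≤ M
  pos : ∀ t, 0 < t → 0 < φ t
  liminf_pos : 0 < liminf φ atTop

/-- The supremum norm over `(0, ∞)`, with value `∞` for unbounded functions. -/
def supNorm (f : ℝ → ℝ) : ℝ≥0∞ := ⨆ t ∈ Ioi (0 : ℝ), ‖f t‖ₑ

/-- The half-open time interval `[0, ω)`. -/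
def timeDomain (ω : EReal) : Set ℝ := {t | 0 ≤ t ∧ (t : EReal) < ω}

/-- The data of the closed loop, except for the gain `k_r`: the system `(A, B, C)`, the internal
model `(At, Bt, Ct, I)`, the initial values, the reference signal, and the gains and funnel
functions of the controller. Indices start at `0`: `k i` is the gain `k_{i+1}` for
`i = 0, …, r - 2`, and `φ i` is the funnel function `φ_{i+1}` for `i = 0, …, r - 1`. -/
structure LoopData (n m p : ℕ) where
  A : Matrix (Fin n) (Fin n) ℝ
  B : Matrix (Fin n) (Fin m) ℝ
  C : Matrix (Fin m) (Fin n) ℝ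
  r : ℕ
  At : Matrix (Fin p × Fin m) (Fin p × Fin m) ℝ
  Bt : Matrix (Fin p × Fin m) (Fin m) ℝ
  Ct : Matrix (Fin m) (Fin p × Fin m) ℝ
  x0 : EuclideanSpace ℝ (Fin n)
  z0 : EuclideanSpace ℝ (Fin p × Fin m)
  yref : ℝ → EuclideanSpace ℝ (Fin m)
  k : ℕ → ℝ
  φ : ℕ → ℝ → ℝ

namespace LoopData

variable {n m p : ℕ} (S : LoopData n m p)

/-- The tracking error `e = y - y_ref` with `y = C x`. -/
def trackErr (x : ℝ → EuclideanSpace ℝ (Fin n)) (t : ℝ) : EuclideanSpace ℝ (Fin m) :=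
  toEuclideanLin S.C (x t) - S.yref t

/-- The auxiliary errors on `[0, ω)`: `auxErr ω x i` is the signal `e_{i+1}`, with `e_1 = e` and
`e_{i+1} = d/dt e_i + k_i e_i`. -/
def auxErr (ω : EReal) (x : ℝ → EuclideanSpace ℝ (Fin n)) : ℕ → ℝ → EuclideanSpace ℝ (Fin m)
  | 0 => S.trackErr x
  | i + 1 => fun t =>
      derivWithin (auxErr ω x i) (timeDomain ω) t + S.k i • auxErr ω x i t

/-- `initErr i j` is the `j`-th derivative of `e_{i+1}` at time `0`, computed from the initial value
`x0` by differentiating the recursion `e_{i+1} = d/dt e_i + k_i e_i`; here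
`y^{(j)}(0) = C A^j x0` for `j ≤ r - 1`, by the strict relative degree `r`. -/
def initErr : ℕ → ℕ → EuclideanSpace ℝ (Fin m)
  | 0, j => toEuclideanLin (S.C * S.A ^ j) S.x0 - iteratedDerivWithin j S.yref (Ici 0) 0
  | i + 1, j => initErr i (j + 1) + S.k i • initErr i j

/-- Condition (K1): `k_i > ‖φ_i' / φ_i‖_∞ + ‖φ_i / φ_{i+1}‖_∞` for `i = 1, …, r - 1`. -/
def K1 : Prop :=
  ∀ i, i + 1 < S.r →
    supNorm (fun t => derivWithin (S.φ i) (Ici 0) t / S.φ i t) +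
      supNorm (fun t => S.φ i t / S.φ (i + 1) t) < ENNReal.ofReal (S.k i)

/-- Condition (K2): `φ_i(0) ‖e_i(0)‖ < 1` for `i = 1, …, r`. -/
def K2 : Prop := ∀ i, i < S.r → S.φ i 0 * ‖S.initErr i 0‖ < 1

/-- The last auxiliary error `e_r`. -/
def lastErr (ω : EReal) (x : ℝ → EuclideanSpace ℝ (Fin n)) (t : ℝ) : EuclideanSpace ℝ (Fin m) :=
  S.auxErr ω x (S.r - 1) t

/-- The denominator `1 - φ_r(t)² ‖e_r(t)‖²` of the gain. -/
def gainDenom (ω : EReal) (x : ℝ → EuclideanSpace ℝ (Fin n)) (t : ℝ) : ℝ :=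
  1 - S.φ (S.r - 1) t ^ 2 * ‖S.lastErr ω x t‖ ^ 2

/-- The gain `k(t) = k_r / (1 - φ_r(t)² ‖e_r(t)‖²)`. -/
def gain (kr : ℝ) (ω : EReal) (x : ℝ → EuclideanSpace ℝ (Fin n)) (t : ℝ) : ℝ :=
  kr / S.gainDenom ω x t

/-- The output `w = -k e_r` of the funnel controller. -/
def ctrl (kr : ℝ) (ω : EReal) (x : ℝ → EuclideanSpace ℝ (Fin n)) (t : ℝ) :
    EuclideanSpace ℝ (Fin m) :=
  -(S.gain kr ω x t • S.lastErr ω x t)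

/-- The output `u = C̃ z + w` of the internal model, which is the input of the system. -/
def input (kr : ℝ) (ω : EReal) (x : ℝ → EuclideanSpace ℝ (Fin n))
    (z : ℝ → EuclideanSpace ℝ (Fin p × Fin m)) (t : ℝ) : EuclideanSpace ℝ (Fin m) :=
  toEuclideanLin S.Ct (z t) + S.ctrl kr ω x t

/-- `(x, z)` is a solution on `[0, ω)` of the closed loop: it is locally absolutely continuous,
attains the initial values, the gain is well defined, and the differential equations hold almost
everywhere. -/
structure IsSolution (kr : ℝ) (ω : EReal) (x : ℝ → EuclideanSpace ℝ (Fin n))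
    (z : ℝ → EuclideanSpace ℝ (Fin p × Fin m)) : Prop where
  pos : 0 < ω
  ac_x : ∀ b ∈ timeDomain ω, AbsolutelyContinuousOnInterval x 0 b
  ac_z : ∀ b ∈ timeDomain ω, AbsolutelyContinuousOnInterval z 0 b
  init_x : x 0 = S.x0
  init_z : z 0 = S.z0
  gain_defined : ∀ t ∈ timeDomain ω, S.gainDenom ω x t ≠ 0
  ode_x : ∀ᵐ t : ℝ, t ∈ timeDomain ω →
    HasDerivAt x (toEuclideanLin S.A (x t) + toEuclideanLin S.B (S.input kr ω x z t)) t
  ode_z : ∀ᵐ t : ℝ, t ∈ timeDomain ω →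
    HasDerivAt z (toEuclideanLin S.At (z t) + toEuclideanLin S.Bt (S.ctrl kr ω x t)) t

/-- A solution is maximal if it has no proper right extension that is also a solution. -/
def IsMaximalSolution (kr : ℝ) (ω : EReal) (x : ℝ → EuclideanSpace ℝ (Fin n))
    (z : ℝ → EuclideanSpace ℝ (Fin p × Fin m)) : Prop :=
  S.IsSolution kr ω x z ∧
    ∀ (ω' : EReal) (x' : ℝ → EuclideanSpace ℝ (Fin n))
      (z' : ℝ → EuclideanSpace ℝ (Fin p × Fin m)),
      ω < ω' → S.IsSolution kr ω' x' z' →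
        ¬ (EqOn x' x (timeDomain ω) ∧ EqOn z' z (timeDomain ω))

end LoopData

/-- Boundedness of a signal on `[0, ∞)`. -/
def BoundedSignal {E : Type*} [Norm E] (f : ℝ → E) : Prop := ∃ M : ℝ, ∀ t, 0 ≤ t → ‖f t‖ ≤ M

end FunnelIM

end

/-! Adjoin the internal model to the plant. With joint state (x, z) and input w, the interconnection
(𝒜, ℬ, 𝒞) again has relative degree r and the same Γ. Because no root of α is a zero of the plant,
the map from ker α(𝒜) to output jets of order p is injective, and a dimension count makes it
bijective. So every reference in R(α) is an output of the undriven interconnection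
(`exists_reference_trajectory`). Subtracting such a trajectory Xr from the joint state turns
tracking into stabilization: the deviation E obeys E' = 𝒜E - kℬLE, where e_r = LE.

The output L has relative degree one, with Lℬ = Γ positive definite. An unstable mode of the zero
dynamics on ker L would be an unstable zero of the plant, a root of β, or one of the -k_i, and none
of these lies in the closed right half plane. A Lyapunov form for the zero dynamics plus ‖Lv‖² is
then an energy W with W' ≤ -cW + (C - 2kγ)‖Lv‖² (`exists_energy`), where c, C, γ do not involve the
gain. Three consequences follow: growth at a rate independent of k, boundedness of E as long as LE
is bounded, and exponential decay once 2kγ ≥ C. Since k ≥ k_r, the last one yields k_r^*.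

For global existence the denominator of the gain is cut off from below at some δ > 0. The resulting
field is globally Lipschitz and has a global solution. The a priori bounds on E do not depend on δ,
so δ can be taken so small that the feedback at the cutoff level outweighs everything else. A
barrier argument shows that the cutoff is never reached (`exists_funnel_solution`). The remaining
errors satisfy e_i' = e_{i+1} - k_i e_i, and (K1) passes the funnel bound down from e_{i+1} to e_i
(`exists_funnel_bound_of_cascade`).

For uniqueness, the input does not enter the derivatives of e_1, …, e_{r-1}, so every absolutely
continuous solution is classical and has a positive denominator (`IsSolution.classical`). It agrees
with the global solution by Lipschitz uniqueness, and a maximal solution is therefore global. -/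

namespace FunnelIM

/-! ### Hurwitz matrices and Lyapunov functions -/

section Lyapunov

variable {ι : Type*} [Fintype ι] [DecidableEq ι]

attribute [local instance] Matrix.linftyOpNormedRing Matrix.linftyOpNormedAlgebra in
/-- Powers of a complex matrix whose spectrum lies in the open unit disc tend to zero. -/
theorem tendsto_pow_zero_of_spectrum (M : Matrix ι ι ℂ) (hM : ∀ l ∈ spectrum ℂ M, ‖l‖ < 1) :
    Tendsto (fun k : ℕ => M ^ k) atTop (𝓝 0) := by
  cases isEmpty_or_nonempty ι with
  | inl h =>
    have : ∀ k, M ^ k = 0 := fun k => Subsingleton.elim _ _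
    simp [this]
  | inr h =>
    have hlt : spectralRadius ℂ M < ((1 : NNReal) : ℝ≥0∞) :=
      spectrum.spectralRadius_lt_of_forall_lt M (fun l hl => by
        have := hM l hl
        rw [← NNReal.coe_lt_coe]; simpa using this)
    -- By Gelfand's formula ‖M^k‖^(1/k) tends to the spectral radius, so a q between the radius and
    -- 1 gives ‖M^k‖ ≤ q^k eventually.
    obtain ⟨q, hq1, hq2⟩ := exists_between hlt
    have hq : ∀ᶠ k : ℕ in atTop, (‖M ^ k‖₊ : ℝ≥0∞) ^ (1 / k : ℝ) < q :=
      (spectrum.pow_nnnorm_pow_one_div_tendsto_nhds_spectralRadius M).eventually_lt_const hq1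
    lift q to NNReal using (hq2.trans ENNReal.coe_lt_top).ne
    have hq' : ∀ᶠ k : ℕ in atTop, ‖M ^ k‖ ≤ (q : ℝ) ^ k := by
      filter_upwards [hq, eventually_gt_atTop 0] with k hk hk0
      have hk0' : (0 : ℝ) < k := by exact_mod_cast hk0
      have h1 := ENNReal.rpow_lt_rpow hk hk0'
      rw [← ENNReal.rpow_mul, one_div_mul_cancel hk0'.ne', ENNReal.rpow_one,
        ENNReal.rpow_natCast] at h1
      have h2 : ‖M ^ k‖₊ < q ^ k := by exact_mod_cast h1
      exact_mod_cast h2.le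
    refine squeeze_zero_norm' hq' ?_
    apply tendsto_pow_atTop_nhds_zero_of_lt_one q.2
    exact_mod_cast hq2

/-- |1 + hl|² = 1 + h(2 Re l + h|l|²), and the bracket is negative for small h > 0: a short explicit
Euler step moves a stable eigenvalue into the unit disc. -/
theorem norm_one_add_mul_lt_one {l : ℂ} (hl : l.re < 0) :
    ∀ᶠ h : ℝ in 𝓝[>] 0, ‖1 + (h : ℂ) * l‖ < 1 := by
  have h1 : ∀ᶠ h : ℝ in 𝓝[>] 0, h * ‖l‖ ^ 2 < -2 * l.re := by
    have : Tendsto (fun h : ℝ => h * ‖l‖ ^ 2) (𝓝[>] 0) (𝓝 (0 * ‖l‖ ^ 2)) :=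
      ((continuous_id.mul continuous_const).tendsto 0).mono_left nhdsWithin_le_nhds
    rw [zero_mul] at this
    exact this.eventually_lt_const (by linarith)
  filter_upwards [h1, self_mem_nhdsWithin] with h hh hpos
  have hpos : 0 < h := hpos
  have hsq : ‖1 + (h : ℂ) * l‖ ^ 2 < 1 := by
    have e : ‖1 + (h : ℂ) * l‖ ^ 2 = 1 + h * (2 * l.re + h * ‖l‖ ^ 2) := by
      rw [← Complex.normSq_eq_norm_sq, ← Complex.normSq_eq_norm_sq, Complex.normSq_apply,
        Complex.normSq_apply]
      simp
      ring
    rw [e]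
    nlinarith
  nlinarith [norm_nonneg (1 + (h : ℂ) * l)]

/-- A real matrix without eigenvalues in the closed right half plane admits an explicit Euler step
which is eventually a contraction. -/
theorem exists_euler_pow_small (F : Matrix ι ι ℝ)
    (hF : ∀ (l : ℂ) (v : ι → ℂ), 0 ≤ l.re → F.map Complex.ofReal *ᵥ v = l • v → v = 0) :
    ∃ h : ℝ, 0 < h ∧ Tendsto (fun k : ℕ => (1 + h • F) ^ k) atTop (𝓝 0) := by
  set Fc := F.map Complex.ofReal with hFc
  have hspec : ∀ l ∈ spectrum ℂ Fc, l.re < 0 := by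
    intro l hl
    by_contra hcon
    push Not at hcon
    rw [← Matrix.spectrum_toLin', ← Module.End.hasEigenvalue_iff_mem_spectrum] at hl
    obtain ⟨v, hv⟩ := hl.exists_hasEigenvector
    exact hv.2 (hF l v hcon (by simpa using hv.apply_eq_smul))
  have hall : ∀ᶠ h : ℝ in 𝓝[>] 0, ∀ l ∈ spectrum ℂ Fc, ‖1 + (h : ℂ) * l‖ < 1 :=
    (Filter.eventually_all_finite (Matrix.finite_spectrum Fc)).2
      fun l hl => norm_one_add_mul_lt_one (hspec l hl)
  obtain ⟨h, hh, hpos⟩ := (hall.and self_mem_nhdsWithin).exists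
  have hpos : 0 < h := hpos
  refine ⟨h, hpos, ?_⟩
  have hc : Tendsto (fun k : ℕ => (1 + (h : ℂ) • Fc) ^ k) atTop (𝓝 0) := by
    apply tendsto_pow_zero_of_spectrum
    intro l hl
    have hh0 : (h : ℂ) ≠ 0 := by exact_mod_cast hpos.ne'
    have hmem : (l - 1) / h ∈ spectrum ℂ Fc := by
      rw [spectrum.mem_iff] at hl ⊢
      intro hu
      apply hl
      have : algebraMap ℂ (Matrix ι ι ℂ) l - (1 + (h : ℂ) • Fc)
          = (h : ℂ) • (algebraMap ℂ (Matrix ι ι ℂ) ((l - 1) / h) - Fc) := by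
        rw [smul_sub, Algebra.algebraMap_eq_smul_one, Algebra.algebraMap_eq_smul_one, smul_smul,
          mul_div_cancel₀ _ hh0, sub_smul, one_smul]
        abel
      rw [this]
      exact hu.smul (Units.mk0 (h : ℂ) hh0)
    have := hh _ hmem
    rwa [mul_div_cancel₀ _ hh0, add_sub_cancel] at this
  have hmap : ∀ k : ℕ, (1 + (h : ℂ) • Fc) ^ k = ((1 + h • F) ^ k).map Complex.ofReal := by
    intro k
    have e1 : ((1 + h • F) ^ k).map Complex.ofReal
        = (Complex.ofRealHom.mapMatrix (1 + h • F)) ^ k := by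
      rw [← map_pow]; rfl
    rw [e1]
    congr 1
    ext i j
    by_cases hij : i = j <;> simp [hFc, hij]
  refine tendsto_pi_nhds.2 fun i => tendsto_pi_nhds.2 fun j => ?_
  have hij := tendsto_pi_nhds.1 (tendsto_pi_nhds.1 hc i) j
  refine ((Complex.continuous_re.tendsto _).comp hij).congr fun k => ?_
  simp only [Function.comp, hmap]
  rfl

/-- Lyapunov's theorem: a real matrix without eigenvalues in the closed right half plane admits a
quadratic Lyapunov function. -/
theorem exists_lyapunov (F : Matrix ι ι ℝ)
    (hF : ∀ (l : ℂ) (v : ι → ℂ), 0 ≤ l.re → F.map Complex.ofReal *ᵥ v = l • v → v = 0) :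
    ∃ (P : EuclideanSpace ℝ ι →L[ℝ] EuclideanSpace ℝ ι) (c : ℝ), 0 < c ∧
      (∀ v w, inner ℝ (P v) w = inner ℝ (P w) v) ∧ (∀ v, ‖v‖ ^ 2 ≤ inner ℝ (P v) v) ∧
      ∀ v, inner ℝ (P v) (toEuclideanLin F v) ≤ -c * ‖v‖ ^ 2 := by
  obtain ⟨h, hpos, hlim⟩ := exists_euler_pow_small F hF
  set M := toEuclideanCLM (𝕜 := ℝ) (n := ι) (1 + h • F) with hM
  have hcont : Continuous (toEuclideanCLM (𝕜 := ℝ) (n := ι)) :=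
    (toEuclideanCLM (𝕜 := ℝ) (n := ι)).toAlgEquiv.toLinearMap.continuous_of_finiteDimensional
  have hlim2 : Tendsto (fun k : ℕ => ‖M ^ k‖) atTop (𝓝 0) := by
    have := (hcont.tendsto 0).comp hlim
    have := this.norm
    simpa [hM, Function.comp_def] using this
  obtain ⟨K, hK, hK0⟩ :=
    ((hlim2.eventually_lt_const (show (0 : ℝ) < 1 / 2 by norm_num)).and
      (eventually_gt_atTop 0)).exists
  -- A finite sum replaces the Lyapunov integral. Along v ↦ Mv it telescopes up to the end term ‖M^K
  -- v‖², which is small because ‖M^K‖ < 1/2.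
  let P : EuclideanSpace ℝ ι →L[ℝ] EuclideanSpace ℝ ι :=
    ∑ k ∈ Finset.range K, ContinuousLinearMap.adjoint (M ^ k) ∘L (M ^ k)
  have hP : ∀ v w, inner ℝ (P v) w = ∑ k ∈ Finset.range K, inner ℝ ((M ^ k) v) ((M ^ k) w) := by
    intro v w
    simp [P, sum_inner, ContinuousLinearMap.adjoint_inner_left]
  have hsymm : ∀ v w, inner ℝ (P v) w = inner ℝ (P w) v := by
    intro v w
    rw [hP, hP]
    exact Finset.sum_congr rfl fun k _ => real_inner_comm _ _
  refine ⟨P, 3 / (8 * h), by positivity, hsymm, ?_, ?_⟩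
  · intro v
    rw [hP]
    obtain ⟨K', rfl⟩ : ∃ K', K = K' + 1 := ⟨K - 1, by omega⟩
    rw [Finset.sum_range_succ']
    have : 0 ≤ ∑ k ∈ Finset.range K', inner ℝ ((M ^ (k + 1)) v) ((M ^ (k + 1)) v) :=
      Finset.sum_nonneg fun k _ => real_inner_self_nonneg
    simp only [pow_zero, one_apply_eq_self, real_inner_self_eq_norm_sq] at this ⊢
    linarith
  · intro v
    set f := toEuclideanLin F v with hf
    have hMv : M v = v + h • f := by
      rw [hM, hf]
      ext i
      simp [toLpLin_apply]
    have h1 : inner ℝ (P (M v)) (M v) - inner ℝ (P v) v = ‖(M ^ K) v‖ ^ 2 - ‖v‖ ^ 2 := by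
      have e1 : inner ℝ (P (M v)) (M v)
          = ∑ k ∈ Finset.range K, ‖(M ^ (k + 1)) v‖ ^ 2 := by
        rw [hP]
        refine Finset.sum_congr rfl fun k _ => ?_
        rw [real_inner_self_eq_norm_sq, pow_succ]; rfl
      have e2 : inner ℝ (P v) v = ∑ k ∈ Finset.range K, ‖(M ^ k) v‖ ^ 2 := by
        rw [hP]
        exact Finset.sum_congr rfl fun k _ => real_inner_self_eq_norm_sq _
      rw [e1, e2, ← Finset.sum_sub_distrib]
      rw [Finset.sum_range_sub (fun k => ‖(M ^ k) v‖ ^ 2)]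
      simp
    have h2 : inner ℝ (P (M v)) (M v) = inner ℝ (P v) v + 2 * h * inner ℝ (P v) f
        + h ^ 2 * inner ℝ (P f) f := by
      rw [hMv]
      simp only [map_add, map_smul, inner_add_left, inner_add_right, inner_smul_left,
        inner_smul_right, hsymm f v]
      simp
      ring
    have h3 : 0 ≤ inner ℝ (P f) f := by
      rw [hP]
      exact Finset.sum_nonneg fun k _ => real_inner_self_nonneg
    have h4 : ‖(M ^ K) v‖ ≤ 1 / 2 * ‖v‖ :=
      ((M ^ K).le_opNorm v).trans (by gcongr)
    have h5 : ‖(M ^ K) v‖ ^ 2 ≤ 1 / 4 * ‖v‖ ^ 2 := by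
      calc ‖(M ^ K) v‖ ^ 2 ≤ (1 / 2 * ‖v‖) ^ 2 := by gcongr
        _ = _ := by ring
    -- The second-order term h²⟪Pf, f⟫ is nonnegative, so the decrease of 3/4 ‖v‖² over one Euler
    -- step already bounds the first-order term. Division by 2h gives the rate 3/(8h).
    have h6 : 2 * h * inner ℝ (P v) f ≤ -(3 / 4) * ‖v‖ ^ 2 := by nlinarith [sq_nonneg h]
    have : inner ℝ (P v) f * (8 * h) ≤ -3 * ‖v‖ ^ 2 := by linarith
    rw [show -(3 / (8 * h)) * ‖v‖ ^ 2 = (-3 * ‖v‖ ^ 2) / (8 * h) by ring]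
    rwa [le_div_iff₀ (by positivity)]

end Lyapunov

/-! ### Ordinary differential equations -/

section ODE

variable {V : Type*} [NormedAddCommGroup V] [NormedSpace ℝ V]

/-- A globally Lipschitz vector field vanishing at the origin has a solution on `[0, ∞)` through
every point. The fixed point iteration takes place in an exponentially weighted space. -/
theorem exists_global_solution [CompleteSpace V] (f : ℝ → V → V) (hf : Continuous (Function.uncurry f)) {K : ℝ}
    (hK : 0 < K) (hlip : ∀ t v w, ‖f t v - f t w‖ ≤ K * ‖v - w‖) (h0 : ∀ t, f t 0 = 0) (v0 : V) :
    ∃ X : ℝ → V, X 0 = v0 ∧ ∀ t, 0 ≤ t → HasDerivAt X (f t (X t)) t := by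
  -- With the weight e^(-lt) the integral operator is K/l-Lipschitz on all of [0, ∞); l = 2K gives
  -- the contraction factor 1/2.
  set l : ℝ := 2 * K with hl
  have hlpos : 0 < l := by positivity
  have hexpint : ∀ t : ℝ, ∫ s in (0 : ℝ)..t, Real.exp (l * s) = (Real.exp (l * t) - 1) / l := by
    intro t
    rw [intervalIntegral.integral_comp_mul_left (fun s => Real.exp s) hlpos.ne']
    simp [integral_exp]; ring
  have hexpint' : ∀ t : ℝ, Real.exp (-(l * t)) * ∫ s in (0 : ℝ)..t, Real.exp (l * s) ≤ 1 / l := by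
    intro t
    rw [hexpint, ← mul_div_assoc, mul_sub, ← Real.exp_add]
    simp only [neg_add_cancel, Real.exp_zero, mul_one]
    gcongr
    linarith [Real.exp_pos (-(l * t))]
  have hcont : ∀ g : BoundedContinuousFunction ℝ V,
      Continuous fun s => f s (Real.exp (l * s) • g s) := fun g =>
    hf.comp (continuous_id.prodMk (by fun_prop))
  have hint : ∀ g : BoundedContinuousFunction ℝ V, ∀ a b : ℝ,
      IntervalIntegrable (fun s => f s (Real.exp (l * s) • g s)) volume a b := fun g a b =>
    (hcont g).intervalIntegrable a b
  have hdiff : ∀ (g g' : BoundedContinuousFunction ℝ V) (t : ℝ), 0 ≤ t →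
      ‖Real.exp (-(l * t)) • ((∫ s in (0 : ℝ)..t, f s (Real.exp (l * s) • g s))
        - ∫ s in (0 : ℝ)..t, f s (Real.exp (l * s) • g' s))‖ ≤ 1 / 2 * dist g g' := by
    intro g g' t ht
    rw [← intervalIntegral.integral_sub (hint g 0 t) (hint g' 0 t), norm_smul, Real.norm_eq_abs,
      abs_of_pos (Real.exp_pos _)]
    have h1 : ‖∫ s in (0 : ℝ)..t, (f s (Real.exp (l * s) • g s) - f s (Real.exp (l * s) • g' s))‖
        ≤ ∫ s in (0 : ℝ)..t, K * dist g g' * Real.exp (l * s) := by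
      apply intervalIntegral.norm_integral_le_of_norm_le ht
      · refine Eventually.of_forall fun s _ => (hlip _ _ _).trans ?_
        rw [← smul_sub, norm_smul, Real.norm_eq_abs, abs_of_pos (Real.exp_pos _)]
        have : ‖g s - g' s‖ ≤ dist g g' := by
          rw [← dist_eq_norm]; exact BoundedContinuousFunction.dist_coe_le_dist s
        have hE := Real.exp_pos (l * s)
        calc K * (Real.exp (l * s) * ‖g s - g' s‖) ≤ K * (Real.exp (l * s) * dist g g') := by
              gcongr
          _ = _ := by ring
      · exact Continuous.intervalIntegrable (by fun_prop) _ _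
    rw [intervalIntegral.integral_const_mul] at h1
    calc Real.exp (-(l * t)) * _ ≤ Real.exp (-(l * t)) *
          (K * dist g g' * ∫ s in (0 : ℝ)..t, Real.exp (l * s)) := by gcongr
      _ = K * dist g g' * (Real.exp (-(l * t)) * ∫ s in (0 : ℝ)..t, Real.exp (l * s)) := by ring
      _ ≤ K * dist g g' * (1 / l) := by
          have := hexpint' t
          gcongr
      _ = 1 / 2 * dist g g' := by rw [hl]; field_simp
  have hzero : ∀ s, f s (Real.exp (l * s) • (0 : BoundedContinuousFunction ℝ V) s) = 0 := by
    intro s; simp [h0]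
  -- The unknown is g(t) = e^(-lt) X(t). Freezing time at 0 for t < 0 gives functions on the whole
  -- line, and f(·, 0) = 0 keeps the image bounded.
  let T : BoundedContinuousFunction ℝ V → BoundedContinuousFunction ℝ V := fun g =>
    BoundedContinuousFunction.ofNormedAddCommGroup
      (fun t => Real.exp (-(l * max t 0)) •
        (v0 + ∫ s in (0 : ℝ)..max t 0, f s (Real.exp (l * s) • g s)))
      (by
        have := intervalIntegral.continuous_primitive (μ := volume) (hint g) 0
        fun_prop)
      (‖v0‖ + 1 / 2 * dist g 0)
      (by
        intro t
        rw [smul_add]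
        refine (norm_add_le _ _).trans (add_le_add ?_ ?_)
        · rw [norm_smul, Real.norm_eq_abs, abs_of_pos (Real.exp_pos _)]
          have : Real.exp (-(l * max t 0)) ≤ 1 := by
            rw [Real.exp_le_one_iff]
            have : 0 ≤ l * max t 0 := by positivity
            linarith
          exact mul_le_of_le_one_left (norm_nonneg _) this
        · have := hdiff g 0 (max t 0) (le_max_right _ _)
          simpa only [hzero, intervalIntegral.integral_zero, sub_zero] using this)
  have hT : ContractingWith (1 / 2 : NNReal) T := by
    refine ⟨by rw [← NNReal.coe_lt_coe]; norm_num, LipschitzWith.of_dist_le_mul fun g g' => ?_⟩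
    rw [BoundedContinuousFunction.dist_le (by positivity)]
    intro t
    have := hdiff g g' (max t 0) (le_max_right _ _)
    rw [dist_eq_norm]
    simp only [T, BoundedContinuousFunction.coe_ofNormedAddCommGroup]
    rw [← smul_sub, add_sub_add_left_eq_sub]
    simpa using this
  obtain ⟨g, hg⟩ : ∃ g, T g = g := ⟨hT.fixedPoint, hT.fixedPoint_isFixedPt⟩
  have hgt : ∀ t, 0 ≤ t → Real.exp (l * t) • g t
      = v0 + ∫ s in (0 : ℝ)..t, f s (Real.exp (l * s) • g s) := by
    intro t ht
    have := congrArg (fun G : BoundedContinuousFunction ℝ V => G t) hg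
    simp only [T, BoundedContinuousFunction.coe_ofNormedAddCommGroup, max_eq_left ht] at this
    rw [← this, smul_smul, ← Real.exp_add]
    simp
  refine ⟨fun t => v0 + ∫ s in (0 : ℝ)..t, f s (Real.exp (l * s) • g s), by simp, ?_⟩
  intro t ht
  simp only
  rw [← hgt t ht]
  exact ((hcont g).integral_hasStrictDerivAt 0 t).hasDerivAt.const_add v0

/-- A continuous function starting below `b` stays below `b` if its derivative is negative whenever
it reaches `b` for the first time. -/
theorem lt_of_barrier {g : ℝ → ℝ} {b : ℝ} (hg : ContinuousOn g (Ici 0)) (h0 : g 0 < b)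
    (hd : ∀ t, 0 < t → g t = b → (∀ s, 0 ≤ s → s ≤ t → g s ≤ b) → ∃ d < 0, HasDerivAt g d t) :
    ∀ t, 0 ≤ t → g t < b := by
  intro t ht
  by_contra hcon
  push Not at hcon
  set S := {s | s ∈ Icc 0 t ∧ b ≤ g s} with hS
  have hScl : IsClosed S := by
    have : S = Icc 0 t ∩ g ⁻¹' Ici b := rfl
    rw [this]
    exact (hg.mono Icc_subset_Ici_self).preimage_isClosed_of_isClosed isClosed_Icc isClosed_Ici
  have hSne : S.Nonempty := ⟨t, ⟨ht, le_rfl⟩, hcon⟩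
  have hSbdd : BddBelow S := ⟨0, fun s hs => hs.1.1⟩
  have hmem := hScl.csInf_mem hSne hSbdd
  set τ := sInf S with hτ
  have hbefore : ∀ s, 0 ≤ s → s < τ → g s < b := by
    intro s hs hsτ
    by_contra h
    push Not at h
    exact absurd (csInf_le hSbdd ⟨⟨hs, hsτ.le.trans hmem.1.2⟩, h⟩) (not_le.2 hsτ)
  have hτpos : 0 < τ := by
    rcases hmem.1.1.eq_or_lt with h | h
    · exact absurd hmem.2 (by rw [← h]; exact not_le.2 h0)
    · exact h
  have hcontτ : ContinuousWithinAt g (Ico 0 τ) τ :=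
    (hg τ hτpos.le).mono fun s hs => hs.1
  have hle : g τ ≤ b := by
    have : τ ∈ closure (Ico 0 τ) := by
      rw [closure_Ico hτpos.ne]; exact ⟨hτpos.le, le_rfl⟩
    exact hcontτ.closure_le this continuousWithinAt_const fun s hs => (hbefore s hs.1 hs.2).le
  have heq : g τ = b := le_antisymm hle hmem.2
  obtain ⟨d, hd0, hder⟩ := hd τ hτpos heq fun s hs hst => by
    rcases hst.eq_or_lt with h | h
    · rw [h]; exact hle
    · exact (hbefore s hs h).le
  -- Just before the first hitting time τ the difference quotients are negative by the sign of the
  -- derivative, but positive because g < b there.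
  have hev : ∀ᶠ s in 𝓝[<] τ, slope g τ s < 0 :=
    ((hasDerivAt_iff_tendsto_slope.1 hder).mono_left
      (nhdsWithin_mono _ fun s hs => ne_of_lt hs)).eventually_lt_const hd0
  have hev2 : ∀ᶠ s in 𝓝[<] τ, 0 < s := by
    filter_upwards [Ioo_mem_nhdsLT hτpos] with s hs using hs.1
  obtain ⟨s, ⟨hs1, hs2⟩, hs3⟩ := ((hev.and hev2).and self_mem_nhdsWithin).exists
  have hs3 : s < τ := hs3
  have := hbefore s hs2.le hs3
  rw [slope_def_field, heq] at hs1
  have hpos : 0 < (g s - b) / (s - τ) := div_pos_of_neg_of_neg (by linarith) (by linarith)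
  linarith

/-- Grönwall's inequality for differentiable real functions, with an arbitrary rate. -/
theorem le_gronwall_of_hasDerivAt {W W' : ℝ → ℝ} {k d T : ℝ}
    (hW : ∀ t, 0 ≤ t → HasDerivAt W (W' t) t)
    (hb : ∀ t, 0 ≤ t → t < T → W' t ≤ k * W t + d) :
    ∀ t, 0 ≤ t → t ≤ T → W t ≤ gronwallBound (W 0) k d t := by
  intro t ht htT
  have := le_gronwallBound_of_liminf_deriv_right_le (f := W) (f' := W') (δ := W 0) (K := k)
    (ε := d) (a := 0) (b := T)
    (fun s hs => (hW s hs.1).continuousAt.continuousWithinAt)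
    (fun s hs r hr => (hW s hs.1).hasDerivWithinAt.liminf_right_slope_le hr) le_rfl
    (fun s hs => hb s hs.1 hs.2) t ⟨ht, htT⟩
  simpa using this

theorem gronwallBound_neg_le {δ c d t : ℝ} (hδ : 0 ≤ δ) (hc : 0 < c) (hd : 0 ≤ d) (ht : 0 ≤ t) :
    gronwallBound δ (-c) d t ≤ δ + d / c := by
  rw [gronwallBound_of_K_ne_0 (by linarith)]
  beta_reduce
  have h1 : Real.exp (-c * t) ≤ 1 := by
    rw [Real.exp_le_one_iff]; nlinarith
  have h2 := Real.exp_pos (-c * t)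
  have h3 : d / -c * (Real.exp (-c * t) - 1) = d / c * (1 - Real.exp (-c * t)) := by
    rw [div_neg]; ring
  rw [h3]
  have h4 : 0 ≤ d / c := by positivity
  nlinarith

end ODE

/-! ### Funnel functions -/

theorem IsFunnel.nonneg {φ : ℝ → ℝ} (h : IsFunnel φ) {t : ℝ} (ht : 0 ≤ t) : 0 ≤ φ t := by
  rcases ht.eq_or_lt with rfl | ht
  · have hc : ContinuousWithinAt φ (Ioi 0) 0 :=
      (h.contDiffOn.continuousOn 0 self_mem_Ici).mono Ioi_subset_Ici_self
    exact ge_of_tendsto hc (by filter_upwards [self_mem_nhdsWithin] with s hs using (h.pos s hs).le)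
  · exact (h.pos t ht).le

/-- The positive limit inferior controls the tail and compactness the rest. The bound starts at time
1 because φ may vanish at 0. -/
theorem IsFunnel.exists_lower_bound {φ : ℝ → ℝ} (h : IsFunnel φ) :
    ∃ c, 0 < c ∧ ∀ t, 1 ≤ t → c ≤ φ t := by
  obtain ⟨M, hM⟩ := h.bounded
  have hbdd : IsBoundedUnder (· ≥ ·) atTop φ :=
    ⟨-M, by
      rw [eventually_map]
      filter_upwards [eventually_ge_atTop 0] with t ht using (abs_le.1 (hM t ht)).1⟩
  obtain ⟨a, ha0, ha⟩ := exists_between h.liminf_pos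
  obtain ⟨T, hT⟩ := eventually_atTop.1 (eventually_lt_of_lt_liminf ha hbdd)
  obtain ⟨s, hs, hmin⟩ := (isCompact_Icc (a := (1 : ℝ)) (b := max 1 T)).exists_isMinOn
    ⟨1, le_rfl, le_max_left _ _⟩
    (h.contDiffOn.continuousOn.mono fun t ht => zero_le_one.trans ht.1)
  refine ⟨min a (φ s), lt_min ha0 (h.pos s (by linarith [hs.1])), fun t ht => ?_⟩
  by_cases htT : t ≤ max 1 T
  · exact (min_le_right _ _).trans (hmin ⟨ht, htT⟩)
  · push Not at htT
    exact (min_le_left _ _).trans (hT t ((le_max_right _ _).trans htT.le)).le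

theorem IsFunnel.hasDerivAt {φ : ℝ → ℝ} (h : IsFunnel φ) {t : ℝ} (ht : 0 < t) :
    HasDerivAt φ (derivWithin φ (Ici 0) t) t :=
  ((h.contDiffOn.differentiableOn (by norm_num)) t ht.le).hasDerivWithinAt.hasDerivAt
    (Ici_mem_nhds ht)

/-! ### The truncated funnel gain -/

section Truncation

variable {U : Type*} [NormedAddCommGroup U] [NormedSpace ℝ U]

/-- If sy ≤ 1, factor s²(y² - x²) as a difference of squares. If sy > 1, then 1 - s²x² ≤ 2(1 - sx) ≤
2(sy - sx), so the larger argument may lie outside the funnel. -/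
theorem abs_max_one_sub_sq_sub_le {δ s x y : ℝ} (hδ : 0 < δ) (hs : 0 ≤ s) (hx : 0 ≤ x)
    (hxy : x ≤ y) (hsx : s * x ≤ 1) :
    |max δ (1 - s ^ 2 * x ^ 2) - max δ (1 - s ^ 2 * y ^ 2)| ≤ 2 * s * (y - x) := by
  have hsxy : s * x ≤ s * y := by gcongr
  have hsx0 : 0 ≤ s * x := by positivity
  have hmono : s ^ 2 * x ^ 2 ≤ s ^ 2 * y ^ 2 := by gcongr
  have hle : max δ (1 - s ^ 2 * y ^ 2) ≤ max δ (1 - s ^ 2 * x ^ 2) :=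
    max_le_max le_rfl (by linarith)
  rw [abs_of_nonneg (by linarith), sub_le_iff_le_add]
  refine max_le ?_ ?_
  · have := le_max_left δ (1 - s ^ 2 * y ^ 2)
    nlinarith
  · by_cases hsy : s * y ≤ 1
    · have := le_max_right δ (1 - s ^ 2 * y ^ 2)
      nlinarith
    · have := le_max_left δ (1 - s ^ 2 * y ^ 2)
      nlinarith

/-- The constant is free of s and hence uniform in time. For the shorter vector a, the factor s in
the difference of the denominators is absorbed by s‖a‖ ≤ 1; if s‖a‖ > 1, both denominators equal δ.
-/
theorem norm_truncated_gain_sub_le {δ s : ℝ} (hδ : 0 < δ) (hs : 0 ≤ s) (a b : U) :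
    ‖(max δ (1 - s ^ 2 * ‖a‖ ^ 2))⁻¹ • a - (max δ (1 - s ^ 2 * ‖b‖ ^ 2))⁻¹ • b‖
      ≤ (δ⁻¹ + 2 * (δ⁻¹ * δ⁻¹)) * ‖a - b‖ := by
  wlog hab : ‖a‖ ≤ ‖b‖ generalizing a b
  · rw [norm_sub_rev, norm_sub_rev a b]
    exact this b a (le_of_not_ge hab)
  set Da := max δ (1 - s ^ 2 * ‖a‖ ^ 2) with hDa
  set Db := max δ (1 - s ^ 2 * ‖b‖ ^ 2) with hDb
  have hda : δ ≤ Da := le_max_left _ _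
  have hdb : δ ≤ Db := le_max_left _ _
  have hDa0 : 0 < Da := hδ.trans_le hda
  have hDb0 : 0 < Db := hδ.trans_le hdb
  have e : Da⁻¹ • a - Db⁻¹ • b = Db⁻¹ • (a - b) + (Da⁻¹ - Db⁻¹) • a := by module
  have h1 : ‖Db⁻¹ • (a - b)‖ ≤ δ⁻¹ * ‖a - b‖ := by
    rw [norm_smul, Real.norm_eq_abs, abs_of_pos (by positivity)]
    gcongr
  have h2 : |Da - Db| * ‖a‖ ≤ 2 * ‖a - b‖ := by
    by_cases hsa : s * ‖a‖ ≤ 1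
    · have h3 := abs_max_one_sub_sq_sub_le hδ hs (norm_nonneg a) hab hsa
      have h4 : ‖b‖ - ‖a‖ ≤ ‖a - b‖ := by rw [norm_sub_rev]; exact norm_sub_norm_le b a
      have h5 : 0 ≤ ‖b‖ - ‖a‖ := by linarith
      calc |Da - Db| * ‖a‖ ≤ 2 * s * (‖b‖ - ‖a‖) * ‖a‖ := by gcongr
        _ = 2 * (‖b‖ - ‖a‖) * (s * ‖a‖) := by ring
        _ ≤ 2 * (‖b‖ - ‖a‖) * 1 := by gcongr
        _ ≤ 2 * ‖a - b‖ := by linarith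
    · push Not at hsa
      have hsb : s * ‖a‖ ≤ s * ‖b‖ := by gcongr
      have e1 : Da = δ := max_eq_left (by nlinarith)
      have e2 : Db = δ := max_eq_left (by nlinarith)
      rw [e1, e2]
      simp
  have h6 : ‖(Da⁻¹ - Db⁻¹) • a‖ ≤ 2 * (δ⁻¹ * δ⁻¹) * ‖a - b‖ := by
    rw [norm_smul, Real.norm_eq_abs, inv_sub_inv hDa0.ne' hDb0.ne', abs_div, abs_sub_comm,
      abs_of_pos (mul_pos hDa0 hDb0), div_eq_mul_inv, mul_inv]
    calc |Da - Db| * (Da⁻¹ * Db⁻¹) * ‖a‖ = (Da⁻¹ * Db⁻¹) * (|Da - Db| * ‖a‖) := by ring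
      _ ≤ (δ⁻¹ * δ⁻¹) * (2 * ‖a - b‖) := by gcongr
      _ = _ := by ring
  rw [e]
  refine (norm_add_le _ _).trans ?_
  linarith

end Truncation

/-! ### Energy forms for high-gain feedback -/

section Energy

variable {V U : Type*} [NormedAddCommGroup V] [InnerProductSpace ℝ V]
  [NormedAddCommGroup U] [InnerProductSpace ℝ U]

/-- A quadratic form `v ↦ ⟪Q v, v⟫` which certifies stability of `v' = A v - k B L v` for large
gains `k` and bounded growth for every nonnegative gain. -/
structure IsEnergyForm (A : V →L[ℝ] V) (B : U →L[ℝ] V) (L : V →L[ℝ] U) (Q : V →L[ℝ] V)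
    (a c C γ : ℝ) : Prop where
  symm : ∀ v w, inner ℝ (Q v) w = inner ℝ (Q w) v
  a_pos : 0 < a
  c_pos : 0 < c
  C_pos : 0 < C
  γ_pos : 0 < γ
  norm_le : ∀ v, ‖v‖ ^ 2 ≤ a * inner ℝ (Q v) v
  output_le : ∀ v, ‖L v‖ ^ 2 ≤ inner ℝ (Q v) v
  coercive : ∀ u, γ * ‖u‖ ^ 2 ≤ inner ℝ u (L (B u))
  decay : ∀ k v, 0 ≤ k → 2 * inner ℝ (Q v) (A v - k • B (L v))
    ≤ -c * inner ℝ (Q v) v + (C - 2 * k * γ) * ‖L v‖ ^ 2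

/-- V splits into ker L and the range of R. The form is P on the component ξ in ker L plus ‖Lv‖².
The range of B has no component in ker L, so the feedback acts on ‖Lv‖² alone, where coercivity
gives it a sign. The mixed terms are handled by Young's inequality. -/
theorem exists_isEnergyForm [CompleteSpace V] [CompleteSpace U] (A : V →L[ℝ] V) (B : U →L[ℝ] V)
    (L : V →L[ℝ] U) (R : U →L[ℝ] V) (hLR : ∀ u, L (R u) = u) (hRB : ∀ u, R (L (B u)) = B u)
    {γ : ℝ} (hγ : 0 < γ) (hcoer : ∀ u, γ * ‖u‖ ^ 2 ≤ inner ℝ u (L (B u)))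
    (P : V →L[ℝ] V) {c₀ : ℝ} (hc₀ : 0 < c₀) (hsymm : ∀ v w, inner ℝ (P v) w = inner ℝ (P w) v)
    (hP : ∀ v, ‖v‖ ^ 2 ≤ inner ℝ (P v) v)
    (hdec : ∀ v, L v = 0 → inner ℝ (P v) (A v - R (L (A v))) ≤ -c₀ * ‖v‖ ^ 2) :
    ∃ (Q : V →L[ℝ] V) (a c C : ℝ), IsEnergyForm A B L Q a c C γ := by
  set prj : V →L[ℝ] V := ContinuousLinearMap.id ℝ V - R ∘L L with hprj
  have hprjv : ∀ v, prj v = v - R (L v) := fun v => rfl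
  set Q : V →L[ℝ] V := ContinuousLinearMap.adjoint prj ∘L P ∘L prj
    + ContinuousLinearMap.adjoint L ∘L L with hQ
  have hQv : ∀ v w, inner ℝ (Q v) w = inner ℝ (P (prj v)) (prj w) + inner ℝ (L v) (L w) := by
    intro v w
    simp [hQ, inner_add_left, ContinuousLinearMap.adjoint_inner_left]
  set n₁ := ‖P‖ * ‖prj ∘L A ∘L R‖ + ‖L ∘L A‖ with hn₁
  set b := ‖L ∘L A ∘L R‖ with hb
  set p := ‖P‖ + 1 with hp
  have hp0 : 0 < p := by positivity
  have hb0 : 0 ≤ b := norm_nonneg _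
  -- The first constant comes from ‖v‖ ≤ ‖ξ‖ + ‖R‖‖Lv‖. In the last one, n₁²/c₀ is the Young
  -- remainder of the mixed terms, 2b bounds the drift of Lv, and c₀/p pays for the part ‖Lv‖² of
  -- the form in -c⟪Qv, v⟫.
  refine ⟨Q, 2 + 2 * ‖R‖ ^ 2, c₀ / p, n₁ ^ 2 / c₀ + 2 * b + c₀ / p, ?_⟩
  refine ⟨?_, by positivity, by positivity, by positivity, hγ, ?_, ?_, hcoer, ?_⟩
  · intro v w
    rw [hQv, hQv, hsymm, real_inner_comm (L v)]
  · intro v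
    have e : v = prj v + R (L v) := by rw [hprjv]; abel
    have h1 : ‖v‖ ≤ ‖prj v‖ + ‖R‖ * ‖L v‖ := by
      calc ‖v‖ = ‖prj v + R (L v)‖ := by rw [← e]
        _ ≤ ‖prj v‖ + ‖R (L v)‖ := norm_add_le _ _
        _ ≤ _ := by gcongr; exact R.le_opNorm _
    have h2 := hP (prj v)
    rw [hQv, real_inner_self_eq_norm_sq]
    have h3 : ‖v‖ ^ 2 ≤ (‖prj v‖ + ‖R‖ * ‖L v‖) ^ 2 := by gcongr
    have h4 : (‖prj v‖ + ‖R‖ * ‖L v‖) ^ 2 ≤ 2 * ‖prj v‖ ^ 2 + 2 * ‖R‖ ^ 2 * ‖L v‖ ^ 2 := by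
      nlinarith [sq_nonneg (‖prj v‖ - ‖R‖ * ‖L v‖)]
    nlinarith [mul_nonneg (sq_nonneg ‖R‖) ((sq_nonneg ‖prj v‖).trans h2), sq_nonneg ‖L v‖,
      sq_nonneg ‖R‖]
  · intro v
    rw [hQv, real_inner_self_eq_norm_sq]
    linarith [(sq_nonneg _).trans (hP (prj v))]
  · intro k v hk
    set ξ := prj v with hξ
    set e := L v with he
    have hvξ : v = ξ + R e := by rw [hξ, hprjv]; abel
    have hLξ : L ξ = 0 := by rw [hξ, hprjv, map_sub, hLR, sub_self]
    have hprjB : prj (B e) = 0 := by rw [hprjv, hRB, sub_self]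
    have hAv : A v = A ξ + A (R e) := by rw [hvξ, map_add]
    have h1 : inner ℝ (P ξ) (prj (A ξ)) ≤ -c₀ * ‖ξ‖ ^ 2 := by rw [hprjv]; exact hdec ξ hLξ
    have h2 : inner ℝ (P ξ) (prj (A (R e))) ≤ ‖P‖ * ‖prj ∘L A ∘L R‖ * (‖ξ‖ * ‖e‖) := by
      refine (real_inner_le_norm _ _).trans ?_
      calc ‖P ξ‖ * ‖prj (A (R e))‖ ≤ (‖P‖ * ‖ξ‖) * (‖prj ∘L A ∘L R‖ * ‖e‖) := by
            gcongr
            · exact P.le_opNorm _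
            · exact (prj ∘L A ∘L R).le_opNorm e
        _ = _ := by ring
    have h3 : inner ℝ e (L (A ξ)) ≤ ‖L ∘L A‖ * (‖ξ‖ * ‖e‖) := by
      refine (real_inner_le_norm _ _).trans ?_
      calc ‖e‖ * ‖L (A ξ)‖ ≤ ‖e‖ * (‖L ∘L A‖ * ‖ξ‖) := by
            gcongr; exact (L ∘L A).le_opNorm ξ
        _ = _ := by ring
    have h4 : inner ℝ e (L (A (R e))) ≤ b * ‖e‖ ^ 2 := by
      refine (real_inner_le_norm _ _).trans ?_
      calc ‖e‖ * ‖L (A (R e))‖ ≤ ‖e‖ * (b * ‖e‖) := by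
            gcongr; exact (L ∘L A ∘L R).le_opNorm e
        _ = _ := by ring
    have h5 := mul_le_mul_of_nonneg_left (hcoer e) hk
    have e1 : inner ℝ (Q v) (A v - k • B e) = inner ℝ (P ξ) (prj (A ξ))
        + inner ℝ (P ξ) (prj (A (R e))) + inner ℝ e (L (A ξ)) + inner ℝ e (L (A (R e)))
        - k * inner ℝ e (L (B e)) := by
      rw [hQv, hAv]
      simp only [map_add, map_sub, map_smul, hprjB, smul_zero, sub_zero, inner_add_right,
        inner_sub_right, inner_smul_right]
      ring
    have e2 : inner ℝ (Q v) v = inner ℝ (P ξ) ξ + ‖e‖ ^ 2 := by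
      rw [hQv, real_inner_self_eq_norm_sq]
    have h6 : inner ℝ (P ξ) ξ ≤ p * ‖ξ‖ ^ 2 := by
      refine (real_inner_le_norm _ _).trans ?_
      calc ‖P ξ‖ * ‖ξ‖ ≤ (‖P‖ * ‖ξ‖) * ‖ξ‖ := by gcongr; exact P.le_opNorm _
        _ ≤ p * ‖ξ‖ ^ 2 := by rw [hp]; nlinarith [sq_nonneg ‖ξ‖]
    have h7 : 2 * (n₁ * (‖ξ‖ * ‖e‖)) ≤ c₀ * ‖ξ‖ ^ 2 + n₁ ^ 2 / c₀ * ‖e‖ ^ 2 := by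
      have h8 : 0 ≤ (c₀ * ‖ξ‖ - n₁ * ‖e‖) ^ 2 / c₀ := by positivity
      have h9 : (c₀ * ‖ξ‖ - n₁ * ‖e‖) ^ 2 / c₀
          = c₀ * ‖ξ‖ ^ 2 - 2 * (n₁ * (‖ξ‖ * ‖e‖)) + n₁ ^ 2 / c₀ * ‖e‖ ^ 2 := by
        field_simp; ring
      linarith
    have h10 : c₀ / p * inner ℝ (P ξ) ξ ≤ c₀ * ‖ξ‖ ^ 2 := by
      calc c₀ / p * inner ℝ (P ξ) ξ ≤ c₀ / p * (p * ‖ξ‖ ^ 2) := by gcongr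
        _ = _ := by field_simp
    rw [e1, e2]
    have h11 : n₁ * (‖ξ‖ * ‖e‖)
        = ‖P‖ * ‖prj ∘L A ∘L R‖ * (‖ξ‖ * ‖e‖) + ‖L ∘L A‖ * (‖ξ‖ * ‖e‖) := by rw [hn₁]; ring
    nlinarith

end Energy

/-! ### Closed loop under high-gain feedback -/

section HighGain

variable {V U : Type*} [NormedAddCommGroup V] [InnerProductSpace ℝ V]
  [NormedAddCommGroup U] [InnerProductSpace ℝ U]
  {A : V →L[ℝ] V} {B : U →L[ℝ] V} {L : V →L[ℝ] U} {Q : V →L[ℝ] V} {a c C γ : ℝ}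

theorem IsEnergyForm.nonneg (h : IsEnergyForm A B L Q a c C γ) (v : V) : 0 ≤ inner ℝ (Q v) v :=
  (sq_nonneg _).trans (h.output_le v)

theorem IsEnergyForm.hasDerivAt (h : IsEnergyForm A B L Q a c C γ) {X : ℝ → V} {X' : V} {t : ℝ}
    (hX : HasDerivAt X X' t) :
    HasDerivAt (fun s => inner ℝ (Q (X s)) (X s)) (2 * inner ℝ (Q (X t)) X') t := by
  have h1 := (Q.hasFDerivAt.comp_hasDerivAt t hX).inner ℝ hX
  convert! h1 using 1
  simp only [Function.comp]
  rw [h.symm X' (X t)]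
  ring

/-- Dropping the dissipative feedback term and using ‖Lv‖² ≤ ⟪Qv, v⟫ leaves W' ≤ CW, whatever the
gain. This serves on [0, 1], where the funnel may be too wide to bound the output. -/
theorem IsEnergyForm.le_exp (h : IsEnergyForm A B L Q a c C γ) {X : ℝ → V} {k : ℝ → ℝ}
    (hk : ∀ t, 0 ≤ t → 0 ≤ k t)
    (hX : ∀ t, 0 ≤ t → HasDerivAt X (A (X t) - k t • B (L (X t))) t) {t : ℝ} (ht : 0 ≤ t) :
    inner ℝ (Q (X t)) (X t) ≤ inner ℝ (Q (X 0)) (X 0) * Real.exp (C * t) := by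
  have := le_gronwall_of_hasDerivAt (W := fun s => inner ℝ (Q (X s)) (X s)) (k := C) (d := 0)
    (T := t) (fun s hs => h.hasDerivAt (hX s hs)) (fun s hs _ => by
      have h1 := h.decay (k s) (X s) (hk s hs)
      have h2 := h.output_le (X s)
      have h3 := mul_nonneg (mul_nonneg (hk s hs) h.γ_pos.le) (sq_nonneg ‖L (X s)‖)
      have h4 := mul_nonneg h.c_pos.le (h.nonneg (X s))
      have h5 := mul_le_mul_of_nonneg_left h2 h.C_pos.le
      linarith) t ht le_rfl
  rwa [gronwallBound_ε0] at this

/-- The output acts as a bounded input to the stable zero dynamics: W' ≤ -cW + CM for every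
nonnegative gain. -/
theorem IsEnergyForm.le_of_output_le (h : IsEnergyForm A B L Q a c C γ) {X : ℝ → V} {k : ℝ → ℝ}
    (hk : ∀ t, 0 ≤ t → 0 ≤ k t)
    (hX : ∀ t, 0 ≤ t → HasDerivAt X (A (X t) - k t • B (L (X t))) t) {M t : ℝ} (ht : 0 ≤ t)
    (hM : ∀ s, 0 ≤ s → s ≤ t → ‖L (X s)‖ ^ 2 ≤ M) :
    inner ℝ (Q (X t)) (X t) ≤ inner ℝ (Q (X 0)) (X 0) + C * M / c := by
  have hM0 : 0 ≤ M := (sq_nonneg _).trans (hM 0 le_rfl ht)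
  have := le_gronwall_of_hasDerivAt (W := fun s => inner ℝ (Q (X s)) (X s)) (k := -c)
    (d := C * M) (T := t) (fun s hs => h.hasDerivAt (hX s hs)) (fun s hs hst => by
      have h1 := h.decay (k s) (X s) (hk s hs)
      have h3 := mul_nonneg (mul_nonneg (hk s hs) h.γ_pos.le) (sq_nonneg ‖L (X s)‖)
      have h5 := mul_le_mul_of_nonneg_left (hM s hs hst.le) h.C_pos.le
      linarith) t ht le_rfl
  exact this.trans (gronwallBound_neg_le (h.nonneg _) h.c_pos (mul_nonneg h.C_pos.le hM0) ht)

/-- When 2kγ ≥ C, the output term of `decay` is nonpositive and the energy decays like e^(-ct). -/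
theorem IsEnergyForm.tendsto_zero (h : IsEnergyForm A B L Q a c C γ) {X : ℝ → V} {k : ℝ → ℝ}
    (hk : ∀ t, 0 ≤ t → 0 ≤ k t)
    (hX : ∀ t, 0 ≤ t → HasDerivAt X (A (X t) - k t • B (L (X t))) t)
    (hC : ∀ t, 0 ≤ t → C ≤ 2 * k t * γ) : Tendsto X atTop (𝓝 0) := by
  have hW : ∀ t, 0 ≤ t →
      inner ℝ (Q (X t)) (X t) ≤ inner ℝ (Q (X 0)) (X 0) * Real.exp (-c * t) := by
    intro t ht
    have := le_gronwall_of_hasDerivAt (W := fun s => inner ℝ (Q (X s)) (X s)) (k := -c) (d := 0)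
      (T := t) (fun s hs => h.hasDerivAt (hX s hs)) (fun s hs _ => by
        have h1 := h.decay (k s) (X s) (hk s hs)
        have h5 := mul_nonneg (sub_nonneg.2 (hC s hs)) (sq_nonneg ‖L (X s)‖)
        linarith) t ht le_rfl
    rwa [gronwallBound_ε0] at this
  have hexp : Tendsto (fun t : ℝ => a * (inner ℝ (Q (X 0)) (X 0) * Real.exp (-c * t))) atTop
      (𝓝 0) := by
    have h1 : Tendsto (fun t : ℝ => -c * t) atTop atBot :=
      tendsto_id.const_mul_atTop_of_neg (by linarith [h.c_pos])
    have h2 := (Real.tendsto_exp_atBot.comp h1).const_mul (a * inner ℝ (Q (X 0)) (X 0))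
    simpa [mul_assoc] using h2
  have hsq : Tendsto (fun t => ‖X t‖ ^ 2) atTop (𝓝 0) := by
    refine squeeze_zero' (Eventually.of_forall fun t => sq_nonneg _) ?_ hexp
    filter_upwards [eventually_ge_atTop 0] with t ht
    exact (h.norm_le _).trans (mul_le_mul_of_nonneg_left (hW t ht) h.a_pos.le)
  have := (Real.continuous_sqrt.tendsto 0).comp hsq
  rw [tendsto_zero_iff_norm_tendsto_zero]
  simpa [Function.comp_def] using this

/-- The closed-loop vector field with the denominator of the gain bounded below by `δ`. -/
noncomputable def truncField (A : V →L[ℝ] V) (B : U →L[ℝ] V) (L : V →L[ℝ] U) (ψ : ℝ → ℝ) (kr δ t : ℝ) (v : V) :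
    V :=
  A v - (kr / max δ (1 - ψ t ^ 2 * ‖L v‖ ^ 2)) • B (L v)

theorem norm_truncField_sub_le {ψ : ℝ → ℝ} {kr δ t : ℝ} (hkr : 0 ≤ kr) (hδ : 0 < δ)
    (hψ : 0 ≤ ψ t) (v w : V) :
    ‖truncField A B L ψ kr δ t v - truncField A B L ψ kr δ t w‖
      ≤ (‖A‖ + kr * ‖B‖ * (δ⁻¹ + 2 * (δ⁻¹ * δ⁻¹)) * ‖L‖) * ‖v - w‖ := by
  have e : truncField A B L ψ kr δ t v - truncField A B L ψ kr δ t w = A (v - w)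
      - kr • B ((max δ (1 - ψ t ^ 2 * ‖L v‖ ^ 2))⁻¹ • L v
        - (max δ (1 - ψ t ^ 2 * ‖L w‖ ^ 2))⁻¹ • L w) := by
    simp only [truncField, map_sub, map_smul, div_eq_mul_inv, mul_smul, smul_sub]
    abel
  rw [e]
  have h1 := norm_truncated_gain_sub_le hδ hψ (L v) (L w)
  have h2 : ‖L v - L w‖ ≤ ‖L‖ * ‖v - w‖ := by rw [← map_sub]; exact L.le_opNorm _
  have hδ' : 0 ≤ δ⁻¹ := by positivity
  refine (norm_sub_le _ _).trans ?_
  rw [add_mul]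
  refine add_le_add (A.le_opNorm _) ?_
  rw [norm_smul, Real.norm_eq_abs, abs_of_nonneg hkr]
  calc kr * ‖B _‖ ≤ kr * (‖B‖ * ((δ⁻¹ + 2 * (δ⁻¹ * δ⁻¹)) * (‖L‖ * ‖v - w‖))) := by
        gcongr
        refine (B.le_opNorm _).trans ?_
        gcongr
        exact h1.trans (by gcongr)
    _ = _ := by ring

theorem continuous_truncField {ψ : ℝ → ℝ} {kr δ : ℝ} (hδ : 0 < δ) (hψ : Continuous ψ) :
    Continuous (Function.uncurry (truncField A B L ψ kr δ)) := by
  unfold Function.uncurry truncField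
  have : ∀ p : ℝ × V, max δ (1 - ψ p.1 ^ 2 * ‖L p.2‖ ^ 2) ≠ 0 := fun p =>
    (hδ.trans_le (le_max_left _ _)).ne'
  fun_prop (disch := exact this)

/-- Solutions of the closed loop which stay inside the funnel are unique. -/
theorem eqOn_of_truncField {ψ : ℝ → ℝ} {kr δ b : ℝ} (hkr : 0 ≤ kr) (hδ : 0 < δ)
    (hψ : ∀ t, 0 ≤ t → 0 ≤ ψ t) {X Y : ℝ → V}
    (hXc : ContinuousOn X (Icc 0 b)) (hYc : ContinuousOn Y (Icc 0 b))
    (hX : ∀ t ∈ Ico 0 b, HasDerivWithinAt X (truncField A B L ψ kr δ t (X t)) (Ici t) t)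
    (hY : ∀ t ∈ Ico 0 b, HasDerivWithinAt Y (truncField A B L ψ kr δ t (Y t)) (Ici t) t)
    (h0 : X 0 = Y 0) : EqOn X Y (Icc 0 b) := by
  set K := ‖A‖ + kr * ‖B‖ * (δ⁻¹ + 2 * (δ⁻¹ * δ⁻¹)) * ‖L‖
  refine ODE_solution_unique_of_mem_Icc_right (v := truncField A B L ψ kr δ) (s := fun _ => univ)
    (K := K.toNNReal) (fun t ht => ?_) hXc hX (fun _ _ => mem_univ _) hYc hY
    (fun _ _ => mem_univ _) h0
  refine LipschitzOnWith.of_dist_le_mul fun v _ w _ => ?_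
  rw [dist_eq_norm, dist_eq_norm, Real.coe_toNNReal _ (by positivity)]
  exact norm_truncField_sub_le hkr hδ (hψ t ht.1) v w

/-- The left side is the derivative of ψ²‖Lx‖² along the closed loop, with p and q the values of ψ
and ψ'. Coercivity gives the feedback term its sign; everything else is bounded independently of k.
-/
theorem IsEnergyForm.funnel_deriv_le (h : IsEnergyForm A B L Q a c C γ)
    {x : V} {p q k Ψ Ψ' M N : ℝ} (hk : 0 ≤ k) (hp : |p| ≤ Ψ) (hq : |q| ≤ Ψ')
    (hM : ‖L x‖ ^ 2 ≤ M) (hN : ‖x‖ ^ 2 ≤ N) :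
    2 * p * q * ‖L x‖ ^ 2 + p ^ 2 * (2 * inner ℝ (L x) (L (A x - k • B (L x))))
      ≤ 2 * Ψ * Ψ' * M + 2 * Ψ ^ 2 * (‖L ∘L A‖ * (M + N)) - 2 * (k * γ) * (p ^ 2 * ‖L x‖ ^ 2) := by
  have hΨ0 : 0 ≤ Ψ := (abs_nonneg _).trans hp
  have hΨ'0 : 0 ≤ Ψ' := (abs_nonneg _).trans hq
  have hM0 : 0 ≤ M := (sq_nonneg _).trans hM
  have hN0 : 0 ≤ N := (sq_nonneg _).trans hN
  have hpsi2 : p ^ 2 ≤ Ψ ^ 2 := by rw [← sq_abs]; gcongr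
  have b1 : p * q * ‖L x‖ ^ 2 ≤ Ψ * Ψ' * M := by
    have : p * q ≤ Ψ * Ψ' := by
      refine (le_abs_self _).trans ?_
      rw [abs_mul]; gcongr
    calc p * q * ‖L x‖ ^ 2 ≤ Ψ * Ψ' * ‖L x‖ ^ 2 := by gcongr
      _ ≤ _ := by gcongr
  have b2 : inner ℝ (L x) (L (A x)) ≤ ‖L ∘L A‖ * (M + N) := by
    refine (real_inner_le_norm _ _).trans ?_
    have h1 : ‖L (A x)‖ ≤ ‖L ∘L A‖ * ‖x‖ := (L ∘L A).le_opNorm x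
    have h2 : ‖L x‖ * ‖x‖ ≤ M + N := by
      nlinarith [sq_nonneg (‖L x‖ - ‖x‖), sq_nonneg ‖L x‖, sq_nonneg ‖x‖]
    calc ‖L x‖ * ‖L (A x)‖ ≤ ‖L x‖ * (‖L ∘L A‖ * ‖x‖) := by gcongr
      _ = ‖L ∘L A‖ * (‖L x‖ * ‖x‖) := by ring
      _ ≤ ‖L ∘L A‖ * (M + N) := by gcongr
  have b3 : p ^ 2 * inner ℝ (L x) (L (A x)) ≤ Ψ ^ 2 * (‖L ∘L A‖ * (M + N)) := by
    calc p ^ 2 * inner ℝ (L x) (L (A x)) ≤ p ^ 2 * (‖L ∘L A‖ * (M + N)) := by gcongr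
      _ ≤ _ := by gcongr
  have b4 : (k * p ^ 2) * (γ * ‖L x‖ ^ 2) ≤ (k * p ^ 2) * inner ℝ (L x) (L (B (L x))) := by
    gcongr
    exact h.coercive _
  rw [map_sub, map_smul, inner_sub_right, inner_smul_right]
  linarith

/-- Funnel control of a system with relative degree one: the output stays uniformly inside the
funnel, the state is bounded, and it tends to zero if the gain is large. -/
theorem exists_funnel_solution [CompleteSpace V] (h : IsEnergyForm A B L Q a c C γ) {ψ : ℝ → ℝ}
    (hψ : IsFunnel ψ) {kr : ℝ} (hkr : 0 < kr) (v0 : V) (h0 : ψ 0 * ‖L v0‖ < 1) :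
    ∃ (X : ℝ → V) (δ : ℝ), 0 < δ ∧ X 0 = v0 ∧
      (∀ t, 0 ≤ t → δ ≤ 1 - ψ t ^ 2 * ‖L (X t)‖ ^ 2) ∧
      (∀ t, 0 ≤ t → HasDerivAt X
        (A (X t) - (kr / (1 - ψ t ^ 2 * ‖L (X t)‖ ^ 2)) • B (L (X t))) t) ∧
      (∃ M, ∀ t, 0 ≤ t → ‖X t‖ ≤ M) ∧ (C ≤ 2 * kr * γ → Tendsto X atTop (𝓝 0)) := by
  obtain ⟨c₀, hc₀, hlow⟩ := hψ.exists_lower_bound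
  obtain ⟨Ψ, hΨ⟩ := hψ.bounded
  obtain ⟨Ψ', hΨ'⟩ := hψ.deriv_bounded
  have hγ := h.γ_pos
  have hcp := h.c_pos
  have hCp := h.C_pos
  have hap := h.a_pos
  have hΨ0 : 0 ≤ Ψ := (abs_nonneg _).trans (hΨ 0 le_rfl)
  have hΨ'0 : 0 ≤ Ψ' := (abs_nonneg _).trans (hΨ' 0 le_rfl)
  set W0 := inner ℝ (Q v0) v0 with hW0
  have hW00 : 0 ≤ W0 := h.nonneg v0
  -- M bounds ‖LX‖² inside the funnel: through the lower bound c₀ of ψ after time 1, through the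
  -- growth of the energy before. None of M, N, D involves δ, so δ may be chosen in terms of them.
  set M := (c₀⁻¹) ^ 2 + W0 * Real.exp C with hM
  have hM0 : 0 ≤ M := by positivity
  set N := a * (W0 + C * M / c) with hN
  have hN0 : 0 ≤ N := by positivity
  set D := 2 * Ψ * Ψ' * M + 2 * Ψ ^ 2 * (‖L ∘L A‖ * (M + N)) with hD
  have hD0 : 0 ≤ D := by positivity
  set g0 := ψ 0 ^ 2 * ‖L v0‖ ^ 2 with hg0
  have hψ0 := hψ.nonneg le_rfl
  have hg0lt : g0 < 1 := by
    have : 0 ≤ ψ 0 * ‖L v0‖ := by positivity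
    rw [hg0, ← mul_pow]; nlinarith
  -- The barrier level lies above the initial value g0. At g = g1 the gain is k_r/δ with γk_r/δ ≥ D
  -- + 1; together with g1 ≥ 1/2 this bounds the derivative by D - (D + 1) < 0.
  set g1 := max (1 / 2) (max ((g0 + 1) / 2) (1 - kr * γ / (D + 1))) with hg1
  have hg1half : 1 / 2 ≤ g1 := le_max_left _ _
  have hg1g0 : g0 < g1 :=
    lt_of_lt_of_le (by linarith) ((le_max_left _ _).trans (le_max_right _ _))
  have hg1kr : 1 - kr * γ / (D + 1) ≤ g1 := (le_max_right _ _).trans (le_max_right _ _)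
  have hg1lt : g1 < 1 := by
    have : 0 < kr * γ / (D + 1) := by positivity
    refine max_lt (by norm_num) (max_lt (by linarith) (by linarith))
  set δ := 1 - g1 with hδ
  have hδ0 : 0 < δ := by linarith
  -- Freezing ψ for negative times makes the field continuous on the whole line.
  set ψ' : ℝ → ℝ := fun t => ψ (max t 0) with hψ'
  have hψ'c : Continuous ψ' :=
    hψ.contDiffOn.continuousOn.comp_continuous (by fun_prop) fun t => le_max_right t 0
  have hψ'eq : ∀ t, 0 ≤ t → ψ' t = ψ t := fun t ht => by rw [hψ']; simp [ht]
  set K := ‖A‖ + kr * ‖B‖ * (δ⁻¹ + 2 * (δ⁻¹ * δ⁻¹)) * ‖L‖ with hK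
  have hK0 : 0 ≤ K := by positivity
  obtain ⟨X, hX0, hXd⟩ := exists_global_solution (truncField A B L ψ' kr δ)
    (continuous_truncField hδ0 hψ'c) (K := K + 1) (by linarith)
    (fun t v w => (norm_truncField_sub_le hkr.le hδ0 (hψ.nonneg (le_max_right _ _)) v w).trans
      (mul_le_mul_of_nonneg_right (by linarith) (norm_nonneg _)))
    (fun t => by simp [truncField]) v0
  set g : ℝ → ℝ := fun t => ψ t ^ 2 * ‖L (X t)‖ ^ 2 with hg
  set k : ℝ → ℝ := fun t => kr / max δ (1 - g t) with hkdef
  have hg_nonneg : ∀ t, 0 ≤ g t := fun t => by positivity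
  have hden : ∀ t, 0 < max δ (1 - g t) := fun t => hδ0.trans_le (le_max_left _ _)
  have hk0 : ∀ t, 0 ≤ t → 0 ≤ k t := fun t _ => (div_pos hkr (hden t)).le
  have hkge : ∀ t, kr ≤ k t := fun t => by
    rw [hkdef, le_div_iff₀ (hden t)]
    have : max δ (1 - g t) ≤ 1 := max_le (by linarith) (by linarith [hg_nonneg t])
    nlinarith
  have hXd' : ∀ t, 0 ≤ t → HasDerivAt X (A (X t) - k t • B (L (X t))) t := by
    intro t ht
    have := hXd t ht
    rwa [truncField, hψ'eq t ht] at this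
  have hXc : ContinuousOn X (Ici 0) := fun t ht => (hXd' t ht).continuousAt.continuousWithinAt
  have hgc : ContinuousOn g (Ici 0) :=
    (hψ.contDiffOn.continuousOn.pow 2).mul ((L.continuous.comp_continuousOn hXc).norm.pow 2)
  have hout : ∀ s, 0 ≤ s → g s ≤ 1 → ‖L (X s)‖ ^ 2 ≤ M := by
    intro s hs hgs
    by_cases hs1 : s ≤ 1
    · have h1 := (h.output_le (X s)).trans (h.le_exp hk0 hXd' hs)
      rw [hX0] at h1
      have h2 : W0 * Real.exp (C * s) ≤ W0 * Real.exp C := by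
        gcongr
        nlinarith
      have : 0 ≤ (c₀⁻¹) ^ 2 := by positivity
      linarith
    · push Not at hs1
      have h1 := hlow s hs1.le
      have h2 : c₀ ^ 2 * ‖L (X s)‖ ^ 2 ≤ 1 := by
        refine le_trans ?_ hgs
        simp only [hg]
        gcongr
      have h3 : ‖L (X s)‖ ^ 2 ≤ (c₀⁻¹) ^ 2 := by
        rw [inv_pow, ← one_div, le_div_iff₀ (by positivity)]
        linarith
      have : 0 ≤ W0 * Real.exp C := by positivity
      linarith
  have hstate : ∀ t, 0 ≤ t → (∀ s, 0 ≤ s → s ≤ t → g s ≤ 1) → ‖X t‖ ^ 2 ≤ N := by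
    intro t ht hs
    have h1 := h.le_of_output_le hk0 hXd' (M := M) ht fun s hs0 hst => hout s hs0 (hs s hs0 hst)
    rw [hX0] at h1
    exact (h.norm_le _).trans (mul_le_mul_of_nonneg_left h1 hap.le)
  have hbar : ∀ t, 0 ≤ t → g t < g1 := by
    refine lt_of_barrier hgc (by simpa [hg, hX0] using hg1g0) ?_
    intro t ht hgt hle
    have hle1 : ∀ s, 0 ≤ s → s ≤ t → g s ≤ 1 := fun s hs hst => (hle s hs hst).trans hg1lt.le
    have hMt := hout t ht.le (hle1 t ht.le le_rfl)
    have hNt := hstate t ht.le hle1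
    have hd1 : HasDerivAt (fun s => ‖L (X s)‖ ^ 2)
        (2 * inner ℝ (L (X t)) (L (A (X t) - k t • B (L (X t))))) t :=
      (L.hasFDerivAt.comp_hasDerivAt t (hXd' t ht.le)).norm_sq
    have hd2 : HasDerivAt g _ t := ((hψ.hasDerivAt ht).pow 2).mul hd1
    refine ⟨_, ?_, hd2⟩
    have hest := h.funnel_deriv_le (hk0 t ht.le) (hΨ t ht.le) (hΨ' t ht.le) hMt hNt
    have hkt : D + 1 ≤ k t * γ := by
      have e1 : max δ (1 - g t) = δ := by rw [hgt]; exact max_eq_left le_rfl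
      simp only [hkdef]
      rw [e1, div_mul_eq_mul_div, le_div_iff₀ hδ0]
      have : δ ≤ kr * γ / (D + 1) := by linarith
      rw [le_div_iff₀ (by linarith)] at this
      linarith
    have b5 : (D + 1) * g1 ≤ (k t * γ) * g1 := by gcongr
    have b6 : (D + 1) * (1 / 2) ≤ (D + 1) * g1 := by gcongr
    have e2 : ψ t ^ 2 * ‖L (X t)‖ ^ 2 = g1 := hgt
    rw [e2] at hest
    refine lt_of_le_of_lt (le_trans (le_of_eq ?_) hest) (b := D - 2 * (k t * γ) * g1) (by linarith)
    norm_num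
  -- The truncation is never active, so X solves the original equation.
  have hmax : ∀ t, 0 ≤ t → max δ (1 - g t) = 1 - g t := fun t ht =>
    max_eq_right (by linarith [hbar t ht])
  refine ⟨X, δ, hδ0, hX0, fun t ht => by linarith [hbar t ht], fun t ht => ?_, ⟨√N, fun t ht => ?_⟩,
    fun hC => ?_⟩
  · have := hXd' t ht
    simp only [hkdef, hmax t ht] at this
    exact this
  · exact Real.le_sqrt_of_sq_le (hstate t ht fun s hs _ => (hbar s hs).le.trans hg1lt.le)
  · refine h.tendsto_zero hk0 hXd' fun t _ => hC.trans ?_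
    have := hkge t
    gcongr

end HighGain

/-! ### Cascades of funnels -/

section Cascade

variable {U : Type*} [NormedAddCommGroup U] [InnerProductSpace ℝ U]

theorem abs_le_toReal_supNorm {f : ℝ → ℝ} (hf : supNorm f ≠ ∞) {t : ℝ} (ht : 0 < t) :
    |f t| ≤ (supNorm f).toReal := by
  have h1 : ‖f t‖ₑ ≤ supNorm f := le_iSup₂ (f := fun t (_ : t ∈ Ioi (0 : ℝ)) => ‖f t‖ₑ) t ht
  have := ENNReal.toReal_mono hf h1
  simpa using this

/-- If `e' = e⁺ - κ e`, the signal `e⁺` stays in its funnel and `κ` is large enough, then `e` stays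
uniformly inside its funnel. -/
theorem exists_funnel_bound_of_cascade {φ ψ : ℝ → ℝ} (hφ : IsFunnel φ) (hψ : IsFunnel ψ) {κ : ℝ}
    (hκ : supNorm (fun t => derivWithin φ (Ici 0) t / φ t) + supNorm (fun t => φ t / ψ t)
      < ENNReal.ofReal κ)
    {e e' : ℝ → U} (he : ∀ t, 0 ≤ t → HasDerivWithinAt e (e' t - κ • e t) (Ici 0) t)
    (h0 : φ 0 * ‖e 0‖ < 1) (h1 : ∀ t, 0 ≤ t → ψ t * ‖e' t‖ ≤ 1) :
    ∃ ε : ℝ, 0 < ε ∧ ε < 1 ∧ ∀ t, 0 ≤ t → φ t * ‖e t‖ ≤ ε := by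
  have hfin : supNorm (fun t => derivWithin φ (Ici 0) t / φ t) + supNorm (fun t => φ t / ψ t) ≠ ∞ :=
    (hκ.trans ENNReal.ofReal_lt_top).ne
  obtain ⟨hf1, hf2⟩ := ENNReal.add_ne_top.1 hfin
  set a := (supNorm (fun t => derivWithin φ (Ici 0) t / φ t)).toReal with ha
  set b := (supNorm (fun t => φ t / ψ t)).toReal with hb
  have ha0 : 0 ≤ a := ENNReal.toReal_nonneg
  have hb0 : 0 ≤ b := ENNReal.toReal_nonneg
  have hab : a + b < κ := by
    have h := hκ
    rw [← ENNReal.ofReal_toReal hfin, ENNReal.toReal_add hf1 hf2] at h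
    exact (ENNReal.ofReal_lt_ofReal_iff_of_nonneg (by positivity)).1 h
  have hκa : 0 < κ - a := by linarith
  have hq : b / (κ - a) < 1 := by rw [div_lt_one hκa]; linarith
  have hq0 : 0 ≤ b / (κ - a) := by positivity
  -- At φ‖e‖ = ε, half the derivative of φ²‖e‖² is at most ε(b - (κ - a)ε), which is negative once ε
  -- > b/(κ - a). By (K1) this ratio is below 1; the midpoints keep ε above it and above the initial
  -- value.
  set ε := max ((φ 0 * ‖e 0‖ + 1) / 2) ((b / (κ - a) + 1) / 2) with hε
  have hε1 : ε < 1 := max_lt (by linarith) (by linarith)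
  have hεq : b / (κ - a) < ε := lt_of_lt_of_le (by linarith) (le_max_right _ _)
  have hε0 : φ 0 * ‖e 0‖ < ε := lt_of_lt_of_le (by linarith) (le_max_left _ _)
  have hεpos : 0 < ε := lt_of_le_of_lt hq0 hεq
  have hεq' : b < (κ - a) * ε := by
    rw [div_lt_iff₀ hκa] at hεq; linarith
  have hec : ContinuousOn e (Ici 0) := fun t ht => (he t ht).continuousWithinAt
  have hbar : ∀ t, 0 ≤ t → φ t ^ 2 * ‖e t‖ ^ 2 < ε ^ 2 := by
    refine lt_of_barrier (g := fun t => φ t ^ 2 * ‖e t‖ ^ 2)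
      ((hφ.contDiffOn.continuousOn.pow 2).mul (hec.norm.pow 2)) ?_ ?_
    · have := hφ.nonneg le_rfl
      rw [← mul_pow]
      gcongr
    · intro t ht hgt _
      have hφt := hφ.pos t ht
      have hψt := hψ.pos t ht
      have het : HasDerivAt e (e' t - κ • e t) t := (he t ht.le).hasDerivAt (Ici_mem_nhds ht)
      refine ⟨_, ?_, ((hφ.hasDerivAt ht).pow 2).mul het.norm_sq⟩
      set φd := derivWithin φ (Ici 0) t
      have hs : φ t * ‖e t‖ = ε := by
        rw [← mul_pow] at hgt
        exact (pow_left_inj₀ (by positivity) hεpos.le two_ne_zero).1 hgt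
      have b1 : φ t * φd * ‖e t‖ ^ 2 ≤ a * ε ^ 2 := by
        have h2 : φd / φ t ≤ a := (le_abs_self _).trans (abs_le_toReal_supNorm hf1 ht)
        have h3 : φ t * φd * ‖e t‖ ^ 2 = φd / φ t * ε ^ 2 := by
          rw [← hs]; field_simp
        rw [h3]; gcongr
      have b2 : φ t ^ 2 * inner ℝ (e t) (e' t) ≤ ε * b := by
        have h2 : φ t / ψ t ≤ b := (le_abs_self _).trans (abs_le_toReal_supNorm hf2 ht)
        have h3 : φ t * ‖e' t‖ ≤ b := by
          calc φ t * ‖e' t‖ = φ t / ψ t * (ψ t * ‖e' t‖) := by field_simp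
            _ ≤ b * 1 := by
              gcongr
              exact h1 t ht.le
            _ = b := mul_one b
        calc φ t ^ 2 * inner ℝ (e t) (e' t) ≤ φ t ^ 2 * (‖e t‖ * ‖e' t‖) := by
              gcongr; exact real_inner_le_norm _ _
          _ = (φ t * ‖e t‖) * (φ t * ‖e' t‖) := by ring
          _ ≤ ε * b := by rw [hs]; gcongr
      have b3 : φ t ^ 2 * ‖e t‖ ^ 2 = ε ^ 2 := hgt
      rw [inner_sub_right, inner_smul_right, real_inner_self_eq_norm_sq]
      have b4 : a * ε ^ 2 + ε * b - κ * ε ^ 2 < 0 := by nlinarith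
      have b5 : κ * (φ t ^ 2 * ‖e t‖ ^ 2) = κ * ε ^ 2 := by rw [b3]
      norm_num
      nlinarith
  refine ⟨ε, hεpos, hε1, fun t ht => ?_⟩
  have := hbar t ht
  rw [← mul_pow] at this
  exact (lt_of_pow_lt_pow_left₀ 2 hεpos.le this).le

end Cascade

/-! ### Time domains and absolutely continuous solutions -/

section TimeDomain

theorem timeDomain_top : timeDomain ⊤ = Ici 0 := by
  ext t; simp [timeDomain, EReal.coe_lt_top]

theorem timeDomain_subset (ω : EReal) : timeDomain ω ⊆ Ici 0 := fun _ ht => ht.1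

theorem zero_mem_timeDomain {ω : EReal} (hω : 0 < ω) : (0 : ℝ) ∈ timeDomain ω := ⟨le_rfl, hω⟩

theorem Icc_subset_timeDomain {ω : EReal} {t : ℝ} (ht : t ∈ timeDomain ω) :
    Icc 0 t ⊆ timeDomain ω := fun _ hs =>
  ⟨hs.1, lt_of_le_of_lt (EReal.coe_le_coe_iff.2 hs.2) ht.2⟩

theorem exists_gt_mem_timeDomain {ω : EReal} {t : ℝ} (ht : t ∈ timeDomain ω) :
    ∃ b, t < b ∧ b ∈ timeDomain ω := by
  obtain ⟨b, hb1, hb2⟩ := EReal.lt_iff_exists_real_btwn.1 ht.2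
  have : t < b := EReal.coe_lt_coe_iff.1 hb1
  exact ⟨b, this, ht.1.trans this.le, hb2⟩

theorem convex_timeDomain (ω : EReal) : Convex ℝ (timeDomain ω) :=
  Set.OrdConnected.convex ⟨fun _ hx _ hy _ hs => Icc_subset_timeDomain hy ⟨hx.1.trans hs.1, hs.2⟩⟩

theorem uniqueDiffOn_timeDomain {ω : EReal} (hω : 0 < ω) : UniqueDiffOn ℝ (timeDomain ω) := by
  apply uniqueDiffOn_convex (convex_timeDomain ω)
  obtain ⟨b, hb, hbm⟩ := exists_gt_mem_timeDomain (zero_mem_timeDomain hω)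
  refine ⟨b / 2, mem_interior.2 ⟨Ioo 0 b, ?_, isOpen_Ioo, by constructor <;> linarith⟩⟩
  exact fun s hs => Icc_subset_timeDomain hbm ⟨hs.1.le, hs.2.le⟩

theorem Icc_mem_nhdsWithin_timeDomain {ω : EReal} {t b : ℝ} (htb : t < b) :
    Icc 0 b ∈ 𝓝[timeDomain ω] t := by
  filter_upwards [self_mem_nhdsWithin, nhdsWithin_le_nhds (Iio_mem_nhds htb)] with s hs hsb
  exact ⟨hs.1, le_of_lt hsb⟩

variable {E F : Type*} [NormedAddCommGroup E] [NormedSpace ℝ E] [NormedAddCommGroup F]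
  [NormedSpace ℝ F]

theorem absolutelyContinuousOnInterval_clm_comp {f : ℝ → E} {a b : ℝ} (T : E →L[ℝ] F)
    (hf : AbsolutelyContinuousOnInterval f a b) :
    AbsolutelyContinuousOnInterval (fun t => T (f t)) a b := by
  refine squeeze_zero (fun I => Finset.sum_nonneg fun i _ => dist_nonneg) (fun I => ?_)
    (by simpa using Tendsto.const_mul ‖T‖ hf)
  rw [Finset.mul_sum]
  refine Finset.sum_le_sum fun i _ => ?_
  rw [dist_eq_norm, dist_eq_norm, ← map_sub]
  exact T.le_opNorm _

/-- A locally absolutely continuous function whose derivative agrees almost everywhere with a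
continuous function is continuously differentiable. -/
theorem hasDerivWithinAt_of_absolutelyContinuous [CompleteSpace E] {ω : EReal} {f g : ℝ → E}
    (hf : ∀ b ∈ timeDomain ω, AbsolutelyContinuousOnInterval f 0 b)
    (hd : ∀ᵐ t : ℝ, t ∈ timeDomain ω → HasDerivAt f (g t) t)
    (hg : ContinuousOn g (timeDomain ω)) {t : ℝ} (ht : t ∈ timeDomain ω) :
    HasDerivWithinAt f (g t) (timeDomain ω) t := by
  obtain ⟨b, htb, hb⟩ := exists_gt_mem_timeDomain ht
  have hb0 : 0 ≤ b := hb.1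
  have hsub := Icc_subset_timeDomain hb
  -- A continuous extension of g has a C¹ primitive G. Then f - G is absolutely continuous with zero
  -- derivative almost everywhere, hence constant.
  set g' : ℝ → E := IccExtend hb0 ((Icc 0 b).domRestrict g) with hg'
  have hg'c : Continuous g' := (hg.mono hsub).domRestrict.Icc_extend'
  have hg'eq : ∀ s ∈ Icc 0 b, g' s = g s := fun s hs => by
    rw [hg', IccExtend_of_mem _ _ hs]; rfl
  set G : ℝ → E := fun s => ∫ τ in (0 : ℝ)..s, g' τ with hG
  have hGd : ∀ s, HasDerivAt G (g' s) s := fun s =>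
    (hg'c.integral_hasStrictDerivAt 0 s).hasDerivAt
  have hGcd : ContDiff ℝ 1 G := by
    rw [contDiff_one_iff_deriv]
    refine ⟨fun s => (hGd s).differentiableAt, ?_⟩
    have : deriv G = g' := funext fun s => (hGd s).deriv
    rwa [this]
  have hac : AbsolutelyContinuousOnInterval (f - G) 0 b :=
    (hf b hb).sub hGcd.contDiffOn.absolutelyContinuousOnInterval
  obtain ⟨c, hc⟩ := hac.const_of_ae_hasDerivAt_zero (by
    filter_upwards [hd] with s hs hmem
    rw [uIcc_of_le hb0] at hmem
    have := (hs (hsub hmem)).sub (hGd s)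
    rwa [hg'eq s hmem, sub_self] at this)
  rw [uIcc_of_le hb0] at hc
  have hfeq : ∀ s ∈ Icc 0 b, f s = G s + c := fun s hs => by
    rw [← hc s hs]; simp
  have htm : t ∈ Icc 0 b := ⟨ht.1, htb.le⟩
  have h1 : HasDerivWithinAt f (g t) (Icc 0 b) t := by
    rw [← hg'eq t htm]
    exact ((hGd t).add_const c).hasDerivWithinAt.congr hfeq (hfeq t htm)
  exact h1.mono_of_mem_nhdsWithin (Icc_mem_nhdsWithin_timeDomain htb)

theorem HasDerivAt.absolutelyContinuousOnInterval {f f' : ℝ → E} {b : ℝ} (hb : 0 ≤ b)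
    (hf : ∀ t, 0 ≤ t → HasDerivAt f (f' t) t) (hf' : ContinuousOn f' (Ici 0)) :
    AbsolutelyContinuousOnInterval f 0 b := by
  obtain ⟨M, hM⟩ := (isCompact_Icc (a := (0 : ℝ)) (b := b)).exists_bound_of_continuousOn
    (hf'.mono Icc_subset_Ici_self)
  refine LipschitzOnWith.absolutelyContinuousOnInterval (K := M.toNNReal) ?_
  rw [uIcc_of_le hb]
  refine (convex_Icc 0 b).lipschitzOnWith_of_nnnorm_hasDerivWithin_le (f' := f')
    (fun t ht => (hf t ht.1).hasDerivWithinAt) fun t ht => ?_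
  rw [← NNReal.coe_le_coe, coe_nnnorm]
  exact (hM t ht).trans (Real.le_coe_toNNReal M)

end TimeDomain

/-! ### Auxiliary output matrices -/

section OutMat

variable {R ι κ μ : Type*} [CommRing R] [Fintype ι] [DecidableEq ι]

/-- The matrices `C (A + k₀) ⋯ (A + k_{i-1})`. -/
def outMat (A : Matrix ι ι R) (C : Matrix κ ι R) (k : ℕ → R) : ℕ → Matrix κ ι R
  | 0 => C
  | i + 1 => outMat A C k i * (A + k i • 1)

theorem outMat_succ_mul_pow (A : Matrix ι ι R) (C : Matrix κ ι R) (k : ℕ → R) (i j : ℕ) :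
    outMat A C k (i + 1) * A ^ j = outMat A C k i * A ^ (j + 1) + k i • (outMat A C k i * A ^ j) := by
  rw [outMat, Matrix.mul_assoc, Matrix.add_mul, Matrix.mul_add, pow_succ']
  simp

/-- `outMat` at i is C times a monic polynomial of degree i in A, so only Markov parameters of index
at most i + j enter. -/
theorem outMat_mul_pow_mul_eq_zero {A : Matrix ι ι R} {B : Matrix ι μ R} {C : Matrix κ ι R} {r : ℕ}
    (h : ∀ k, k + 2 ≤ r → C * A ^ k * B = 0) (k : ℕ → R) (i : ℕ) :
    ∀ j, i + j + 2 ≤ r → outMat A C k i * A ^ j * B = 0 := by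
  induction i with
  | zero => intro j hj; exact h j (by omega)
  | succ i ih =>
    intro j hj
    rw [outMat_succ_mul_pow, Matrix.add_mul, Matrix.smul_mul, ih (j + 1) (by omega),
      ih j (by omega), smul_zero, add_zero]

theorem outMat_mul_eq_zero {A : Matrix ι ι R} {B : Matrix ι μ R} {C : Matrix κ ι R} {r : ℕ}
    (h : ∀ k, k + 2 ≤ r → C * A ^ k * B = 0) (k : ℕ → R) {i : ℕ} (hi : i + 2 ≤ r) :
    outMat A C k i * B = 0 := by
  simpa using outMat_mul_pow_mul_eq_zero h k i 0 hi

/-- Only the leading term of that polynomial reaches C A^(r-1) B, with coefficient 1. -/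
theorem outMat_mul_pow_mul_eq {A : Matrix ι ι R} {B : Matrix ι μ R} {C : Matrix κ ι R} {r : ℕ}
    (h : ∀ k, k + 2 ≤ r → C * A ^ k * B = 0) (k : ℕ → R) (i : ℕ) :
    ∀ j, i + j + 1 = r → outMat A C k i * A ^ j * B = C * A ^ (r - 1) * B := by
  induction i with
  | zero => intro j hj; rw [outMat, show j = r - 1 by omega]
  | succ i ih =>
    intro j hj
    rw [outMat_succ_mul_pow, Matrix.add_mul, Matrix.smul_mul, ih (j + 1) (by omega),
      outMat_mul_pow_mul_eq_zero h k i j (by omega), smul_zero, add_zero]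

/-- Modulo the range of B, which the output matrices of lower index annihilate, A acts on v as l, so
each factor A + k_s becomes the scalar l + k_s. -/
theorem outMat_mulVec_of_eq [Fintype μ] {A : Matrix ι ι R} {B : Matrix ι μ R} {C : Matrix κ ι R} {r : ℕ}
    (h : ∀ k, k + 2 ≤ r → C * A ^ k * B = 0) (k : ℕ → R) {l : R} {v : ι → R} {q : μ → R}
    (hv : A *ᵥ v = l • v + B *ᵥ q) (i : ℕ) (hi : i + 1 ≤ r) :
    outMat A C k i *ᵥ v = (∏ s ∈ Finset.range i, (l + k s)) • (C *ᵥ v) := by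
  induction i with
  | zero => simp [outMat]
  | succ i ih =>
    rw [outMat, ← Matrix.mulVec_mulVec, Matrix.add_mulVec, hv, Matrix.smul_mulVec,
      Matrix.one_mulVec, show l • v + B *ᵥ q + k i • v = (l + k i) • v + B *ᵥ q by
        rw [add_smul]; abel,
      Matrix.mulVec_add, Matrix.mulVec_smul, ih (by omega), Matrix.mulVec_mulVec,
      outMat_mul_eq_zero h k (by omega), Matrix.zero_mulVec, add_zero, smul_smul,
      Finset.prod_range_succ, mul_comm]

theorem map_outMat {R' : Type*} [CommRing R'] (f : R →+* R') (A : Matrix ι ι R) (C : Matrix κ ι R)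
    (k : ℕ → R) (i : ℕ) :
    (outMat A C k i).map f = outMat (A.map f) (C.map f) (fun s => f (k s)) i := by
  induction i with
  | zero => rfl
  | succ i ih =>
    rw [outMat, outMat, Matrix.map_mul, ih]
    congr 1
    ext a b
    by_cases hab : a = b <;> simp [hab]

end OutMat

/-! ### Zeros of linear systems -/

section Zeros

theorem eq_zero_of_rosenbrock_rank {n m : ℕ} {A : Matrix (Fin n) (Fin n) ℝ}
    {B : Matrix (Fin n) (Fin m) ℝ} {C : Matrix (Fin m) (Fin n) ℝ} {l : ℂ}
    (h : (rosenbrock A B C l).rank = n + m) {v : Fin n → ℂ} {q : Fin m → ℂ}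
    (h1 : A.map Complex.ofReal *ᵥ v + B.map Complex.ofReal *ᵥ q = l • v)
    (h2 : C.map Complex.ofReal *ᵥ v = 0) : v = 0 ∧ q = 0 := by
  have hinj : Function.Injective (rosenbrock A B C l).mulVecLin := by
    rw [← LinearMap.ker_eq_bot]
    have h3 := (rosenbrock A B C l).mulVecLin.finrank_range_add_finrank_ker
    rw [Matrix.rank] at h
    rw [h] at h3
    simp only [Module.finrank_fintype_fun_eq_card, Fintype.card_sum, Fintype.card_fin] at h3
    exact Submodule.finrank_eq_zero.1 (by omega)
  have h0 : (rosenbrock A B C l).mulVecLin (Sum.elim v q) = 0 := by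
    rw [Matrix.mulVecLin_apply, rosenbrock, Matrix.fromBlocks_mulVec]
    ext i
    cases i with
    | inl i =>
      have := congrFun h1 i
      simp only [Sum.elim_inl, Sum.elim_comp_inl, Sum.elim_comp_inr, Matrix.sub_mulVec,
        Matrix.smul_mulVec, Matrix.one_mulVec, Pi.add_apply, Pi.sub_apply, Pi.zero_apply] at this ⊢
      rw [← this]; ring
    | inr i =>
      have := congrFun h2 i
      simpa using this
  have h4 := hinj (h0.trans (map_zero _).symm)
  constructor
  · ext i; simpa using congrFun h4 (Sum.inl i)
  · ext i; simpa using congrFun h4 (Sum.inr i)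

/-- The matrix `(1 - R L) A (1 - R L) - R L`, which generates the zero dynamics of a system of
relative degree one on `ker L`. -/
def zeroDynMat {𝕜 ι κ : Type*} [CommRing 𝕜] [Fintype ι] [DecidableEq ι] [Fintype κ]
    (A : Matrix ι ι 𝕜) (R : Matrix ι κ 𝕜) (L : Matrix κ ι 𝕜) : Matrix ι ι 𝕜 :=
  (1 - R * L) * A * (1 - R * L) - R * L

variable {ι κ : Type*} [Fintype ι] [DecidableEq ι] [Fintype κ]

theorem zeroDynMat_mulVec_of_mem_ker {𝕜 : Type*} [CommRing 𝕜] {A : Matrix ι ι 𝕜}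
    {R : Matrix ι κ 𝕜} {L : Matrix κ ι 𝕜} {v : ι → 𝕜} (hv : L *ᵥ v = 0) :
    zeroDynMat A R L *ᵥ v = A *ᵥ v - R *ᵥ (L *ᵥ (A *ᵥ v)) := by
  simp only [zeroDynMat, Matrix.sub_mulVec, ← Matrix.mulVec_mulVec, hv, Matrix.one_mulVec,
    Matrix.mulVec_zero, sub_zero]

/-- Since L(1 - RL) = 0, L times the matrix is -L. The summand -RL thus gives all directions
transverse to ker L the eigenvalue -1, and an eigenvector with Re l ≥ 0 must lie in ker L. -/
theorem mulVec_eq_of_zeroDynMat_eigen [DecidableEq κ] {A : Matrix ι ι ℂ} {R : Matrix ι κ ℂ} {L : Matrix κ ι ℂ}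
    (hLR : L * R = 1) {l : ℂ} (hl : 0 ≤ l.re) {v : ι → ℂ} (hv : zeroDynMat A R L *ᵥ v = l • v) :
    L *ᵥ v = 0 ∧ A *ᵥ v = l • v + R *ᵥ (L *ᵥ (A *ᵥ v)) := by
  have hLv : L *ᵥ v = 0 := by
    have h1 := congrArg (fun w => L *ᵥ w) hv
    simp only [Matrix.mulVec_mulVec, Matrix.mulVec_smul] at h1
    have h2 : L * zeroDynMat A R L = -L := by
      have h3 : L * (1 - R * L) = 0 := by
        rw [Matrix.mul_sub, ← Matrix.mul_assoc, hLR]; simp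
      rw [zeroDynMat, Matrix.mul_sub, ← Matrix.mul_assoc, ← Matrix.mul_assoc, h3,
        ← Matrix.mul_assoc, hLR]
      simp
    rw [h2, Matrix.neg_mulVec] at h1
    have h4 : (l + 1) • (L *ᵥ v) = 0 := by
      rw [add_smul, ← h1]; simp
    rcases smul_eq_zero.1 h4 with h5 | h5
    · have := congrArg Complex.re h5
      simp at this
      linarith
    · exact h5
  refine ⟨hLv, ?_⟩
  rw [zeroDynMat_mulVec_of_mem_ker hLv] at hv
  rw [← hv]; abel

theorem map_zeroDynMat (A : Matrix ι ι ℝ) (R : Matrix ι κ ℝ) (L : Matrix κ ι ℝ) :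
    (zeroDynMat A R L).map Complex.ofReal
      = zeroDynMat (A.map Complex.ofReal) (R.map Complex.ofReal) (L.map Complex.ofReal) := by
  change (zeroDynMat A R L).map Complex.ofRealHom = zeroDynMat (A.map Complex.ofRealHom)
    (R.map Complex.ofRealHom) (L.map Complex.ofRealHom)
  have h1 : (1 - R * L).map Complex.ofRealHom
      = 1 - R.map Complex.ofRealHom * L.map Complex.ofRealHom := by
    rw [Matrix.map_sub _ (map_sub _), Matrix.map_mul, Matrix.map_one _ (map_zero _) (map_one _)]
  rw [zeroDynMat, zeroDynMat, Matrix.map_sub _ (map_sub _), Matrix.map_mul, Matrix.map_mul,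
    Matrix.map_mul, h1]

end Zeros

/-! ### Internal models -/

section InternalModel

variable {m p : ℕ}

/-- The matrix determinant lemma gives det(sI - Â + b̂ĉ) = det(sI - Â)(1 + ĉ(sI - Â)⁻¹b̂), hence χ_N
α = χ_Â β. Coprimality yields α ∣ χ_Â, and both are monic of degree p. -/
theorem charpoly_eq_of_isMinimalRealization {α β : ℝ[X]} {Ah : Matrix (Fin p) (Fin p) ℝ}
    {bh ch : Fin p → ℝ} (hα : α.Monic) (hcop : IsCoprime α β) (hdeg : α.degree = (p : WithBot ℕ))
    (h : IsMinimalRealization α β Ah bh ch) :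
    Ah.charpoly = α ∧
      (Ah - replicateCol Unit bh * replicateRow Unit ch).charpoly = β := by
  set f := algebraMap ℝ[X] (RatFunc ℝ) with hf
  have hfinj : Function.Injective f := IsFractionRing.injective _ _
  set N := Ah - replicateCol Unit bh * replicateRow Unit ch with hN
  have hα0 : f α ≠ 0 := (map_ne_zero_iff f hfinj).2 hα.ne_zero
  have hdet : ((charmatrix Ah).map f).det = f Ah.charpoly := by
    rw [Matrix.charpoly, RingHom.map_det]; rfl
  have hdet0 : f Ah.charpoly ≠ 0 := (map_ne_zero_iff f hfinj).2 Ah.charpoly_monic.ne_zero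
  set b' : Fin p → RatFunc ℝ := fun i => algebraMap ℝ (RatFunc ℝ) (bh i) with hb'
  set c' : Fin p → RatFunc ℝ := fun i => algebraMap ℝ (RatFunc ℝ) (ch i) with hc'
  have halg : ∀ x : ℝ, f (Polynomial.C x) = algebraMap ℝ (RatFunc ℝ) x := fun x =>
    (IsScalarTower.algebraMap_apply ℝ ℝ[X] (RatFunc ℝ) x).symm
  have hNmat : (charmatrix N).map f
      = (charmatrix Ah).map f + replicateCol Unit b' * replicateRow Unit c' := by
    ext i j
    simp only [Matrix.map_apply, charmatrix_apply, Matrix.add_apply, hN, Matrix.sub_apply,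
      Matrix.mul_apply, replicateCol_apply, replicateRow_apply, Finset.univ_unique,
      Finset.sum_singleton, map_sub, map_mul, halg, hb', hc']
    ring
  have hkey : f N.charpoly * f α = f Ah.charpoly * f β := by
    have h1 : f N.charpoly = ((charmatrix N).map f).det := by
      rw [Matrix.charpoly, RingHom.map_det]; rfl
    rw [h1, hNmat, det_add_replicateCol_mul_replicateRow (by rw [hdet]; exact hdet0.isUnit), hdet,
      mul_assoc]
    congr 1
    have h2 : (1 + replicateRow Unit c' * ((charmatrix Ah).map f)⁻¹ * replicateCol Unit b').det
        = c' ⬝ᵥ (((charmatrix Ah).map f)⁻¹ *ᵥ b') + 1 := by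
      rw [det_unique, Matrix.add_apply, Matrix.one_apply_eq, add_comm, Matrix.mul_assoc,
        ← Matrix.replicateCol_mulVec, Matrix.replicateRow_mul_replicateCol_apply]
    rw [h2, h.transfer, div_mul_cancel₀ _ hα0]
  rw [← map_mul, ← map_mul] at hkey
  have hkey := hfinj hkey
  have hdvd : α ∣ Ah.charpoly :=
    hcop.dvd_of_dvd_mul_right (Dvd.intro_left _ hkey)
  have hnat : α.natDegree = p := natDegree_eq_of_degree_eq_some hdeg
  have heq : Ah.charpoly = α :=
    eq_of_monic_of_dvd_of_natDegree_le hα Ah.charpoly_monic hdvd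
      (by rw [Matrix.charpoly_natDegree_eq_dim, hnat, Fintype.card_fin])
  refine ⟨heq, ?_⟩
  rw [heq, mul_comm] at hkey
  exact mul_left_cancel₀ hα.ne_zero hkey

/-- The properties of an internal model which are used below, in terms of a single block. -/
structure BlockModel (α : ℝ[X]) (At : Matrix (Fin p × Fin m) (Fin p × Fin m) ℝ)
    (Bt : Matrix (Fin p × Fin m) (Fin m) ℝ) (Ct : Matrix (Fin m) (Fin p × Fin m) ℝ)
    (Ah : Matrix (Fin p) (Fin p) ℝ) (bh ch : Fin p → ℝ) : Prop where
  At_eq : At = blockDiagonal (fun _ : Fin m => Ah)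
  Bt_eq : Bt = Matrix.of (fun (i : Fin p × Fin m) (j : Fin m) => if i.2 = j then bh i.1 else 0)
  Ct_eq : Ct = Matrix.of (fun (j : Fin m) (i : Fin p × Fin m) => if j = i.2 then ch i.1 else 0)
  natDegree_eq : α.natDegree = p
  charpoly_eq : Ah.charpoly = α
  observable : ∀ (l : ℂ) (u : Fin p → ℂ), Ah.map Complex.ofReal *ᵥ u = l • u →
    (∑ i, (ch i : ℂ) * u i) = 0 → u = 0
  zeros : ∀ (l : ℂ) (u : Fin p → ℂ), 0 ≤ l.re →
    (∀ i, (Ah.map Complex.ofReal *ᵥ u) i = l * u i + bh i * ∑ j, (ch j : ℂ) * u j) → u = 0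

theorem re_mulVec (M : Matrix (Fin p) (Fin p) ℝ) (u : Fin p → ℂ) (i : Fin p) :
    ((M.map Complex.ofReal *ᵥ u) i).re = (M *ᵥ fun j => (u j).re) i := by
  simp [Matrix.mulVec, dotProduct]

theorem im_mulVec (M : Matrix (Fin p) (Fin p) ℝ) (u : Fin p → ℂ) (i : Fin p) :
    ((M.map Complex.ofReal *ᵥ u) i).im = (M *ᵥ fun j => (u j).im) i := by
  simp [Matrix.mulVec, dotProduct]

theorem IsInternalModel.exists_blockModel {α : ℝ[X]}
    {At : Matrix (Fin p × Fin m) (Fin p × Fin m) ℝ} {Bt : Matrix (Fin p × Fin m) (Fin m) ℝ}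
    {Ct : Matrix (Fin m) (Fin p × Fin m) ℝ} (hα : α.Monic) (h : IsInternalModel α At Bt Ct) :
    ∃ Ah bh ch, BlockModel α At Bt Ct Ah bh ch := by
  obtain ⟨β, Ah, bh, ch, hβ, hcop, hdα, -, -, hmin, hA, hB, hC⟩ := h
  obtain ⟨h1, h2⟩ := charpoly_eq_of_isMinimalRealization hα hcop hdα hmin
  refine ⟨Ah, bh, ch, hA, hB, hC, natDegree_eq_of_degree_eq_some hdα, h1, ?_, ?_⟩
  · intro l u hu hcu
    have hpow : ∀ k : ℕ, (Ah ^ k).map Complex.ofReal *ᵥ u = l ^ k • u := by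
      intro k
      induction k with
      | zero =>
        have : ((1 : Matrix (Fin p) (Fin p) ℝ).map Complex.ofReal) = 1 :=
          Matrix.map_one _ Complex.ofReal_zero Complex.ofReal_one
        simp [this]
      | succ k ih =>
        have : (Ah ^ (k + 1)).map Complex.ofReal
            = (Ah ^ k).map Complex.ofReal * Ah.map Complex.ofReal := by
          rw [pow_succ]
          exact Matrix.map_mul (f := Complex.ofRealHom)
        rw [this, ← Matrix.mulVec_mulVec, hu, Matrix.mulVec_smul, ih, smul_smul, pow_succ']
    have hz : ∀ k : ℕ, ∑ i, (ch i : ℂ) * ((Ah ^ k).map Complex.ofReal *ᵥ u) i = 0 := by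
      intro k
      rw [hpow]
      have : ∑ i, (ch i : ℂ) * (l ^ k • u) i = l ^ k * ∑ i, (ch i : ℂ) * u i := by
        rw [Finset.mul_sum]
        refine Finset.sum_congr rfl fun i _ => ?_
        simp; ring
      rw [this, hcu, mul_zero]
    -- Â and ĉ are real, so the real and imaginary parts of u are unobservable separately.
    have hre : (fun j => (u j).re) = 0 := by
      apply hmin.observable
      intro k
      have := congrArg Complex.re (hz k)
      simp only [Complex.re_sum, Complex.re_ofReal_mul, re_mulVec, Complex.zero_re] at this
      exact this
    have him : (fun j => (u j).im) = 0 := by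
      apply hmin.observable
      intro k
      have := congrArg Complex.im (hz k)
      simp only [Complex.im_sum, Complex.im_ofReal_mul, im_mulVec, Complex.zero_im] at this
      exact this
    ext j
    exact Complex.ext (congrFun hre j) (congrFun him j)
  · intro l u hl hu
    by_contra hne
    -- The zeros of the internal model are the eigenvalues of Â - b̂ĉ, whose characteristic
    -- polynomial is the Hurwitz polynomial β.
    set N := Ah - replicateCol Unit bh * replicateRow Unit ch with hN
    have hNu : N.map Complex.ofReal *ᵥ u = l • u := by
      ext i
      have e : (N.map Complex.ofReal *ᵥ u) i
          = (Ah.map Complex.ofReal *ᵥ u) i - bh i * ∑ j, (ch j : ℂ) * u j := by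
        simp only [Matrix.mulVec, dotProduct, Matrix.map_apply, hN, Matrix.sub_apply,
          Matrix.mul_apply, replicateCol_apply, replicateRow_apply, Finset.univ_unique,
          Finset.sum_singleton, Complex.ofReal_sub, Complex.ofReal_mul, sub_mul,
          Finset.sum_sub_distrib, Finset.mul_sum]
        simp only [mul_assoc]
      rw [e, hu]
      simp
    have hroot : (N.map Complex.ofReal).charpoly.IsRoot l := by
      rw [← Matrix.mem_spectrum_iff_isRoot_charpoly, ← Matrix.spectrum_toLin',
        ← Module.End.hasEigenvalue_iff_mem_spectrum]
      exact Module.End.hasEigenvalue_of_hasEigenvector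
        (Module.End.hasEigenvector_iff.2 ⟨Module.End.mem_eigenspace_iff.2 (by simpa using hNu), hne⟩)
    have hmap : (N.map Complex.ofReal).charpoly = β.map Complex.ofRealHom := by
      rw [← h2]
      exact Matrix.charpoly_map N Complex.ofRealHom
    have : aeval l β = 0 := by
      rw [hmap, IsRoot.def, eval_map] at hroot
      exact hroot
    linarith [hβ l this]

end InternalModel

/-! ### Matrices as continuous linear maps -/

section MatCLM

variable {ι κ μ : Type*} [Fintype ι] [DecidableEq ι] [Fintype κ] [Fintype μ]

/-- The continuous linear map between Euclidean spaces given by a real matrix. -/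
noncomputable def matCLM (M : Matrix κ ι ℝ) : EuclideanSpace ℝ ι →L[ℝ] EuclideanSpace ℝ κ :=
  LinearMap.toContinuousLinearMap (toEuclideanLin M)

theorem matCLM_apply (M : Matrix κ ι ℝ) (v : EuclideanSpace ℝ ι) :
    matCLM M v = toEuclideanLin M v := rfl

theorem ofLp_matCLM (M : Matrix κ ι ℝ) (v : EuclideanSpace ℝ ι) :
    (matCLM M v).ofLp = M *ᵥ v.ofLp := rfl

theorem matCLM_mul [DecidableEq κ] (M : Matrix μ κ ℝ) (N : Matrix κ ι ℝ) (v : EuclideanSpace ℝ ι) :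
    matCLM (M * N) v = matCLM M (matCLM N v) := by
  apply (WithLp.ofLp_injective 2)
  simp [ofLp_matCLM, Matrix.mulVec_mulVec]

theorem matCLM_add (M N : Matrix κ ι ℝ) (v : EuclideanSpace ℝ ι) :
    matCLM (M + N) v = matCLM M v + matCLM N v := by
  simp [matCLM_apply]

theorem matCLM_smul (c : ℝ) (M : Matrix κ ι ℝ) (v : EuclideanSpace ℝ ι) :
    matCLM (c • M) v = c • matCLM M v := by
  simp [matCLM_apply]

theorem matCLM_one (v : EuclideanSpace ℝ ι) : matCLM (1 : Matrix ι ι ℝ) v = v := by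
  apply (WithLp.ofLp_injective 2)
  simp [ofLp_matCLM]

theorem matCLM_zero (v : EuclideanSpace ℝ ι) : matCLM (0 : Matrix κ ι ℝ) v = 0 := by
  simp [matCLM_apply]

/-- γ is the minimum of the form on the compact unit sphere; for m = 0 the sphere is empty and any γ
will do. -/
theorem exists_coercive {m : ℕ} (G : Matrix (Fin m) (Fin m) ℝ)
    (h : ∀ v : Fin m → ℝ, v ≠ 0 → 0 < v ⬝ᵥ (G *ᵥ v)) :
    ∃ γ : ℝ, 0 < γ ∧ ∀ u, γ * ‖u‖ ^ 2 ≤ inner ℝ u (matCLM G u) := by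
  have hinner : ∀ u : EuclideanSpace ℝ (Fin m),
      inner ℝ u (matCLM G u) = u.ofLp ⬝ᵥ (G *ᵥ u.ofLp) := by
    intro u
    rw [EuclideanSpace.inner_eq_star_dotProduct, ofLp_matCLM, dotProduct_comm]
    simp
  rcases (Metric.sphere (0 : EuclideanSpace ℝ (Fin m)) 1).eq_empty_or_nonempty with hemp | hne
  · refine ⟨1, one_pos, fun u => ?_⟩
    by_cases hu : u = 0
    · simp [hu]
    · exfalso
      have : (‖u‖⁻¹ • u) ∈ Metric.sphere (0 : EuclideanSpace ℝ (Fin m)) 1 := by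
        simp [norm_smul, hu]
      rw [hemp] at this
      exact this
  · obtain ⟨w, hw, hmin⟩ := (isCompact_sphere (0 : EuclideanSpace ℝ (Fin m)) 1).exists_isMinOn hne
      (f := fun u => inner ℝ u (matCLM G u)) (by fun_prop)
    have hw1 : ‖w‖ = 1 := by simpa using hw
    refine ⟨inner ℝ w (matCLM G w), ?_, fun u => ?_⟩
    · rw [hinner]
      apply h
      intro h0
      have : w = 0 := (WithLp.ofLp_injective 2) h0
      simp [this] at hw1
    · by_cases hu : u = 0
      · simp [hu]
      · have hu' : ‖u‖ ≠ 0 := norm_ne_zero_iff.2 hu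
        have hs : (‖u‖⁻¹ • u) ∈ Metric.sphere (0 : EuclideanSpace ℝ (Fin m)) 1 := by
          simp [norm_smul, hu]
        have h1 : inner ℝ w (matCLM G w) ≤ inner ℝ (‖u‖⁻¹ • u) (matCLM G (‖u‖⁻¹ • u)) := hmin hs
        rw [map_smul, inner_smul_left, inner_smul_right] at h1
        simp only [conj_trivial] at h1
        calc _ ≤ (‖u‖⁻¹ * (‖u‖⁻¹ * inner ℝ u (matCLM G u))) * ‖u‖ ^ 2 := by gcongr
          _ = _ := by field_simp

end MatCLM

/-! ### The series interconnection of the system and the internal model -/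

namespace LoopData

variable {n m p : ℕ} (S : LoopData n m p)

/-- The system matrix of the interconnection, with state `(x, z)` and input `w`. -/
def augA : Matrix (Fin n ⊕ Fin p × Fin m) (Fin n ⊕ Fin p × Fin m) ℝ :=
  fromBlocks S.A (S.B * S.Ct) 0 S.At

/-- The input matrix of the interconnection. -/
def augB : Matrix (Fin n ⊕ Fin p × Fin m) (Fin m) ℝ := fromRows S.B S.Bt

/-- The output matrix of the interconnection. -/
def augC : Matrix (Fin m) (Fin n ⊕ Fin p × Fin m) ℝ := fromCols S.C 0

/-- The matrix of the auxiliary error `auxErr i` as a function of the state. -/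
def errMat (i : ℕ) : Matrix (Fin m) (Fin n ⊕ Fin p × Fin m) ℝ := outMat S.augA S.augC S.k i

variable {S}

/-- The coupling block B C̃ enters only through C A^i B with i ≤ r - 2, so the internal model is
invisible in these rows. -/
theorem augC_mul_augA_pow (h : ∀ k, k + 2 ≤ S.r → S.C * S.A ^ k * S.B = 0) (j : ℕ)
    (hj : j + 1 ≤ S.r) : S.augC * S.augA ^ j = fromCols (S.C * S.A ^ j) 0 := by
  induction j with
  | zero => simp [augC]
  | succ j ih =>
    rw [pow_succ, ← Matrix.mul_assoc, ih (by omega), augA, fromCols_mul_fromBlocks, ← Matrix.mul_assoc,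
      h j (by omega), pow_succ, Matrix.mul_assoc]
    simp

theorem augC_mul_augA_pow_mul_augB (h : ∀ k, k + 2 ≤ S.r → S.C * S.A ^ k * S.B = 0) (j : ℕ)
    (hj : j + 1 ≤ S.r) : S.augC * S.augA ^ j * S.augB = S.C * S.A ^ j * S.B := by
  rw [augC_mul_augA_pow h j hj, augB, fromCols_mul_fromRows]
  simp

theorem aug_relDegree (h : ∀ k, k + 2 ≤ S.r → S.C * S.A ^ k * S.B = 0) :
    ∀ k, k + 2 ≤ S.r → S.augC * S.augA ^ k * S.augB = 0 := fun k hk => by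
  rw [augC_mul_augA_pow_mul_augB h k (by omega), h k hk]

theorem errMat_mul_augB (hr : 1 ≤ S.r) (h : ∀ k, k + 2 ≤ S.r → S.C * S.A ^ k * S.B = 0) :
    S.errMat (S.r - 1) * S.augB = S.C * S.A ^ (S.r - 1) * S.B := by
  have := outMat_mul_pow_mul_eq (aug_relDegree h) S.k (S.r - 1) 0 (by omega)
  rw [pow_zero, Matrix.mul_one, augC_mul_augA_pow_mul_augB h _ (by omega)] at this
  exact this

theorem map_augA_mulVec (v : Fin n ⊕ Fin p × Fin m → ℂ) :
    S.augA.map Complex.ofReal *ᵥ v = Sum.elim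
      (S.A.map Complex.ofReal *ᵥ (v ∘ Sum.inl)
        + S.B.map Complex.ofReal *ᵥ (S.Ct.map Complex.ofReal *ᵥ (v ∘ Sum.inr)))
      (S.At.map Complex.ofReal *ᵥ (v ∘ Sum.inr)) := by
  have e : (S.B * S.Ct).map Complex.ofReal = S.B.map Complex.ofReal * S.Ct.map Complex.ofReal :=
    Matrix.map_mul (f := Complex.ofRealHom)
  have e0 : (0 : Matrix (Fin p × Fin m) (Fin n) ℝ).map Complex.ofReal = 0 :=
    Matrix.map_zero _ Complex.ofReal_zero
  rw [augA, fromBlocks_map, fromBlocks_mulVec, e, e0, Matrix.mulVec_mulVec]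
  simp

theorem map_augB_mulVec (q : Fin m → ℂ) :
    S.augB.map Complex.ofReal *ᵥ q
      = Sum.elim (S.B.map Complex.ofReal *ᵥ q) (S.Bt.map Complex.ofReal *ᵥ q) := by
  ext i
  cases i <;> rfl

theorem map_augC_mulVec (v : Fin n ⊕ Fin p × Fin m → ℂ) :
    S.augC.map Complex.ofReal *ᵥ v = S.C.map Complex.ofReal *ᵥ (v ∘ Sum.inl) := by
  ext i
  simp [augC, Matrix.mulVec, dotProduct]

variable {α : ℝ[X]} {Ah : Matrix (Fin p) (Fin p) ℝ} {bh ch : Fin p → ℝ}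

theorem map_At_mulVec (h : BlockModel α S.At S.Bt S.Ct Ah bh ch) (v : Fin p × Fin m → ℂ)
    (i : Fin p) (j : Fin m) :
    (S.At.map Complex.ofReal *ᵥ v) (i, j)
      = (Ah.map Complex.ofReal *ᵥ fun i' => v (i', j)) i := by
  rw [h.At_eq]
  simp only [Matrix.mulVec, dotProduct, Matrix.map_apply, blockDiagonal_apply,
    Fintype.sum_prod_type]
  refine Finset.sum_congr rfl fun i' _ => ?_
  rw [Finset.sum_eq_single j] <;> simp +contextual [eq_comm]

theorem map_Bt_mulVec (h : BlockModel α S.At S.Bt S.Ct Ah bh ch) (q : Fin m → ℂ)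
    (i : Fin p) (j : Fin m) : (S.Bt.map Complex.ofReal *ᵥ q) (i, j) = bh i * q j := by
  rw [h.Bt_eq]
  simp only [Matrix.mulVec, dotProduct, Matrix.map_apply, Matrix.of_apply]
  rw [Finset.sum_eq_single j] <;> simp +contextual [eq_comm]

theorem map_Ct_mulVec (h : BlockModel α S.At S.Bt S.Ct Ah bh ch) (v : Fin p × Fin m → ℂ)
    (j : Fin m) : (S.Ct.map Complex.ofReal *ᵥ v) j = ∑ i, (ch i : ℂ) * v (i, j) := by
  rw [h.Ct_eq]
  simp only [Matrix.mulVec, dotProduct, Matrix.map_apply, Matrix.of_apply, Fintype.sum_prod_type]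
  refine Finset.sum_congr rfl fun i' _ => ?_
  rw [Finset.sum_eq_single j] <;> simp +contextual [eq_comm]

/-- The interconnection has no zeros in the closed right half plane. -/
theorem aug_minPhase (hmin : IsMinimumPhase S.A S.B S.C)
    (h : BlockModel α S.At S.Bt S.Ct Ah bh ch) {l : ℂ} (hl : 0 ≤ l.re)
    {v : Fin n ⊕ Fin p × Fin m → ℂ} {q : Fin m → ℂ}
    (hv : S.augA.map Complex.ofReal *ᵥ v = l • v + S.augB.map Complex.ofReal *ᵥ q)
    (hC : S.augC.map Complex.ofReal *ᵥ v = 0) : v = 0 := by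
  rw [map_augA_mulVec, map_augB_mulVec] at hv
  rw [map_augC_mulVec] at hC
  have h1 : S.A.map Complex.ofReal *ᵥ (v ∘ Sum.inl)
      + S.B.map Complex.ofReal *ᵥ (S.Ct.map Complex.ofReal *ᵥ (v ∘ Sum.inr))
      = l • (v ∘ Sum.inl) + S.B.map Complex.ofReal *ᵥ q := by
    ext i
    have := congrFun hv (Sum.inl i)
    simpa using this
  have h2 : S.At.map Complex.ofReal *ᵥ (v ∘ Sum.inr)
      = l • (v ∘ Sum.inr) + S.Bt.map Complex.ofReal *ᵥ q := by
    ext i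
    have := congrFun hv (Sum.inr i)
    simpa using this
  -- The total plant input C̃z - q must vanish along with the plant state. With q = C̃z, each block
  -- of z satisfies the equation of a zero of the internal model.
  obtain ⟨h3, h4⟩ := eq_zero_of_rosenbrock_rank (hmin l hl) (v := v ∘ Sum.inl)
    (q := S.Ct.map Complex.ofReal *ᵥ (v ∘ Sum.inr) - q)
    (by rw [Matrix.mulVec_sub, ← add_sub_assoc, h1, add_sub_cancel_right]) hC
  have hq : q = S.Ct.map Complex.ofReal *ᵥ (v ∘ Sum.inr) := (sub_eq_zero.1 h4).symm
  have h5 : ∀ j, (fun i => v (Sum.inr (i, j))) = 0 := by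
    intro j
    refine h.zeros l _ hl fun i => ?_
    have h6 := congrFun h2 (i, j)
    rw [map_At_mulVec h, Pi.add_apply, map_Bt_mulVec h, hq, map_Ct_mulVec h] at h6
    exact h6
  ext i
  rcases i with i | ⟨i, j⟩
  · exact congrFun h3 i
  · exact congrFun (h5 j) i

/-- No root of `α` is an unobservable mode of the interconnection. -/
theorem aug_observable (hα : RootsAvoidZeros S.A S.B S.C α)
    (h : BlockModel α S.At S.Bt S.Ct Ah bh ch) {l : ℂ} (hl : aeval l α = 0)
    {v : Fin n ⊕ Fin p × Fin m → ℂ} (hv : S.augA.map Complex.ofReal *ᵥ v = l • v)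
    (hC : S.augC.map Complex.ofReal *ᵥ v = 0) : v = 0 := by
  rw [map_augA_mulVec] at hv
  rw [map_augC_mulVec] at hC
  have h1 : S.A.map Complex.ofReal *ᵥ (v ∘ Sum.inl)
      + S.B.map Complex.ofReal *ᵥ (S.Ct.map Complex.ofReal *ᵥ (v ∘ Sum.inr))
      = l • (v ∘ Sum.inl) := by
    ext i
    have := congrFun hv (Sum.inl i)
    simpa using this
  have h2 : S.At.map Complex.ofReal *ᵥ (v ∘ Sum.inr) = l • (v ∘ Sum.inr) := by
    ext i
    have := congrFun hv (Sum.inr i)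
    simpa using this
  obtain ⟨h3, h4⟩ := eq_zero_of_rosenbrock_rank (hα l hl) h1 hC
  have h5 : ∀ j, (fun i => v (Sum.inr (i, j))) = 0 := by
    intro j
    refine h.observable l _ ?_ ?_
    · ext i
      have h6 := congrFun h2 (i, j)
      rw [map_At_mulVec h] at h6
      exact h6
    · have h6 := congrFun h4 j
      rw [map_Ct_mulVec h] at h6
      exact h6
  ext i
  rcases i with i | ⟨i, j⟩
  · exact congrFun h3 i
  · exact congrFun (h5 j) i

/-- An eigenvector v of the zero dynamics with Re l ≥ 0 satisfies 𝒜v = lv + ℬq and 0 = Lv = ∏(l +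
k_s) 𝒞v. The product is nonzero because k_s > 0, so 𝒞v = 0 and v is an unstable zero direction of
the interconnection, which `aug_minPhase` excludes. Lyapunov's theorem then supplies P. -/
theorem exists_energy (hr : 1 ≤ S.r) (hsys : InSystemClass S.A S.B S.C S.r)
    (h : BlockModel α S.At S.Bt S.Ct Ah bh ch) (hk : ∀ i, i + 1 < S.r → 0 < S.k i) :
    ∃ Q a c C γ, IsEnergyForm (matCLM S.augA) (matCLM S.augB) (matCLM (S.errMat (S.r - 1)))
      Q a c C γ := by
  obtain ⟨⟨hrel, hunit⟩, hmin, hpos⟩ := hsys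
  set Γ := S.C * S.A ^ (S.r - 1) * S.B with hΓ
  set L := S.errMat (S.r - 1) with hL
  have hLB : L * S.augB = Γ := errMat_mul_augB hr hrel
  have hdet : IsUnit Γ.det := (Matrix.isUnit_iff_isUnit_det _).1 hunit
  set R := S.augB * Γ⁻¹ with hR
  have hLR : L * R = 1 := by
    rw [hR, ← Matrix.mul_assoc, hLB, Matrix.mul_nonsing_inv _ hdet]
  have hRB : R * (L * S.augB) = S.augB := by
    rw [hLB, hR, Matrix.mul_assoc, Matrix.nonsing_inv_mul _ hdet, Matrix.mul_one]
  obtain ⟨γ, hγ, hcoer⟩ := exists_coercive Γ hpos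
  obtain ⟨P, c₀, hc₀, hsymm, hP, hdec⟩ := exists_lyapunov (zeroDynMat S.augA R L) (by
    intro l v hl hv
    rw [map_zeroDynMat] at hv
    have hLRc : L.map Complex.ofReal * R.map Complex.ofReal = 1 := by
      have : (L * R).map Complex.ofReal = L.map Complex.ofReal * R.map Complex.ofReal :=
        Matrix.map_mul (f := Complex.ofRealHom)
      rw [← this, hLR, Matrix.map_one _ Complex.ofReal_zero Complex.ofReal_one]
    obtain ⟨h1, h2⟩ := mulVec_eq_of_zeroDynMat_eigen hLRc hl hv
    have hRc : R.map Complex.ofReal = S.augB.map Complex.ofReal * Γ⁻¹.map Complex.ofReal :=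
      Matrix.map_mul (f := Complex.ofRealHom)
    rw [hRc, ← Matrix.mulVec_mulVec] at h2
    have hrelc : ∀ k, k + 2 ≤ S.r → S.augC.map Complex.ofReal * S.augA.map Complex.ofReal ^ k
        * S.augB.map Complex.ofReal = 0 := by
      intro k hk
      have e1 := congrArg (fun M => M.map Complex.ofRealHom) (aug_relDegree hrel k hk)
      simp only [Matrix.map_mul, Matrix.map_zero _ (map_zero Complex.ofRealHom)] at e1
      have e2 : (S.augA ^ k).map Complex.ofRealHom = S.augA.map Complex.ofRealHom ^ k :=
        map_pow Complex.ofRealHom.mapMatrix S.augA k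
      rw [e2] at e1
      exact e1
    have h3 := outMat_mulVec_of_eq hrelc (fun s => (S.k s : ℂ)) h2 (S.r - 1) (by omega)
    have h4 : L.map Complex.ofReal = outMat (S.augA.map Complex.ofReal)
        (S.augC.map Complex.ofReal) (fun s => (S.k s : ℂ)) (S.r - 1) :=
      map_outMat Complex.ofRealHom _ _ _ _
    rw [← h4, h1] at h3
    have h5 : ∏ s ∈ Finset.range (S.r - 1), (l + (S.k s : ℂ)) ≠ 0 := by
      rw [Finset.prod_ne_zero_iff]
      intro s hs h0
      have h6 := congrArg Complex.re h0
      have h7 := hk s (by have := Finset.mem_range.1 hs; omega)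
      simp at h6
      linarith
    exact aug_minPhase hmin h hl h2 ((smul_eq_zero.1 h3.symm).resolve_left h5))
  obtain ⟨Q, a, c, C, hQ⟩ := exists_isEnergyForm (matCLM S.augA) (matCLM S.augB) (matCLM L)
    (matCLM R) (fun u => by rw [← matCLM_mul, hLR, matCLM_one])
    (fun u => by rw [← matCLM_mul L, ← matCLM_mul, hRB]) hγ
    (fun u => by rw [← matCLM_mul, hLB]; exact hcoer u) P hc₀ hsymm hP (fun v hv => by
      have h1 : L *ᵥ v.ofLp = 0 := congrArg WithLp.ofLp hv
      have h2 : toEuclideanLin (zeroDynMat S.augA R L) v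
          = matCLM S.augA v - matCLM R (matCLM L (matCLM S.augA v)) := by
        apply (WithLp.ofLp_injective 2)
        exact zeroDynMat_mulVec_of_mem_ker h1
      rw [← h2]
      exact hdec v)
  exact ⟨Q, a, c, C, γ, hQ⟩

end LoopData

/-! ### Generating the reference signal -/

section LinearODE

variable {U : Type*} [NormedAddCommGroup U] [NormedSpace ℝ U]

/-- A solution of a scalar-coefficient linear differential equation with zero initial jet
vanishes. -/
theorem jet_eq_zero {α : ℝ[X]} (hα : α.Monic) {J : ℕ → ℝ → U}
    (hJ : ∀ j t, 0 ≤ t → HasDerivWithinAt (J j) (J (j + 1) t) (Ici 0) t)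
    (heq : ∀ t, 0 ≤ t → ∑ j ∈ Finset.range (α.natDegree + 1), α.coeff j • J j t = 0)
    (h0 : ∀ j, j < α.natDegree → J j 0 = 0) : ∀ t, 0 ≤ t → J 0 t = 0 := by
  set p := α.natDegree with hp
  set Y : ℝ → Fin p → U := fun t j => J j t with hY
  set Y' : ℝ → Fin p → U := fun t j => J (j + 1) t with hY'
  -- K bounds the companion matrix of α in the sup norm: a shift and one row of coefficients.
  set K : ℝ := 1 + ∑ j ∈ Finset.range p, |α.coeff j| with hK
  have hsum0 : 0 ≤ ∑ j ∈ Finset.range p, |α.coeff j| := Finset.sum_nonneg fun _ _ => abs_nonneg _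
  have htop : ∀ t, 0 ≤ t → J p t = -∑ j ∈ Finset.range p, α.coeff j • J j t := by
    intro t ht
    have h1 := heq t ht
    rw [Finset.sum_range_succ, hα.coeff_natDegree, one_smul] at h1
    exact eq_neg_of_add_eq_zero_right h1
  have hle : ∀ t j, j < p → ‖J j t‖ ≤ ‖Y t‖ := fun t j hj => norm_le_pi_norm (Y t) ⟨j, hj⟩
  have hYd : ∀ t, 0 ≤ t → HasDerivWithinAt Y (Y' t) (Ici 0) t := fun t ht =>
    hasDerivWithinAt_pi.2 fun j => hJ j t ht
  have hbound : ∀ t, 0 ≤ t → ‖Y' t‖ ≤ K * ‖Y t‖ := by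
    intro t ht
    rw [pi_norm_le_iff_of_nonneg (by positivity)]
    intro j
    rcases Nat.lt_or_ge (j + 1) p with hj | hj
    · calc ‖J (j + 1) t‖ ≤ ‖Y t‖ := hle t _ hj
        _ ≤ K * ‖Y t‖ := by
          rw [hK, add_mul, one_mul]
          linarith [mul_nonneg hsum0 (norm_nonneg (Y t))]
    · have hjp : (j : ℕ) + 1 = p := by have := j.2; omega
      have e : Y' t j = J p t := by rw [← hjp]
      rw [e, htop t ht, norm_neg]
      refine (norm_sum_le _ _).trans ?_
      rw [hK, add_mul, Finset.sum_mul]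
      have : ∑ i ∈ Finset.range p, ‖α.coeff i • J i t‖
          ≤ ∑ i ∈ Finset.range p, |α.coeff i| * ‖Y t‖ := by
        refine Finset.sum_le_sum fun i hi => ?_
        rw [norm_smul, Real.norm_eq_abs]
        exact mul_le_mul_of_nonneg_left (hle t i (Finset.mem_range.1 hi)) (abs_nonneg _)
      linarith [norm_nonneg (Y t)]
  have hYz : ∀ t, 0 ≤ t → Y t = 0 := by
    intro t ht
    refine eq_zero_of_abs_deriv_le_mul_abs_self_of_eq_zero_right (f := Y) (f' := Y') (K := K)
      (a := 0) (b := t) (fun s hs => ((hYd s hs.1).continuousWithinAt).mono Icc_subset_Ici_self)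
      (fun s hs => (hYd s hs.1).mono (Ici_subset_Ici.2 hs.1)) ?_ (fun s hs => hbound s hs.1) t
      ⟨ht, le_rfl⟩
    ext j
    exact h0 j j.2
  intro t ht
  rcases Nat.eq_zero_or_pos p with h | h
  · have := htop t ht
    rw [h] at this
    simpa using this
  · exact congrFun (hYz t ht) ⟨0, h⟩

theorem hasDerivWithinAt_iteratedDerivWithin {w : ℝ → U}
    (hw : ContDiffOn ℝ ((⊤ : ℕ∞) : WithTop ℕ∞) w (Ici 0)) (j : ℕ) {t : ℝ} (ht : 0 ≤ t) :
    HasDerivWithinAt (iteratedDerivWithin j w (Ici 0)) (iteratedDerivWithin (j + 1) w (Ici 0) t)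
      (Ici 0) t := by
  rw [iteratedDerivWithin_succ]
  exact ((hw.differentiableOn_iteratedDerivWithin (m := j)
    (by exact_mod_cast ENat.natCast_lt_top j) (uniqueDiffOn_Ici 0)) t ht).hasDerivWithinAt

end LinearODE

/-- A nonzero invariant subspace over ℂ contains an eigenvector. This reduces observability to a
test on eigenvectors. -/
theorem submodule_eq_bot_of_no_eigenvector {W : Type*} [AddCommGroup W] [Module ℂ W]
    [FiniteDimensional ℂ W] (T : W →ₗ[ℂ] W) (N : Submodule ℂ W) (hN : ∀ v ∈ N, T v ∈ N)
    (h : ∀ (l : ℂ) (v : W), v ∈ N → T v = l • v → v = 0) : N = ⊥ := by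
  by_contra hne
  have : Nontrivial N := Submodule.nontrivial_iff_ne_bot.2 hne
  obtain ⟨l, hl⟩ := Module.End.exists_eigenvalue (T.restrict hN)
  obtain ⟨v, hv⟩ := hl.exists_hasEigenvector
  apply hv.2
  have h1 := congrArg Subtype.val hv.apply_eq_smul
  exact Subtype.ext (h l v v.2 (by simpa using h1))

theorem map_aeval_mulVec_of_eigen {ι : Type*} [Fintype ι] [DecidableEq ι] (A : Matrix ι ι ℝ)
    {l : ℂ} {v : ι → ℂ} (hv : A.map Complex.ofReal *ᵥ v = l • v) (q : ℝ[X]) :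
    (aeval A q).map Complex.ofReal *ᵥ v = (aeval l q) • v := by
  have hpow : ∀ k : ℕ, (A ^ k).map Complex.ofReal *ᵥ v = l ^ k • v := by
    intro k
    have e : (A ^ k).map Complex.ofReal = A.map Complex.ofReal ^ k :=
      map_pow Complex.ofRealHom.mapMatrix A k
    rw [e]
    induction k with
    | zero => simp
    | succ k ih =>
      have e' : (A ^ k).map Complex.ofReal = A.map Complex.ofReal ^ k :=
        map_pow Complex.ofRealHom.mapMatrix A k
      rw [pow_succ, ← Matrix.mulVec_mulVec, hv, Matrix.mulVec_smul, ih e', smul_smul, pow_succ']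
  induction q using Polynomial.induction_on' with
  | add f g hf hg =>
    have e : (aeval A f + aeval A g).map Complex.ofReal
        = (aeval A f).map Complex.ofReal + (aeval A g).map Complex.ofReal :=
      Matrix.map_add _ Complex.ofReal_add _ _
    rw [map_add, map_add, e, Matrix.add_mulVec, hf, hg, add_smul]
  | monomial k c =>
    rw [aeval_monomial, aeval_monomial, ← Algebra.smul_def, ← Algebra.smul_def]
    have e : (c • A ^ k).map Complex.ofReal = (c : ℂ) • (A ^ k).map Complex.ofReal := by
      ext i j; simp
    rw [e, Matrix.smul_mulVec, hpow, smul_assoc]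
    simp

/-! ### Observability and output jets on ker α(𝒜) -/

namespace LoopData

variable {n m p : ℕ} {S : LoopData n m p}
variable {α : ℝ[X]} {Ah : Matrix (Fin p) (Fin p) ℝ} {bh ch : Fin p → ℝ}

/-- The interconnection is observable on `ker α(𝒜)`. -/
theorem eq_zero_of_unobservable (hα : RootsAvoidZeros S.A S.B S.C α)
    (h : BlockModel α S.At S.Bt S.Ct Ah bh ch) {X : Fin n ⊕ Fin p × Fin m → ℝ}
    (hX : aeval S.augA α *ᵥ X = 0) (hC : ∀ j : ℕ, (S.augC * S.augA ^ j) *ᵥ X = 0) : X = 0 := by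
  set Ac := S.augA.map Complex.ofReal with hAc
  set N : Submodule ℂ (Fin n ⊕ Fin p × Fin m → ℂ) :=
    LinearMap.ker (toLin' ((aeval S.augA α).map Complex.ofReal)) ⊓
      ⨅ j : ℕ, LinearMap.ker (toLin' ((S.augC * S.augA ^ j).map Complex.ofReal)) with hN
  have hmem : ∀ v, v ∈ N ↔ (aeval S.augA α).map Complex.ofReal *ᵥ v = 0 ∧
      ∀ j : ℕ, (S.augC * S.augA ^ j).map Complex.ofReal *ᵥ v = 0 := by
    intro v
    simp [hN, Submodule.mem_inf, Submodule.mem_iInf, LinearMap.mem_ker]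
  have hbot : N = ⊥ := by
    refine submodule_eq_bot_of_no_eigenvector (toLin' Ac) N ?_ ?_
    · intro v hv
      rw [hmem] at hv ⊢
      rw [toLin'_apply]
      refine ⟨?_, fun j => ?_⟩
      · have e : (aeval S.augA α).map Complex.ofReal * Ac
            = Ac * (aeval S.augA α).map Complex.ofReal := by
          have h1 : aeval S.augA α * S.augA = S.augA * aeval S.augA α := by
            have h3 : aeval S.augA (α * Polynomial.X) = aeval S.augA (Polynomial.X * α) := by rw [mul_comm]
            rwa [map_mul, map_mul, aeval_X] at h3
          have h2 := congrArg (fun M => M.map Complex.ofRealHom) h1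
          simp only [Matrix.map_mul] at h2
          exact h2
        rw [Matrix.mulVec_mulVec, e, ← Matrix.mulVec_mulVec, hv.1, Matrix.mulVec_zero]
      · have e : (S.augC * S.augA ^ j).map Complex.ofReal * Ac
            = (S.augC * S.augA ^ (j + 1)).map Complex.ofReal := by
          rw [pow_succ, ← Matrix.mul_assoc]
          exact (Matrix.map_mul (f := Complex.ofRealHom)).symm
        rw [Matrix.mulVec_mulVec, e]
        exact hv.2 (j + 1)
    · intro l v hv hTv
      rw [toLin'_apply] at hTv
      rw [hmem] at hv
      by_contra hne
      have h1 := map_aeval_mulVec_of_eigen S.augA hTv α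
      rw [hv.1] at h1
      have hl : aeval l α = 0 := (smul_eq_zero.1 h1.symm).resolve_right hne
      have h2 := hv.2 0
      rw [pow_zero, Matrix.mul_one] at h2
      exact hne (aug_observable hα h hl hTv h2)
  have hXc : (fun i => (X i : ℂ)) ∈ N := by
    have hlift : ∀ {κ : Type} (M : Matrix κ (Fin n ⊕ Fin p × Fin m) ℝ), M *ᵥ X = 0 →
        M.map Complex.ofReal *ᵥ (fun i => (X i : ℂ)) = 0 := by
      intro κ M hM
      ext i
      have := congrArg Complex.ofReal (congrFun hM i)
      simpa [Matrix.mulVec, dotProduct] using this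
    rw [hmem]
    exact ⟨hlift _ hX, fun j => hlift _ (hC j)⟩
  rw [hbot, Submodule.mem_bot] at hXc
  ext i
  exact Complex.ofReal_eq_zero.1 (congrFun hXc i)

/-- 𝒜 is block triangular: the z-component evolves on its own, one copy of Â per block. -/
theorem aeval_augA_mulVec_inr (h : BlockModel α S.At S.Bt S.Ct Ah bh ch) (q : ℝ[X])
    (X : Fin n ⊕ Fin p × Fin m → ℝ) (i : Fin p) (j : Fin m) :
    (aeval S.augA q *ᵥ X) (Sum.inr (i, j))
      = (aeval Ah q *ᵥ fun i' => X (Sum.inr (i', j))) i := by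
  have hstep : ∀ (Y : Fin n ⊕ Fin p × Fin m → ℝ) (i : Fin p),
      (S.augA *ᵥ Y) (Sum.inr (i, j)) = (Ah *ᵥ fun i' => Y (Sum.inr (i', j))) i := by
    intro Y i
    rw [augA, h.At_eq, fromBlocks_mulVec]
    simp only [Sum.elim_inr, Matrix.zero_mulVec, Matrix.mulVec, dotProduct, blockDiagonal_apply,
      Fintype.sum_prod_type, zero_add, Function.comp]
    refine Finset.sum_congr rfl fun i' _ => ?_
    rw [Finset.sum_eq_single j] <;> simp +contextual [eq_comm]
  have hpow : ∀ (k : ℕ) (i : Fin p), (S.augA ^ k *ᵥ X) (Sum.inr (i, j))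
      = (Ah ^ k *ᵥ fun i' => X (Sum.inr (i', j))) i := by
    intro k
    induction k with
    | zero => intro i; simp
    | succ k ih =>
      intro i
      rw [pow_succ', pow_succ', ← Matrix.mulVec_mulVec, ← Matrix.mulVec_mulVec, hstep, funext ih]
  induction q using Polynomial.induction_on' with
  | add f g hf hg =>
    rw [map_add, map_add, Matrix.add_mulVec, Matrix.add_mulVec, Pi.add_apply, Pi.add_apply, hf, hg]
  | monomial k c =>
    rw [aeval_monomial, aeval_monomial, ← Algebra.smul_def, ← Algebra.smul_def, Matrix.smul_mulVec,
      Matrix.smul_mulVec, Pi.smul_apply, Pi.smul_apply, hpow]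

/-- As α is monic and α(𝒜)X = 0, each 𝒞𝒜^(s+p)X is a combination of lower ones, so p vanishing
derivatives force all of them to vanish. -/
theorem eq_zero_of_initial_jet (hmonic : α.Monic) (hα : RootsAvoidZeros S.A S.B S.C α)
    (h : BlockModel α S.At S.Bt S.Ct Ah bh ch) {X : Fin n ⊕ Fin p × Fin m → ℝ}
    (hX : aeval S.augA α *ᵥ X = 0) (hC : ∀ j : ℕ, j < p → (S.augC * S.augA ^ j) *ᵥ X = 0) :
    X = 0 := by
  have hlead : α.coeff p = 1 := by
    have := hmonic.coeff_natDegree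
    rwa [h.natDegree_eq] at this
  refine eq_zero_of_unobservable hα h hX fun j => ?_
  induction j using Nat.strong_induction_on with
  | _ j ih =>
    rcases Nat.lt_or_ge j p with hj | hj
    · exact hC j hj
    · obtain ⟨s, rfl⟩ : ∃ s, j = s + p := ⟨j - p, by omega⟩
      have h1 : S.augC *ᵥ (S.augA ^ s *ᵥ (aeval S.augA α *ᵥ X)) = 0 := by simp [hX]
      rw [aeval_eq_sum_range, h.natDegree_eq, Finset.sum_range_succ, hlead, one_smul, Matrix.add_mulVec, Matrix.mulVec_add,
        Matrix.mulVec_add, Matrix.sum_mulVec, Matrix.mulVec_sum, Matrix.mulVec_sum] at h1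
      have h2 : ∑ i ∈ Finset.range p,
          S.augC *ᵥ (S.augA ^ s *ᵥ ((α.coeff i • S.augA ^ i) *ᵥ X)) = 0 := by
        refine Finset.sum_eq_zero fun i hi => ?_
        have hi' := Finset.mem_range.1 hi
        have h3 := ih (s + i) (by omega)
        rw [pow_add, ← Matrix.mulVec_mulVec, ← Matrix.mulVec_mulVec] at h3
        rw [Matrix.smul_mulVec, Matrix.mulVec_smul, Matrix.mulVec_smul, h3, smul_zero]
      rw [h2, zero_add] at h1
      rw [pow_add, ← Matrix.mulVec_mulVec, ← Matrix.mulVec_mulVec]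
      exact h1

/-- Every initial jet of order `p` is attained by an output of the interconnection. -/
theorem exists_initial_jet (hmonic : α.Monic) (hα : RootsAvoidZeros S.A S.B S.C α)
    (h : BlockModel α S.At S.Bt S.Ct Ah bh ch) (y : Fin p → Fin m → ℝ) :
    ∃ X : Fin n ⊕ Fin p × Fin m → ℝ, aeval S.augA α *ᵥ X = 0 ∧
      ∀ j : Fin p, (S.augC * S.augA ^ (j : ℕ)) *ᵥ X = y j := by
  set f := toLin' (aeval S.augA α) with hf
  set O : LinearMap.ker f →ₗ[ℝ] (Fin p → Fin m → ℝ) :=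
    (LinearMap.pi fun j : Fin p => toLin' (S.augC * S.augA ^ (j : ℕ))) ∘ₗ
      (LinearMap.ker f).subtype with hO
  have hOapp : ∀ X j, O X j = (S.augC * S.augA ^ (j : ℕ)) *ᵥ X.1 := fun X j => rfl
  have hinj : Function.Injective O := by
    rw [← LinearMap.ker_eq_bot, LinearMap.ker_eq_bot']
    intro X hX
    apply Subtype.ext
    refine eq_zero_of_initial_jet hmonic hα h (LinearMap.mem_ker.1 X.2) fun j hj => ?_
    have := congrFun hX ⟨j, hj⟩
    rwa [hOapp] at this
  -- By Cayley–Hamilton for Â, the z-component of α(𝒜)X vanishes. The range thus has dimension at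
  -- most n and the kernel at least pm, which upgrades injectivity of the jet map to bijectivity.
  have hrange : Module.finrank ℝ (LinearMap.range f) ≤ n := by
    set g : LinearMap.range f →ₗ[ℝ] (Fin n → ℝ) :=
      (LinearMap.funLeft ℝ ℝ Sum.inl) ∘ₗ (LinearMap.range f).subtype with hg
    have hginj : Function.Injective g := by
      rw [← LinearMap.ker_eq_bot, LinearMap.ker_eq_bot']
      rintro ⟨Y, X, rfl⟩ hY
      apply Subtype.ext
      ext i
      rcases i with i | ⟨i, j⟩
      · exact congrFun hY i
      · change (toLin' (aeval S.augA α) X) (Sum.inr (i, j)) = 0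
        rw [toLin'_apply, aeval_augA_mulVec_inr h, ← h.charpoly_eq, aeval_self_charpoly]
        simp
    have := LinearMap.finrank_le_finrank_of_injective hginj
    simpa using this
  have hdim : Module.finrank ℝ (LinearMap.ker f) = Module.finrank ℝ (Fin p → Fin m → ℝ) := by
    apply le_antisymm (LinearMap.finrank_le_finrank_of_injective hinj)
    have h1 := f.finrank_range_add_finrank_ker
    have h2 : Module.finrank ℝ (Fin p → Fin m → ℝ) = p * m := by
      simp [Module.finrank_pi_fintype]
    simp only [Module.finrank_fintype_fun_eq_card, Fintype.card_sum, Fintype.card_prod,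
      Fintype.card_fin] at h1
    rw [h2]
    omega
  obtain ⟨X, hX⟩ := (LinearMap.injective_iff_surjective_of_finrank_eq_finrank hdim).1 hinj y
  exact ⟨X.1, LinearMap.mem_ker.1 X.2, fun j => by rw [← hOapp, hX]⟩

end LoopData

/-! ### Linear flows and boundedness from bounded outputs -/

section Flow

variable {V U : Type*} [NormedAddCommGroup V] [NormedSpace ℝ V]
  [NormedAddCommGroup U] [NormedSpace ℝ U]

theorem exp_zero_smul_apply (A : V →L[ℝ] V) (v : V) : NormedSpace.exp ((0 : ℝ) • A) v = v := by
  rw [zero_smul, NormedSpace.exp_zero]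
  rfl

theorem hasDerivAt_exp_smul_apply [CompleteSpace V] (A : V →L[ℝ] V) (v : V) (t : ℝ) :
    HasDerivAt (fun s : ℝ => NormedSpace.exp (s • A) v) (A (NormedSpace.exp (t • A) v)) t :=
  (hasDerivAt_exp_smul_const' A t).clm_apply (hasDerivAt_const t v) |> fun h => by simpa using h

theorem exp_smul_apply_apply [CompleteSpace V] (A : V →L[ℝ] V) (v : V) (s t : ℝ) :
    NormedSpace.exp (s • A) (NormedSpace.exp (t • A) v) = NormedSpace.exp ((s + t) • A) v := by
  let +nondep : NormedAlgebra ℚ (V →L[ℝ] V) := .restrictScalars ℚ ℝ (V →L[ℝ] V)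
  rw [add_smul, NormedSpace.exp_add_of_commute
    (((Commute.refl A).smul_left s).smul_right t)]
  rfl

theorem apply_exp_smul_of_commute {A M : V →L[ℝ] V} (h : Commute M A) {v : V} (hv : M v = 0)
    (t : ℝ) : M (NormedSpace.exp (t • A) v) = 0 := by
  have h1 : Commute M (NormedSpace.exp (t • A)) := (h.smul_right t).exp_right
  have h2 : M (NormedSpace.exp (t • A) v) = NormedSpace.exp (t • A) (M v) :=
    congrArg (fun T : V →L[ℝ] V => T v) h1.eq
  rw [h2, hv, map_zero]

/-- If `(C, A)` is observable on an `A`-invariant finite-dimensional kernel, then the trajectories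
in this kernel with bounded output are bounded. -/
theorem bounded_of_bounded_output [CompleteSpace V] [FiniteDimensional ℝ V] {A M : V →L[ℝ] V} (hcomm : Commute M A)
    (C : V →L[ℝ] U) (hobs : ∀ v, M v = 0 → (∀ j : ℕ, C ((A ^ j) v) = 0) → v = 0) {v : V}
    (hv : M v = 0) (hb : BoundedSignal fun t : ℝ => C (NormedSpace.exp (t • A) v)) :
    BoundedSignal fun t : ℝ => NormedSpace.exp (t • A) v := by
  have hcont : ∀ w : V, Continuous fun s : ℝ => NormedSpace.exp (s • A) w := fun w =>
    continuous_iff_continuousAt.2 fun t => (hasDerivAt_exp_smul_apply A w t).continuousAt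
  -- T sends a state to its output on a window of length 1. Observability makes it injective, hence
  -- bounded below in finite dimension; on the window [t, t + 1] it bounds the state at t by the
  -- supremum of the output.
  let T : LinearMap.ker (M : V →ₗ[ℝ] V) →ₗ[ℝ] C(Icc (0 : ℝ) 1, U) :=
    { toFun := fun w => ⟨fun s => C (NormedSpace.exp ((s : ℝ) • A) w.1),
        C.continuous.comp ((hcont w.1).comp continuous_subtype_val)⟩
      map_add' := fun w w' => by ext s; simp
      map_smul' := fun c w => by ext s; simp }
  have hT : LinearMap.ker T = ⊥ := by
    rw [LinearMap.ker_eq_bot']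
    intro w hw
    apply Subtype.ext
    refine hobs w.1 w.2 fun j => ?_
    have hz : ∀ j : ℕ, ∀ s ∈ Icc (0 : ℝ) 1, C ((A ^ j) (NormedSpace.exp (s • A) w.1)) = 0 := by
      intro j
      induction j with
      | zero =>
        intro s hs
        have := congrArg (fun g : C(Icc (0 : ℝ) 1, U) => g ⟨s, hs⟩) hw
        simpa [T] using this
      | succ j ih =>
        intro s hs
        have h1 : HasDerivWithinAt (fun τ : ℝ => C ((A ^ j) (NormedSpace.exp (τ • A) w.1)))
            (C ((A ^ j) (A (NormedSpace.exp (s • A) w.1)))) (Icc 0 1) s :=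
          ((C ∘L (A ^ j)).hasFDerivAt.comp_hasDerivAt s
            (hasDerivAt_exp_smul_apply A w.1 s)).hasDerivWithinAt
        have h2 : HasDerivWithinAt (fun τ : ℝ => C ((A ^ j) (NormedSpace.exp (τ • A) w.1)))
            0 (Icc 0 1) s :=
          (hasDerivWithinAt_const s (Icc 0 1) (0 : U)).congr ih (ih s hs)
        rw [pow_succ]
        exact ((uniqueDiffOn_Icc (zero_lt_one' ℝ)) s hs).eq_deriv _ h1 h2
    have := hz j 0 ⟨le_rfl, zero_le_one⟩
    simpa using this
  obtain ⟨K, -, hK⟩ := T.exists_antilipschitzWith hT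
  obtain ⟨N, hN⟩ := hb
  refine ⟨K * N, fun t ht => ?_⟩
  set w : LinearMap.ker (M : V →ₗ[ℝ] V) :=
    ⟨NormedSpace.exp (t • A) v, apply_exp_smul_of_commute hcomm hv t⟩ with hw
  have h1 : ‖w‖ ≤ K * ‖T w‖ := ZeroHomClass.bound_of_antilipschitz T hK w
  have hN0 : 0 ≤ N := (norm_nonneg _).trans (hN 0 le_rfl)
  have h2 : ‖T w‖ ≤ N := by
    rw [ContinuousMap.norm_le _ hN0]
    intro s
    have : T w s = C (NormedSpace.exp (((s : ℝ) + t) • A) v) := by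
      rw [← exp_smul_apply_apply]; rfl
    rw [this]
    exact hN _ (add_nonneg s.2.1 ht)
  calc ‖NormedSpace.exp (t • A) v‖ = ‖w‖ := rfl
    _ ≤ K * N := h1.trans (by gcongr)

end Flow

section MatCLM

variable {ι κ : Type*} [Fintype ι] [DecidableEq ι] [Fintype κ]

theorem matCLM_pow (M : Matrix ι ι ℝ) (j : ℕ) (v : EuclideanSpace ℝ ι) :
    matCLM (M ^ j) v = (matCLM M ^ j) v := by
  induction j generalizing v with
  | zero => simp [matCLM_one]
  | succ j ih => rw [pow_succ, matCLM_mul, ih, pow_succ]; rfl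

theorem commute_matCLM_aeval (M : Matrix ι ι ℝ) (q : ℝ[X]) :
    Commute (matCLM (aeval M q)) (matCLM M) := by
  have h1 : aeval M q * M = M * aeval M q := by
    have h3 : aeval M (q * Polynomial.X) = aeval M (Polynomial.X * q) := by rw [mul_comm]
    rwa [map_mul, map_mul, aeval_X] at h3
  ext1 v
  change matCLM (aeval M q) (matCLM M v) = matCLM M (matCLM (aeval M q) v)
  rw [← matCLM_mul, ← matCLM_mul, h1]

end MatCLM

namespace LoopData

variable {n m p : ℕ} {S : LoopData n m p}
variable {α : ℝ[X]} {Ah : Matrix (Fin p) (Fin p) ℝ} {bh ch : Fin p → ℝ}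

/-- The internal model principle: the reference signal is an output of the undriven
interconnection, along a trajectory which is bounded if the reference signal is. -/
theorem exists_reference_trajectory (hmonic : α.Monic) (hα : RootsAvoidZeros S.A S.B S.C α)
    (h : BlockModel α S.At S.Bt S.Ct Ah bh ch) (href : S.yref ∈ RefClass m α) :
    ∃ Xr : ℝ → EuclideanSpace ℝ (Fin n ⊕ Fin p × Fin m),
      (∀ t, HasDerivAt Xr (matCLM S.augA (Xr t)) t) ∧
      (∀ t, 0 ≤ t → S.yref t = matCLM S.augC (Xr t)) ∧
      (BoundedSignal S.yref → BoundedSignal Xr) := by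
  obtain ⟨hsmooth, hode⟩ := href
  obtain ⟨X, hX, hjet⟩ := exists_initial_jet hmonic hα h
    fun j => (iteratedDerivWithin j S.yref (Ici 0) 0).ofLp
  set v : EuclideanSpace ℝ (Fin n ⊕ Fin p × Fin m) := WithLp.toLp 2 X with hv
  set Xr : ℝ → EuclideanSpace ℝ (Fin n ⊕ Fin p × Fin m) :=
    fun t => NormedSpace.exp (t • matCLM S.augA) v with hXr
  have hd : ∀ t, HasDerivAt Xr (matCLM S.augA (Xr t)) t := hasDerivAt_exp_smul_apply _ v
  have hMv : matCLM (aeval S.augA α) v = 0 := by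
    apply (WithLp.ofLp_injective 2)
    rw [ofLp_matCLM]
    exact hX
  have hMX : ∀ t, matCLM (aeval S.augA α) (Xr t) = 0 :=
    apply_exp_smul_of_commute (commute_matCLM_aeval _ _) hMv
  have hXr0 : Xr 0 = v := exp_zero_smul_apply _ v
  have heq : ∀ t, 0 ≤ t → S.yref t = matCLM S.augC (Xr t) := by
    -- Both terms are annihilated by α(d/dt), the second because α(𝒜)Xr = 0, and their jets of order
    -- p agree at 0.
    set J : ℕ → ℝ → EuclideanSpace ℝ (Fin m) := fun j t =>
      iteratedDerivWithin j S.yref (Ici 0) t - matCLM (S.augC * S.augA ^ j) (Xr t) with hJ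
    have := jet_eq_zero hmonic (J := J) ?_ ?_ ?_
    · intro t ht
      have h1 := this t ht
      simp only [hJ, iteratedDerivWithin_zero, pow_zero, Matrix.mul_one] at h1
      exact sub_eq_zero.1 h1
    · intro j t ht
      refine (hasDerivWithinAt_iteratedDerivWithin hsmooth j ht).sub ?_
      have h1 := ((matCLM (S.augC * S.augA ^ j)).hasFDerivAt.comp_hasDerivAt t
        (hd t)).hasDerivWithinAt (s := Ici 0)
      rw [← matCLM_mul, Matrix.mul_assoc, ← pow_succ] at h1
      exact h1
    · intro t ht
      have h1 : ∑ j ∈ Finset.range (α.natDegree + 1),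
          α.coeff j • matCLM (S.augC * S.augA ^ j) (Xr t) = 0 := by
        have h2 : matCLM S.augC (matCLM (aeval S.augA α) (Xr t)) = 0 := by rw [hMX, map_zero]
        apply (WithLp.ofLp_injective 2)
        have h3 := congrArg WithLp.ofLp h2
        rw [ofLp_matCLM, ofLp_matCLM, aeval_eq_sum_range, Matrix.sum_mulVec,
          Matrix.mulVec_sum] at h3
        rw [← h3, WithLp.ofLp_sum]
        refine Finset.sum_congr rfl fun j _ => ?_
        rw [WithLp.ofLp_smul, ofLp_matCLM, Matrix.smul_mulVec, Matrix.mulVec_smul,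
          Matrix.mulVec_mulVec]
      simp only [hJ, smul_sub, Finset.sum_sub_distrib]
      rw [h1, hode t ht, sub_zero]
    · intro j hj
      rw [h.natDegree_eq] at hj
      simp only [hJ, hXr0]
      rw [sub_eq_zero]
      apply (WithLp.ofLp_injective 2)
      rw [ofLp_matCLM]
      exact (hjet ⟨j, hj⟩).symm
  refine ⟨Xr, hd, heq, fun hb => ?_⟩
  refine bounded_of_bounded_output (commute_matCLM_aeval S.augA α) (matCLM S.augC) ?_ hMv ?_
  · intro w hw hobs
    apply (WithLp.ofLp_injective 2)
    refine eq_zero_of_unobservable hα h (congrArg WithLp.ofLp hw) fun j => ?_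
    have h1 := congrArg WithLp.ofLp (hobs j)
    rw [← matCLM_pow, ← matCLM_mul] at h1
    exact h1
  · obtain ⟨N, hN⟩ := hb
    exact ⟨N, fun t ht => (congrArg norm (heq t ht)).symm.trans_le (hN t ht)⟩

end LoopData

theorem iteratedDerivWithin_eq_of_jet {U : Type*} [NormedAddCommGroup U] [NormedSpace ℝ U]
    {f : ℝ → U} {J : ℕ → ℝ → U} {N : ℕ} (h0 : ∀ t, 0 ≤ t → f t = J 0 t)
    (hJ : ∀ j, j < N → ∀ t, 0 ≤ t → HasDerivWithinAt (J j) (J (j + 1) t) (Ici 0) t) :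
    ∀ j, j ≤ N → ∀ t, 0 ≤ t → iteratedDerivWithin j f (Ici 0) t = J j t := by
  intro j
  induction j with
  | zero => intro _ t ht; rw [iteratedDerivWithin_zero]; exact h0 t ht
  | succ j ih =>
    intro hj t ht
    rw [iteratedDerivWithin_succ, derivWithin_congr (s := Ici 0) (f := J j)
      (fun s hs => ih (by omega) s hs) (ih (by omega) t ht)]
    exact (hJ j (by omega) t ht).derivWithin ((uniqueDiffOn_Ici 0) t ht)

namespace LoopData

variable {n m p : ℕ} {S : LoopData n m p}

/-! ### The joint state -/

section Join

/-- The joint state `(x, z)` as a vector of the Euclidean space of the interconnection. -/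
noncomputable def join (x : EuclideanSpace ℝ (Fin n)) (z : EuclideanSpace ℝ (Fin p × Fin m)) :
    EuclideanSpace ℝ (Fin n ⊕ Fin p × Fin m) :=
  matCLM (fromRows 1 0) x + matCLM (fromRows 0 1) z

/-- The first component of the joint state. -/
noncomputable def stateX :
    EuclideanSpace ℝ (Fin n ⊕ Fin p × Fin m) →L[ℝ] EuclideanSpace ℝ (Fin n) :=
  matCLM (fromCols 1 0)

/-- The second component of the joint state. -/
noncomputable def stateZ :
    EuclideanSpace ℝ (Fin n ⊕ Fin p × Fin m) →L[ℝ] EuclideanSpace ℝ (Fin p × Fin m) :=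
  matCLM (fromCols 0 1)

theorem ofLp_join (x : EuclideanSpace ℝ (Fin n)) (z : EuclideanSpace ℝ (Fin p × Fin m)) :
    (join x z).ofLp = Sum.elim x.ofLp z.ofLp := by
  rw [join, WithLp.ofLp_add, ofLp_matCLM, ofLp_matCLM, fromRows_mulVec, fromRows_mulVec]
  ext i
  cases i <;> simp

theorem ofLp_stateX (v : EuclideanSpace ℝ (Fin n ⊕ Fin p × Fin m)) :
    (stateX v).ofLp = v.ofLp ∘ Sum.inl := by
  rw [stateX, ofLp_matCLM, fromCols_mulVec]
  simp

theorem ofLp_stateZ (v : EuclideanSpace ℝ (Fin n ⊕ Fin p × Fin m)) :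
    (stateZ v).ofLp = v.ofLp ∘ Sum.inr := by
  rw [stateZ, ofLp_matCLM, fromCols_mulVec]
  simp

@[simp]
theorem stateX_join (x : EuclideanSpace ℝ (Fin n)) (z : EuclideanSpace ℝ (Fin p × Fin m)) :
    stateX (join x z) = x := by
  apply (WithLp.ofLp_injective 2)
  rw [ofLp_stateX, ofLp_join, Sum.elim_comp_inl]

@[simp]
theorem stateZ_join (x : EuclideanSpace ℝ (Fin n)) (z : EuclideanSpace ℝ (Fin p × Fin m)) :
    stateZ (join x z) = z := by
  apply (WithLp.ofLp_injective 2)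
  rw [ofLp_stateZ, ofLp_join, Sum.elim_comp_inr]

@[simp]
theorem join_state (v : EuclideanSpace ℝ (Fin n ⊕ Fin p × Fin m)) :
    join (stateX v) (stateZ v) = v := by
  apply (WithLp.ofLp_injective 2)
  rw [ofLp_join, ofLp_stateX, ofLp_stateZ, Sum.elim_comp_inl_inr]

theorem aug_join (x : EuclideanSpace ℝ (Fin n)) (z : EuclideanSpace ℝ (Fin p × Fin m))
    (w : EuclideanSpace ℝ (Fin m)) :
    matCLM S.augA (join x z) + matCLM S.augB w
      = join (toEuclideanLin S.A x + toEuclideanLin S.B (toEuclideanLin S.Ct z + w))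
          (toEuclideanLin S.At z + toEuclideanLin S.Bt w) := by
  apply (WithLp.ofLp_injective 2)
  rw [ofLp_join, WithLp.ofLp_add, ofLp_matCLM, ofLp_matCLM, ofLp_join, augA, augB,
    fromBlocks_mulVec, fromRows_mulVec]
  simp only [← matCLM_apply, WithLp.ofLp_add, ofLp_matCLM, Matrix.mulVec_add,
    Matrix.mulVec_mulVec]
  ext i
  cases i <;> simp [add_assoc]

theorem augC_join (x : EuclideanSpace ℝ (Fin n)) (z : EuclideanSpace ℝ (Fin p × Fin m)) (j : ℕ)
    (hrel : ∀ k, k + 2 ≤ S.r → S.C * S.A ^ k * S.B = 0) (hj : j + 1 ≤ S.r) :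
    matCLM (S.augC * S.augA ^ j) (join x z) = toEuclideanLin (S.C * S.A ^ j) x := by
  apply (WithLp.ofLp_injective 2)
  rw [← matCLM_apply, ofLp_matCLM, ofLp_matCLM, augC_mul_augA_pow hrel j hj, ofLp_join,
    fromCols_mulVec]
  simp

end Join

/-! ### Errors as functions of the joint state -/

/-- The deviation of the joint state from a reference trajectory. -/
noncomputable def deviation (x : ℝ → EuclideanSpace ℝ (Fin n))
    (z : ℝ → EuclideanSpace ℝ (Fin p × Fin m))
    (Xr : ℝ → EuclideanSpace ℝ (Fin n ⊕ Fin p × Fin m)) (t : ℝ) :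
    EuclideanSpace ℝ (Fin n ⊕ Fin p × Fin m) :=
  join (x t) (z t) - Xr t

theorem errMat_succ_apply (i : ℕ) (v : EuclideanSpace ℝ (Fin n ⊕ Fin p × Fin m)) :
    matCLM (S.errMat (i + 1)) v
      = matCLM (S.errMat i) (matCLM S.augA v) + S.k i • matCLM (S.errMat i) v := by
  have e : S.errMat (i + 1) = S.errMat i * S.augA + S.k i • S.errMat i := by
    rw [errMat, errMat, outMat, Matrix.mul_add]
    simp
  rw [e, matCLM_add, matCLM_smul, matCLM_mul]

variable {x : ℝ → EuclideanSpace ℝ (Fin n)} {z : ℝ → EuclideanSpace ℝ (Fin p × Fin m)}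
  {Xr : ℝ → EuclideanSpace ℝ (Fin n ⊕ Fin p × Fin m)} {ω : EReal} {kr : ℝ}

theorem trackErr_eq (hr : 1 ≤ S.r) (hrel : ∀ k, k + 2 ≤ S.r → S.C * S.A ^ k * S.B = 0)
    (hy : ∀ t, 0 ≤ t → S.yref t = matCLM S.augC (Xr t)) {t : ℝ} (ht : 0 ≤ t) :
    S.trackErr x t = matCLM S.augC (deviation x z Xr t) := by
  have h1 := augC_join (S := S) (x t) (z t) 0 hrel (by omega)
  rw [pow_zero, pow_zero, Matrix.mul_one, Matrix.mul_one] at h1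
  rw [trackErr, deviation, map_sub, h1, hy t ht]

/-- While the input stays out of the derivative, d/dt + k_i is multiplication of the output matrix
by 𝒜 + k_i. That fact is the hypothesis `hd`, which is verified separately for arbitrary solutions
and for the constructed one. -/
theorem auxErr_eq (hr : 1 ≤ S.r) (hrel : ∀ k, k + 2 ≤ S.r → S.C * S.A ^ k * S.B = 0)
    (hω : 0 < ω) (hy : ∀ t, 0 ≤ t → S.yref t = matCLM S.augC (Xr t))
    (hd : ∀ i, i + 2 ≤ S.r → ∀ t ∈ timeDomain ω,
      HasDerivWithinAt (fun s => matCLM (S.errMat i) (deviation x z Xr s))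
        (matCLM (S.errMat i) (matCLM S.augA (deviation x z Xr t))) (timeDomain ω) t) (i : ℕ) :
    i + 1 ≤ S.r → ∀ t ∈ timeDomain ω,
      S.auxErr ω x i t = matCLM (S.errMat i) (deviation x z Xr t) := by
  induction i with
  | zero => intro _ t ht; exact trackErr_eq hr hrel hy ht.1
  | succ i ih =>
    intro hi t ht
    have h1 := ih (by omega)
    change derivWithin (S.auxErr ω x i) (timeDomain ω) t + S.k i • S.auxErr ω x i t = _
    rw [derivWithin_congr h1 (h1 t ht), h1 t ht, errMat_succ_apply,
      (hd i (by omega) t ht).derivWithin (uniqueDiffOn_timeDomain hω t ht)]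

/-- The formal initial jets obey the recursion of `errMat`; z0 does not contribute, by the relative
degree. -/
theorem initErr_eq (hrel : ∀ k, k + 2 ≤ S.r → S.C * S.A ^ k * S.B = 0)
    (hXr : ∀ t, HasDerivAt Xr (matCLM S.augA (Xr t)) t)
    (hy : ∀ t, 0 ≤ t → S.yref t = matCLM S.augC (Xr t)) (i : ℕ) :
    ∀ j, i + j + 1 ≤ S.r →
      S.initErr i j = matCLM (S.errMat i * S.augA ^ j) (join S.x0 S.z0 - Xr 0) := by
  induction i with
  | zero =>
    intro j hj
    have h1 := iteratedDerivWithin_eq_of_jet (f := S.yref) (N := j)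
      (J := fun j t => matCLM (S.augC * S.augA ^ j) (Xr t))
      (fun t ht => by simpa using hy t ht) (fun j _ t _ => by
        have h1 := ((matCLM (S.augC * S.augA ^ j)).hasFDerivAt.comp_hasDerivAt t
          (hXr t)).hasDerivWithinAt (s := Ici 0)
        rw [← matCLM_mul, Matrix.mul_assoc, ← pow_succ] at h1
        exact h1) j le_rfl 0 le_rfl
    rw [initErr, h1, map_sub]
    congr 1
    exact (augC_join S.x0 S.z0 j hrel (by omega)).symm
  | succ i ih =>
    intro j hj
    rw [initErr, ih (j + 1) (by omega), ih j (by omega), ← matCLM_smul, ← matCLM_add]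
    congr 2
    rw [errMat, errMat, outMat_succ_mul_pow]

theorem K2.lt (hK2 : S.K2) (hrel : ∀ k, k + 2 ≤ S.r → S.C * S.A ^ k * S.B = 0)
    (hXr : ∀ t, HasDerivAt Xr (matCLM S.augA (Xr t)) t)
    (hy : ∀ t, 0 ≤ t → S.yref t = matCLM S.augC (Xr t)) {i : ℕ} (hi : i < S.r) :
    S.φ i 0 * ‖matCLM (S.errMat i) (join S.x0 S.z0 - Xr 0)‖ < 1 := by
  have h1 := hK2 i hi
  rw [initErr_eq hrel hXr hy i 0 (by omega), pow_zero, Matrix.mul_one] at h1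
  exact h1

/-! ### Solutions are classical -/

theorem errMat_apply_augB (hrel : ∀ k, k + 2 ≤ S.r → S.C * S.A ^ k * S.B = 0) {i : ℕ}
    (hi : i + 2 ≤ S.r) (w : EuclideanSpace ℝ (Fin m)) :
    matCLM (S.errMat i) (matCLM S.augB w) = 0 := by
  rw [← matCLM_mul, errMat, outMat_mul_eq_zero (aug_relDegree hrel) S.k hi, matCLM_zero]

theorem IsSolution.absolutelyContinuous_join (h : S.IsSolution kr ω x z) {b : ℝ}
    (hb : b ∈ timeDomain ω) :
    AbsolutelyContinuousOnInterval (fun t => join (x t) (z t)) 0 b :=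
  (absolutelyContinuousOnInterval_clm_comp _ (h.ac_x b hb)).add
    (absolutelyContinuousOnInterval_clm_comp _ (h.ac_z b hb))

theorem IsSolution.ae_hasDerivAt_join (h : S.IsSolution kr ω x z) :
    ∀ᵐ t : ℝ, t ∈ timeDomain ω → HasDerivAt (fun s => join (x s) (z s))
      (matCLM S.augA (join (x t) (z t)) + matCLM S.augB (S.ctrl kr ω x t)) t := by
  filter_upwards [h.ode_x, h.ode_z] with t hx hz ht
  rw [aug_join]
  exact ((matCLM (fromRows 1 0)).hasFDerivAt.comp_hasDerivAt t (hx ht)).add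
    ((matCLM (fromRows 0 1)).hasFDerivAt.comp_hasDerivAt t (hz ht))

theorem IsSolution.continuousOn_join (h : S.IsSolution kr ω x z) :
    ContinuousOn (fun t => join (x t) (z t)) (timeDomain ω) := by
  intro t ht
  obtain ⟨b, htb, hb⟩ := exists_gt_mem_timeDomain ht
  have h1 := (h.absolutelyContinuous_join hb).continuousOn
  rw [uIcc_of_le hb.1] at h1
  exact (h1 t ⟨ht.1, htb.le⟩).mono_of_mem_nhdsWithin (Icc_mem_nhdsWithin_timeDomain htb)

theorem IsSolution.continuousOn_deviation (h : S.IsSolution kr ω x z)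
    (hXr : ∀ t, HasDerivAt Xr (matCLM S.augA (Xr t)) t) :
    ContinuousOn (deviation x z Xr) (timeDomain ω) :=
  h.continuousOn_join.sub fun t _ => (hXr t).continuousAt.continuousWithinAt

/-- This breaks a circle: the input is built from e_r, itself defined by derivatives of a merely
absolutely continuous state. For indices at most r - 2 the input drops out, so the derivative is
almost everywhere a continuous function of time and therefore exists everywhere. -/
theorem IsSolution.auxErr_eq (h : S.IsSolution kr ω x z) (hr : 1 ≤ S.r)
    (hrel : ∀ k, k + 2 ≤ S.r → S.C * S.A ^ k * S.B = 0)
    (hXr : ∀ t, HasDerivAt Xr (matCLM S.augA (Xr t)) t)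
    (hy : ∀ t, 0 ≤ t → S.yref t = matCLM S.augC (Xr t)) {i : ℕ} (hi : i + 1 ≤ S.r) {t : ℝ}
    (ht : t ∈ timeDomain ω) :
    S.auxErr ω x i t = matCLM (S.errMat i) (deviation x z Xr t) := by
  refine LoopData.auxErr_eq hr hrel h.pos hy ?_ i hi t ht
  intro i hi t ht
  have h1 : HasDerivWithinAt (fun s => matCLM (S.errMat i) (join (x s) (z s)))
      (matCLM (S.errMat i) (matCLM S.augA (join (x t) (z t)))) (timeDomain ω) t := by
    refine hasDerivWithinAt_of_absolutelyContinuous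
      (g := fun t => matCLM (S.errMat i) (matCLM S.augA (join (x t) (z t))))
      (fun b hb => absolutelyContinuousOnInterval_clm_comp _ (h.absolutelyContinuous_join hb)) ?_
      (((matCLM (S.errMat i)).continuous.comp (matCLM S.augA).continuous).comp_continuousOn
        h.continuousOn_join) ht
    filter_upwards [h.ae_hasDerivAt_join] with s hs hmem
    have h2 := (matCLM (S.errMat i)).hasFDerivAt.comp_hasDerivAt s (hs hmem)
    rw [map_add, errMat_apply_augB hrel hi, add_zero] at h2
    exact h2
  have h2 := h1.sub ((matCLM (S.errMat i)).hasFDerivAt.comp_hasDerivAt t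
    (hXr t)).hasDerivWithinAt
  rw [← map_sub, ← map_sub] at h2
  refine h2.congr (fun s _ => ?_) ?_ <;> simp [deviation]

/-- The last auxiliary error as a function of the deviation. -/
noncomputable abbrev lastCLM (S : LoopData n m p) :
    EuclideanSpace ℝ (Fin n ⊕ Fin p × Fin m) →L[ℝ] EuclideanSpace ℝ (Fin m) :=
  matCLM (S.errMat (S.r - 1))

/-- The denominator of the gain as a function of time and the deviation. -/
noncomputable def denom (S : LoopData n m p) (t : ℝ)
    (v : EuclideanSpace ℝ (Fin n ⊕ Fin p × Fin m)) : ℝ :=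
  1 - S.φ (S.r - 1) t ^ 2 * ‖S.lastCLM v‖ ^ 2

theorem continuousOn_denom {s : Set ℝ} (hs : s ⊆ Ici 0) (hφ : IsFunnel (S.φ (S.r - 1)))
    {X : ℝ → EuclideanSpace ℝ (Fin n ⊕ Fin p × Fin m)} (hX : ContinuousOn X s) :
    ContinuousOn (fun t => S.denom t (X t)) s :=
  continuousOn_const.sub (((hφ.contDiffOn.continuousOn.mono hs).pow 2).mul
    ((S.lastCLM.continuous.comp_continuousOn hX).norm.pow 2))

theorem gainDenom_eq {t : ℝ} {v : EuclideanSpace ℝ (Fin n ⊕ Fin p × Fin m)}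
    (hv : S.auxErr ω x (S.r - 1) t = S.lastCLM v) : S.gainDenom ω x t = S.denom t v := by
  rw [gainDenom, lastErr, hv, denom]

theorem ctrl_eq {t : ℝ} {v : EuclideanSpace ℝ (Fin n ⊕ Fin p × Fin m)}
    (hv : S.auxErr ω x (S.r - 1) t = S.lastCLM v) :
    S.ctrl kr ω x t = -((kr / S.denom t v) • S.lastCLM v) := by
  rw [ctrl, gain, gainDenom_eq hv, lastErr, hv]

theorem denom_init_pos (hr : 1 ≤ S.r) (hφ : IsFunnel (S.φ (S.r - 1))) (hK2 : S.K2)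
    (hrel : ∀ k, k + 2 ≤ S.r → S.C * S.A ^ k * S.B = 0)
    (hXr : ∀ t, HasDerivAt Xr (matCLM S.augA (Xr t)) t)
    (hy : ∀ t, 0 ≤ t → S.yref t = matCLM S.augC (Xr t)) :
    0 < S.denom 0 (join S.x0 S.z0 - Xr 0) := by
  have h1 := K2.lt hK2 hrel hXr hy (i := S.r - 1) (by omega)
  have h2 := mul_nonneg (hφ.nonneg le_rfl)
    (norm_nonneg (matCLM (S.errMat (S.r - 1)) (join S.x0 S.z0 - Xr 0)))
  rw [denom, ← mul_pow]
  nlinarith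

/-- A solution of the closed loop is a classical solution which stays inside the funnel. -/
theorem IsSolution.classical (h : S.IsSolution kr ω x z) (hr : 1 ≤ S.r)
    (hφ : IsFunnel (S.φ (S.r - 1))) (hK2 : S.K2)
    (hrel : ∀ k, k + 2 ≤ S.r → S.C * S.A ^ k * S.B = 0)
    (hXr : ∀ t, HasDerivAt Xr (matCLM S.augA (Xr t)) t)
    (hy : ∀ t, 0 ≤ t → S.yref t = matCLM S.augC (Xr t)) {t : ℝ} (ht : t ∈ timeDomain ω) :
    0 < S.denom t (deviation x z Xr t) ∧
    HasDerivWithinAt (deviation x z Xr) (matCLM S.augA (deviation x z Xr t)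
      - (kr / S.denom t (deviation x z Xr t)) •
        matCLM S.augB (S.lastCLM (deviation x z Xr t))) (timeDomain ω) t := by
  have hE := h.continuousOn_deviation hXr
  have haux : ∀ t ∈ timeDomain ω, S.auxErr ω x (S.r - 1) t = S.lastCLM (deviation x z Xr t) :=
    fun t ht => h.auxErr_eq hr hrel hXr hy (by omega) ht
  have hne : ∀ t ∈ timeDomain ω, S.denom t (deviation x z Xr t) ≠ 0 := fun t ht => by
    rw [← gainDenom_eq (haux t ht)]; exact h.gain_defined t ht
  have hdc := continuousOn_denom (timeDomain_subset ω) hφ hE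
  have h0 : 0 < S.denom 0 (deviation x z Xr 0) := by
    rw [deviation, h.init_x, h.init_z]
    exact denom_init_pos hr hφ hK2 hrel hXr hy
  constructor
  · by_contra hcon
    push Not at hcon
    -- The denominator is continuous, positive at 0 by (K2) and nowhere zero, hence positive.
    obtain ⟨s, hs, hs0⟩ := (convex_timeDomain ω).isPreconnected.intermediate_value ht
      (zero_mem_timeDomain h.pos) hdc ⟨hcon, h0.le⟩
    exact hne s hs hs0
  · have hctrl : ∀ t ∈ timeDomain ω, S.ctrl kr ω x t
        = -((kr / S.denom t (deviation x z Xr t)) • S.lastCLM (deviation x z Xr t)) :=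
      fun t ht => ctrl_eq (haux t ht)
    have hctrlc : ContinuousOn (S.ctrl kr ω x) (timeDomain ω) :=
      (((continuousOn_const.div hdc hne).smul
        (S.lastCLM.continuous.comp_continuousOn hE)).neg).congr hctrl
    have h1 := hasDerivWithinAt_of_absolutelyContinuous
      (g := fun t => matCLM S.augA (join (x t) (z t)) + matCLM S.augB (S.ctrl kr ω x t))
      (fun b hb => h.absolutelyContinuous_join hb) h.ae_hasDerivAt_join
      (((matCLM S.augA).continuous.comp_continuousOn h.continuousOn_join).add
        ((matCLM S.augB).continuous.comp_continuousOn hctrlc)) ht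
    have h2 := h1.sub (hXr t).hasDerivWithinAt
    refine h2.congr_deriv ?_
    rw [hctrl t ht, map_neg, map_smul]
    simp only [deviation, map_sub]
    abel

theorem truncField_eq {δ t : ℝ} {v : EuclideanSpace ℝ (Fin n ⊕ Fin p × Fin m)}
    (hδ : δ ≤ S.denom t v) :
    truncField (matCLM S.augA) (matCLM S.augB) S.lastCLM (S.φ (S.r - 1)) kr δ t v
      = matCLM S.augA v - (kr / S.denom t v) • matCLM S.augB (S.lastCLM v) := by
  rw [denom] at hδ ⊢
  rw [truncField, max_eq_right hδ]

/-- Every solution of the closed loop agrees with a given global classical solution. -/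
theorem IsSolution.deviation_eq (h : S.IsSolution kr ω x z) (hkr : 0 < kr) (hr : 1 ≤ S.r)
    (hφ : IsFunnel (S.φ (S.r - 1))) (hK2 : S.K2)
    (hrel : ∀ k, k + 2 ≤ S.r → S.C * S.A ^ k * S.B = 0)
    (hXr : ∀ t, HasDerivAt Xr (matCLM S.augA (Xr t)) t)
    (hy : ∀ t, 0 ≤ t → S.yref t = matCLM S.augC (Xr t))
    {E : ℝ → EuclideanSpace ℝ (Fin n ⊕ Fin p × Fin m)} {δ : ℝ} (hδ : 0 < δ)
    (hE0 : E 0 = join S.x0 S.z0 - Xr 0) (hEδ : ∀ t, 0 ≤ t → δ ≤ S.denom t (E t))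
    (hE : ∀ t, 0 ≤ t → HasDerivAt E (matCLM S.augA (E t)
      - (kr / S.denom t (E t)) • matCLM S.augB (S.lastCLM (E t))) t) {t : ℝ}
    (ht : t ∈ timeDomain ω) : deviation x z Xr t = E t := by
  have hsub := Icc_subset_timeDomain ht
  have hDc := (h.continuousOn_deviation hXr).mono hsub
  have hcl := fun s hs => h.classical hr hφ hK2 hrel hXr hy (t := s) hs
  -- On the compact [0, t] the denominator of the given solution has a positive minimum δ₁. Both
  -- deviations then solve the Lipschitz field truncated at min δ δ₁.
  obtain ⟨s₀, hs₀, hmin⟩ := (isCompact_Icc (a := (0 : ℝ)) (b := t)).exists_isMinOn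
    ⟨0, le_rfl, ht.1⟩ (continuousOn_denom Icc_subset_Ici_self hφ hDc)
  set δ₁ := S.denom s₀ (deviation x z Xr s₀) with hδ₁
  have hδ₁0 : 0 < δ₁ := (hcl s₀ (hsub hs₀)).1
  refine eqOn_of_truncField (A := matCLM S.augA) (B := matCLM S.augB) (L := S.lastCLM)
    (ψ := S.φ (S.r - 1)) (δ := min δ δ₁) (b := t) hkr.le (lt_min hδ hδ₁0)
    (fun s hs => hφ.nonneg hs) hDc
    (fun s hs => (hE s hs.1).continuousAt.continuousWithinAt) ?_ ?_ ?_ ⟨ht.1, le_rfl⟩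
  · intro s hs
    have hsm : s ∈ timeDomain ω := hsub ⟨hs.1, hs.2.le⟩
    rw [truncField_eq ((min_le_right _ _).trans (hmin ⟨hs.1, hs.2.le⟩))]
    refine (hcl s hsm).2.mono_of_mem_nhdsWithin ?_
    filter_upwards [self_mem_nhdsWithin, nhdsWithin_le_nhds (Iio_mem_nhds hs.2)] with τ h1 h2
    exact hsub ⟨hs.1.trans h1, le_of_lt h2⟩
  · intro s hs
    rw [truncField_eq ((min_le_left _ _).trans (hEδ s hs.1))]
    exact (hE s hs.1).hasDerivWithinAt
  · rw [hE0, deviation, h.init_x, h.init_z]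

end LoopData

/-! ### Bounded signals and the closed loop along an error trajectory -/

theorem BoundedSignal.clm_comp {U V : Type*} [NormedAddCommGroup U] [NormedSpace ℝ U]
    [NormedAddCommGroup V] [NormedSpace ℝ V] (L : U →L[ℝ] V) {f : ℝ → U} (hf : BoundedSignal f) :
    BoundedSignal fun t => L (f t) := by
  obtain ⟨M, hM⟩ := hf
  exact ⟨‖L‖ * M, fun t ht => (L.le_opNorm _).trans (by gcongr; exact hM t ht)⟩

theorem BoundedSignal.add {U : Type*} [SeminormedAddCommGroup U] {f g : ℝ → U}
    (hf : BoundedSignal f) (hg : BoundedSignal g) : BoundedSignal fun t => f t + g t := by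
  obtain ⟨M, hM⟩ := hf
  obtain ⟨N, hN⟩ := hg
  exact ⟨M + N, fun t ht => (norm_add_le _ _).trans (add_le_add (hM t ht) (hN t ht))⟩

namespace LoopData

variable {n m p : ℕ} {S : LoopData n m p} {kr δ : ℝ}
  {Xr E : ℝ → EuclideanSpace ℝ (Fin n ⊕ Fin p × Fin m)}

/-- `Xr` is a trajectory of the uncontrolled interconnection that generates the reference signal,
and `E` is a global solution of the error dynamics that stays inside the funnel. -/
structure IsErrorTrajectory (S : LoopData n m p) (kr δ : ℝ)
    (Xr E : ℝ → EuclideanSpace ℝ (Fin n ⊕ Fin p × Fin m)) : Prop where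
  ref_deriv : ∀ t, HasDerivAt Xr (matCLM S.augA (Xr t)) t
  ref_output : ∀ t, 0 ≤ t → S.yref t = matCLM S.augC (Xr t)
  pos : 0 < δ
  init : E 0 = join S.x0 S.z0 - Xr 0
  le_denom : ∀ t, 0 ≤ t → δ ≤ S.denom t (E t)
  deriv : ∀ t, 0 ≤ t → HasDerivAt E (matCLM S.augA (E t)
    - (kr / S.denom t (E t)) • matCLM S.augB (S.lastCLM (E t))) t

namespace IsErrorTrajectory

theorem hasDerivWithinAt_errMat (h : S.IsErrorTrajectory kr δ Xr E)
    (hrel : ∀ k, k + 2 ≤ S.r → S.C * S.A ^ k * S.B = 0) {i : ℕ} (hi : i + 2 ≤ S.r) {t : ℝ}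
    (ht : 0 ≤ t) :
    HasDerivWithinAt (fun s => matCLM (S.errMat i) (E s))
      (matCLM (S.errMat i) (matCLM S.augA (E t))) (Ici 0) t := by
  have h1 := ((matCLM (S.errMat i)).hasFDerivAt.comp_hasDerivAt t
    (h.deriv t ht)).hasDerivWithinAt (s := Ici 0)
  rw [map_sub, map_smul, errMat_apply_augB hrel hi, smul_zero, sub_zero] at h1
  exact h1

theorem auxErr_eq (h : S.IsErrorTrajectory kr δ Xr E) (hr : 1 ≤ S.r)
    (hrel : ∀ k, k + 2 ≤ S.r → S.C * S.A ^ k * S.B = 0) {i : ℕ} (hi : i < S.r) {t : ℝ}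
    (ht : 0 ≤ t) :
    S.auxErr ⊤ (fun s => stateX (E s + Xr s)) i t = matCLM (S.errMat i) (E t) := by
  have hdev : deviation (fun s => stateX (E s + Xr s)) (fun s => stateZ (E s + Xr s)) Xr = E := by
    funext s
    rw [deviation, join_state, add_sub_cancel_right]
  have h1 := LoopData.auxErr_eq (S := S) (ω := ⊤) (x := fun s => stateX (E s + Xr s))
    (z := fun s => stateZ (E s + Xr s)) (Xr := Xr) hr hrel EReal.zero_lt_top h.ref_output
    (fun i hi t ht => by
      rw [hdev]
      rw [timeDomain_top] at ht ⊢
      exact h.hasDerivWithinAt_errMat hrel hi ht) i hi t (by rwa [timeDomain_top])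
  rwa [hdev] at h1

theorem continuousOn (h : S.IsErrorTrajectory kr δ Xr E) : ContinuousOn E (Ici 0) :=
  fun t ht => (h.deriv t ht).continuousAt.continuousWithinAt

theorem denom_pos (h : S.IsErrorTrajectory kr δ Xr E) {t : ℝ} (ht : 0 ≤ t) :
    0 < S.denom t (E t) :=
  h.pos.trans_le (h.le_denom t ht)

theorem isSolution (h : S.IsErrorTrajectory kr δ Xr E) (hr : 1 ≤ S.r)
    (hrel : ∀ k, k + 2 ≤ S.r → S.C * S.A ^ k * S.B = 0) (hφ : IsFunnel (S.φ (S.r - 1))) :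
    S.IsSolution kr ⊤ (fun s => stateX (E s + Xr s)) (fun s => stateZ (E s + Xr s)) := by
  have haux : ∀ t, 0 ≤ t → S.auxErr ⊤ (fun s => stateX (E s + Xr s)) (S.r - 1) t
      = S.lastCLM (E t) := fun t ht => h.auxErr_eq hr hrel (by omega) ht
  set w : ℝ → EuclideanSpace ℝ (Fin m) := fun t =>
    -((kr / S.denom t (E t)) • S.lastCLM (E t)) with hw
  have hctrl : ∀ t, 0 ≤ t → S.ctrl kr ⊤ (fun s => stateX (E s + Xr s)) t = w t :=
    fun t ht => ctrl_eq (haux t ht)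
  have hXrc : Continuous Xr := continuous_iff_continuousAt.2 fun t =>
    (h.ref_deriv t).continuousAt
  have hsum : ∀ t, 0 ≤ t → HasDerivAt (fun s => E s + Xr s)
      (matCLM S.augA (E t + Xr t) + matCLM S.augB (w t)) t := by
    intro t ht
    refine ((h.deriv t ht).add (h.ref_deriv t)).congr_deriv ?_
    rw [hw, map_add, map_neg, map_smul]
    abel
  have hcont : ContinuousOn (fun t => matCLM S.augA (E t + Xr t) + matCLM S.augB (w t))
      (Ici 0) := by
    refine ((matCLM S.augA).continuous.comp_continuousOn
      (h.continuousOn.add hXrc.continuousOn)).add ((matCLM S.augB).continuous.comp_continuousOn ?_)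
    exact ((continuousOn_const.div (continuousOn_denom subset_rfl hφ h.continuousOn)
      fun t ht => (h.denom_pos ht).ne').smul
        (S.lastCLM.continuous.comp_continuousOn h.continuousOn)).neg
  have hx : ∀ t, 0 ≤ t → HasDerivAt (fun s => stateX (E s + Xr s))
      (stateX (matCLM S.augA (E t + Xr t) + matCLM S.augB (w t))) t := fun t ht =>
    (stateX (n := n) (m := m) (p := p)).hasFDerivAt.comp_hasDerivAt t (hsum t ht)
  have hz : ∀ t, 0 ≤ t → HasDerivAt (fun s => stateZ (E s + Xr s))
      (stateZ (matCLM S.augA (E t + Xr t) + matCLM S.augB (w t))) t := fun t ht =>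
    (stateZ (n := n) (m := m) (p := p)).hasFDerivAt.comp_hasDerivAt t (hsum t ht)
  have hinit : E 0 + Xr 0 = join S.x0 S.z0 := by rw [h.init, sub_add_cancel]
  have hsplit := fun t => aug_join (S := S) (stateX (E t + Xr t)) (stateZ (E t + Xr t)) (w t)
  simp only [join_state] at hsplit
  refine ⟨EReal.zero_lt_top, fun b hb => ?_, fun b hb => ?_, ?_, ?_, fun t ht => ?_, ?_, ?_⟩
  · exact HasDerivAt.absolutelyContinuousOnInterval hb.1 hx
      ((stateX (n := n) (m := m) (p := p)).continuous.comp_continuousOn hcont)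
  · exact HasDerivAt.absolutelyContinuousOnInterval hb.1 hz
      ((stateZ (n := n) (m := m) (p := p)).continuous.comp_continuousOn hcont)
  · rw [hinit, stateX_join]
  · rw [hinit, stateZ_join]
  · rw [gainDenom_eq (haux t ht.1)]
    exact (h.denom_pos ht.1).ne'
  · refine Eventually.of_forall fun t ht => ?_
    have h1 := hx t ht.1
    rw [hsplit, stateX_join, ← hctrl t ht.1] at h1
    exact h1
  · refine Eventually.of_forall fun t ht => ?_
    have h1 := hz t ht.1
    rw [hsplit, stateZ_join, ← hctrl t ht.1] at h1
    exact h1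

theorem eqOn_of_isSolution (h : S.IsErrorTrajectory kr δ Xr E) (hkr : 0 < kr) (hr : 1 ≤ S.r)
    (hrel : ∀ k, k + 2 ≤ S.r → S.C * S.A ^ k * S.B = 0) (hφ : IsFunnel (S.φ (S.r - 1)))
    (hK2 : S.K2) {ω : EReal} {x : ℝ → EuclideanSpace ℝ (Fin n)}
    {z : ℝ → EuclideanSpace ℝ (Fin p × Fin m)} (hs : S.IsSolution kr ω x z) :
    EqOn x (fun s => stateX (E s + Xr s)) (timeDomain ω) ∧
      EqOn z (fun s => stateZ (E s + Xr s)) (timeDomain ω) := by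
  have h1 : ∀ t ∈ timeDomain ω, join (x t) (z t) = E t + Xr t := fun t ht => by
    rw [← hs.deviation_eq hkr hr hφ hK2 hrel h.ref_deriv h.ref_output h.pos h.init h.le_denom
      h.deriv ht, deviation, sub_add_cancel]
  constructor
  · intro t ht
    simp only [← h1 t ht, stateX_join]
  · intro t ht
    simp only [← h1 t ht, stateZ_join]

/-- Every solution agrees with the global one on its domain, so with ω < ∞ the global one would be a
proper extension. -/
theorem eq_of_isMaximalSolution (h : S.IsErrorTrajectory kr δ Xr E) (hkr : 0 < kr)
    (hr : 1 ≤ S.r) (hrel : ∀ k, k + 2 ≤ S.r → S.C * S.A ^ k * S.B = 0)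
    (hφ : IsFunnel (S.φ (S.r - 1))) (hK2 : S.K2) {ω : EReal}
    {x : ℝ → EuclideanSpace ℝ (Fin n)} {z : ℝ → EuclideanSpace ℝ (Fin p × Fin m)}
    (hs : S.IsMaximalSolution kr ω x z) :
    ω = ⊤ ∧ EqOn x (fun s => stateX (E s + Xr s)) (timeDomain ⊤) ∧
      EqOn z (fun s => stateZ (E s + Xr s)) (timeDomain ⊤) := by
  have heq := h.eqOn_of_isSolution hkr hr hrel hφ hK2 hs.1
  have hω : ω = ⊤ := by
    by_contra hω
    exact hs.2 ⊤ _ _ (lt_top_iff_ne_top.2 hω) (h.isSolution hr hrel hφ)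
      ⟨heq.1.symm, heq.2.symm⟩
  subst hω
  exact ⟨rfl, heq⟩

/-- Induction runs down from the last error, with d the distance to index r - 1: the bound δ on the
denominator confines e_r, and each funnel confines the previous error. -/
theorem exists_funnel_bound (h : S.IsErrorTrajectory kr δ Xr E)
    (hrel : ∀ k, k + 2 ≤ S.r → S.C * S.A ^ k * S.B = 0)
    (hφ : ∀ i, i < S.r → IsFunnel (S.φ i)) (hK1 : S.K1) (hK2 : S.K2) (d : ℕ) :
    ∀ i, i + d + 1 = S.r → ∃ ε : ℝ, 0 < ε ∧ ε < 1 ∧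
      ∀ t, 0 ≤ t → S.φ i t * ‖matCLM (S.errMat i) (E t)‖ ≤ ε := by
  induction d with
  | zero =>
    intro i hi
    obtain rfl : i = S.r - 1 := by omega
    -- The value 1/2 only secures ε > 0, since √(1 - δ) may be 0.
    refine ⟨max (1 / 2) (√(1 - δ)), lt_max_of_lt_left (by norm_num), max_lt (by norm_num) ?_,
      fun t ht => le_max_of_le_right ?_⟩
    · rw [Real.sqrt_lt' one_pos]
      linarith [h.pos]
    · refine Real.le_sqrt_of_sq_le ?_
      have h1 := h.le_denom t ht
      rw [denom] at h1
      rw [mul_pow]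
      linarith
  | succ d ih =>
    intro i hi
    obtain ⟨ε, -, hε1, hε⟩ := ih (i + 1) (by omega)
    refine exists_funnel_bound_of_cascade (hφ i (by omega)) (hφ (i + 1) (by omega))
      (κ := S.k i) (hK1 i (by omega)) (e := fun t => matCLM (S.errMat i) (E t))
      (e' := fun t => matCLM (S.errMat (i + 1)) (E t)) (fun t ht => ?_) ?_
      (fun t ht => (hε t ht).trans hε1.le)
    · refine (h.hasDerivWithinAt_errMat hrel (by omega) ht).congr_deriv ?_
      rw [errMat_succ_apply, add_sub_cancel_right]
    · rw [h.init]
      exact K2.lt hK2 hrel h.ref_deriv h.ref_output (by omega)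

theorem boundedSignal_gain (h : S.IsErrorTrajectory kr δ Xr E) (hkr : 0 < kr) (hr : 1 ≤ S.r)
    (hrel : ∀ k, k + 2 ≤ S.r → S.C * S.A ^ k * S.B = 0) :
    BoundedSignal (S.gain kr ⊤ fun s => stateX (E s + Xr s)) := by
  refine ⟨kr / δ, fun t ht => ?_⟩
  rw [gain, gainDenom_eq (h.auxErr_eq hr hrel (by omega) ht), Real.norm_of_nonneg
    (div_nonneg hkr.le (h.denom_pos ht).le)]
  exact div_le_div_of_nonneg_left hkr.le h.pos (h.le_denom t ht)

/-- By the relative degree, the derivatives of e up to order r - 1 are the linear functions 𝒞𝒜^jE of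
the deviation. -/
theorem tendsto_iteratedDerivWithin (h : S.IsErrorTrajectory kr δ Xr E) (hr : 1 ≤ S.r)
    (hrel : ∀ k, k + 2 ≤ S.r → S.C * S.A ^ k * S.B = 0) (hE : Tendsto E atTop (𝓝 0)) {i : ℕ}
    (hi : i < S.r) :
    Tendsto (fun t => iteratedDerivWithin i (S.trackErr fun s => stateX (E s + Xr s)) (Ici 0) t)
      atTop (𝓝 0) := by
  have h1 := iteratedDerivWithin_eq_of_jet (f := S.trackErr fun s => stateX (E s + Xr s))
    (N := S.r - 1) (J := fun j t => matCLM (S.augC * S.augA ^ j) (E t))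
    (fun t ht => by
      rw [trackErr_eq (z := fun s => stateZ (E s + Xr s)) hr hrel h.ref_output ht]
      rw [deviation, join_state, add_sub_cancel_right, pow_zero, Matrix.mul_one])
    (fun j hj t ht => by
      have h2 := ((matCLM (S.augC * S.augA ^ j)).hasFDerivAt.comp_hasDerivAt t
        (h.deriv t ht)).hasDerivWithinAt (s := Ici 0)
      rw [map_sub, map_smul, ← matCLM_mul, ← matCLM_mul, aug_relDegree hrel j (by omega),
        matCLM_zero, smul_zero, sub_zero, Matrix.mul_assoc, ← pow_succ] at h2
      exact h2) i (by omega)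
  have h2 := ((matCLM (S.augC * S.augA ^ i)).continuous.tendsto 0).comp hE
  rw [map_zero] at h2
  refine h2.congr' ?_
  filter_upwards [eventually_ge_atTop 0] with t ht
  exact (h1 t ht).symm

end IsErrorTrajectory

theorem IsErrorTrajectory.boundedSignal_input (h : S.IsErrorTrajectory kr δ Xr E) (hkr : 0 < kr)
    (hr : 1 ≤ S.r) (hrel : ∀ k, k + 2 ≤ S.r → S.C * S.A ^ k * S.B = 0) (hE : BoundedSignal E)
    {z : ℝ → EuclideanSpace ℝ (Fin p × Fin m)} (hz : BoundedSignal z) :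
    BoundedSignal (S.input kr ⊤ (fun s => stateX (E s + Xr s)) z) := by
  refine BoundedSignal.add (BoundedSignal.clm_comp (matCLM S.Ct) hz) ?_
  obtain ⟨G, hG⟩ := h.boundedSignal_gain hkr hr hrel
  obtain ⟨M, hM⟩ := BoundedSignal.clm_comp S.lastCLM hE
  refine ⟨G * M, fun t ht => ?_⟩
  rw [ctrl, norm_neg, norm_smul, lastErr, h.auxErr_eq hr hrel (by omega) ht]
  exact mul_le_mul (hG t ht) (hM t ht) (norm_nonneg _) ((norm_nonneg _).trans (hG t ht))

end LoopData

end FunnelIM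

/-! ### The closed-loop theorem -/

theorem mainTheorem1 {n m p : ℕ} (S : FunnelIM.LoopData n m p) (α : Polynomial ℝ)
    (hr : 1 ≤ S.r)
    (hsys : FunnelIM.InSystemClass S.A S.B S.C S.r)
    (hmonic : α.Monic)
    (hα : FunnelIM.RootsAvoidZeros S.A S.B S.C α)
    (him : FunnelIM.IsInternalModel α S.At S.Bt S.Ct)
    (href : S.yref ∈ FunnelIM.RefClass m α)
    (hφ : ∀ i, i < S.r → FunnelIM.IsFunnel (S.φ i))
    (hk : ∀ i, i + 1 < S.r → 0 < S.k i)
    (hK1 : S.K1) (hK2 : S.K2) :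
    ∃ krStar : ℝ, 0 < krStar ∧ ∀ kr : ℝ, 0 < kr →
      ∃ (ω : EReal) (x : ℝ → EuclideanSpace ℝ (Fin n))
        (z : ℝ → EuclideanSpace ℝ (Fin p × Fin m)),
        -- existence and uniqueness of a maximal solution
        S.IsMaximalSolution kr ω x z ∧
        (∀ (ω' : EReal) (x' : ℝ → EuclideanSpace ℝ (Fin n))
          (z' : ℝ → EuclideanSpace ℝ (Fin p × Fin m)), S.IsMaximalSolution kr ω' x' z' →
            ω' = ω ∧ Set.EqOn x' x (FunnelIM.timeDomain ω) ∧
              Set.EqOn z' z (FunnelIM.timeDomain ω)) ∧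
        -- (i) global existence
        ω = ⊤ ∧
        -- (ii) all errors evolve uniformly in their funnels
        (∀ i, i < S.r → ∃ ε : ℝ, 0 < ε ∧ ε < 1 ∧
          ∀ t, 0 ≤ t → S.φ i t * ‖S.auxErr ω x i t‖ ≤ ε) ∧
        -- (iii) boundedness of the signals
        FunnelIM.BoundedSignal (S.gain kr ω x) ∧
        (FunnelIM.BoundedSignal S.yref →
          FunnelIM.BoundedSignal x ∧ FunnelIM.BoundedSignal z ∧
            FunnelIM.BoundedSignal (S.input kr ω x z)) ∧
        -- (iv) asymptotic tracking for sufficiently large `k_r`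
        (krStar ≤ kr → ∀ i, i < S.r →
          Filter.Tendsto (fun t => iteratedDerivWithin i (S.trackErr x) (Set.Ici 0) t)
            Filter.atTop (𝓝 0)) := by
  obtain ⟨Ah, bh, ch, hbm⟩ := him.exists_blockModel hmonic
  have hrel := hsys.relDegree.1
  obtain ⟨Q, a, c, C, γ, hQ⟩ := S.exists_energy hr hsys hbm hk
  obtain ⟨Xr, hXr, hy, hXrb⟩ := S.exists_reference_trajectory hmonic hα hbm href
  have hφr := hφ (S.r - 1) (by omega)
  -- C and γ belong to the energy form, obtained before the gain is fixed. The threshold is the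
  -- condition C ≤ 2k_rγ for exponential decay.
  refine ⟨C / (2 * γ), div_pos hQ.C_pos (by linarith [hQ.γ_pos]), fun kr hkr => ?_⟩
  obtain ⟨E, δ, hδ, hE0, hEδ, hE, hEb, hElim⟩ := FunnelIM.exists_funnel_solution hQ hφr hkr
    (FunnelIM.LoopData.join S.x0 S.z0 - Xr 0)
    (FunnelIM.LoopData.K2.lt hK2 hrel hXr hy (by omega))
  have h : S.IsErrorTrajectory kr δ Xr E := ⟨hXr, hy, hδ, hE0, hEδ, hE⟩
  refine ⟨⊤, fun s => FunnelIM.LoopData.stateX (E s + Xr s),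
    fun s => FunnelIM.LoopData.stateZ (E s + Xr s),
    ⟨h.isSolution hr hrel hφr, fun ω' x' z' hω => absurd hω not_top_lt⟩,
    fun ω' x' z' hs => h.eq_of_isMaximalSolution hkr hr hrel hφr hK2 hs, rfl, ?_,
    h.boundedSignal_gain hkr hr hrel, ?_, ?_⟩
  · intro i hi
    obtain ⟨ε, hε0, hε1, hε⟩ := h.exists_funnel_bound hrel hφ hK1 hK2 (S.r - 1 - i) i (by omega)
    refine ⟨ε, hε0, hε1, fun t ht => ?_⟩
    rw [h.auxErr_eq hr hrel hi ht]
    exact hε t ht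
  · intro hb
    have h1 := FunnelIM.BoundedSignal.add hEb (hXrb hb)
    have hz := FunnelIM.BoundedSignal.clm_comp FunnelIM.LoopData.stateZ h1
    exact ⟨FunnelIM.BoundedSignal.clm_comp FunnelIM.LoopData.stateX h1, hz,
      h.boundedSignal_input hkr hr hrel hEb hz⟩
  · intro hle i hi
    refine h.tendsto_iteratedDerivWithin hr hrel (hElim ?_) hi
    rw [div_le_iff₀ (by linarith [hQ.γ_pos])] at hle
    linarith
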